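/- Fix the following conventions. For $r>0$ and a finite set $Q$ of points in the plane, the circular hull $\alpha_r(Q)$ exists if some disk of radius $r$ contains $Q$, and it is then the intersection of all disks of radius $r$ containing $Q$. A vertex of $\alpha_r(Q)$ is a point of $Q$ on the boundary of some disk of radius $r$ containing $Q$; a disk $D$ of radius $r$ is tangent to $\alpha_r(Q)$ at a vertex $v$ if $v\in\partial D$ and $\alpha_r(Q)\subseteq D$. For points $p\ne q$ on a common circle of radius $r$, a minor arc of $p$ and $q$ is an arc of such a circle joining $p$ and $q$ and subtending an angle of at most $180^\circ$; $cw(p,q)$ (resp. $ccw(p,q)$) is the one leading clockwise (resp. counterclockwise) around its center from $p$ to $q$. An upper (resp. lower) common tangent of $\alpha_r(L)$ and $\alpha_r(R)$ is a minor arc $cw(a,b)$ (resp. $ccw(a,b)$) whose supporting disk is tangent to $\alpha_r(L)$ at $a$ and to $\alpha_r(R)$ at $b$. **Lemma.** Let $r>0$ and let $L$ and $R$ be finite non-empty sets of points in the plane lying strictly on the two sides of a line $\ell=\{x:\langle u,x\rangle=t\}$, with $\langle u,p\rangle<t<\langle u,q\rangle$ for $p\in L$, $q\in R$. Assume general position: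 no point of $L\cup R$ is on a minor arc (of radius $r$) of two other points of $L\cup R$. Suppose that $\alpha_r(L)$ and $\alpha_r(R)$ exist and that they are given, together with $r$ and $\ell$ (that is, $u$ and $t$), as follows: the vertices of $\alpha_r(L)$, in counterclockwise order from a vertex farthest in direction $u$, are stored in symmetric order in a balanced binary tree (of height at most a constant $\beta$ times the binary logarithm of its number of nodes plus one), each node also holding the two neighbors of its vertex on the hull; and the vertices of $\alpha_r(R)$, in clockwise order from a vertex farthest in direction $-u$, are stored likewise in a second tree. Then one fixed algorithm (a finite program on a real RAM with unit-cost operations $+,-,\cdot,/,\sqrt{\ }$ and comparisons on exact reals, which follows child pointers of the trees) does the following, on all such inputs, in at most $C\log(|L|+|R|)$ steps, where $C$ depends only on $\beta$: it determines whether $\alpha_r(L\cup R)$ exists; if so, it either correctly reports a dominating case, $R\subseteq\alpha_r(L)$ or $L\subseteq\alpha_r(R)$, or, if neither dominating case happens, it computes points $a_1,b_1\in L$ and $a_2,b_2\in R$ such that $cw(a_1,a_2)$ is the unique upper common tangent and $ccw(b_1,b_2)$ the unique lower common tangent of $\alpha_r(L)$ and $\alpha_r(R)$. -/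

import Mathlib

namespace CircularHull

open Metric

/-! ### Geometry of circular hulls -/

/-- The Euclidean plane. -/
abbrev Plane : Type := EuclideanSpace ℝ (Fin 2)

/-- The planar cross product; `0 < cross (b - a) (c - a)` says that `a, b, c` is a left
(counterclockwise) turn. -/
def cross (a b : Plane) : ℝ := a 0 * b 1 - a 1 * b 0

/-- The disk of radius `r` with center `c` covers `Q`. -/
def Covers (r : ℝ) (c : Plane) (Q : Set Plane) : Prop := Q ⊆ closedBall c r

/-- The circular hull of `Q` exists: some disk of radius `r` covers `Q`. -/
def HullExists (r : ℝ) (Q : Set Plane) : Prop := ∃ c, Covers r c Q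

/-- The circular hull of `Q`: the common intersection of all disks of radius `r` covering `Q`. -/
def hull (r : ℝ) (Q : Set Plane) : Set Plane := ⋂ c ∈ {c | Covers r c Q}, closedBall c r

/-- `v` is a vertex of the circular hull of `Q`: a point of `Q` that lies on the boundary of some
disk of radius `r` covering `Q`. -/
def IsVertex (r : ℝ) (Q : Set Plane) (v : Plane) : Prop :=
  v ∈ Q ∧ ∃ c, Covers r c Q ∧ v ∈ sphere c r

/-- `s` lies on the minor arc `cw(p, q)` of radius `r`: the arc, subtending an angle of at most
`180` degrees, that leads clockwise around its center `c` from `p` to `q`. The minor arc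
`ccw(p, q)` is `cw(q, p)`. -/
def OnCwArc (r : ℝ) (p q s : Plane) : Prop :=
  ∃ c, p ∈ sphere c r ∧ q ∈ sphere c r ∧ cross (p - c) (q - c) ≤ 0 ∧
    s ∈ sphere c r ∧ 0 ≤ cross (q - p) (s - p)

/-- No point of `Q` is on a minor arc of two other points of `Q`. -/
def GeneralPosition (r : ℝ) (Q : Set Plane) : Prop :=
  ∀ p ∈ Q, ∀ q ∈ Q, ∀ s ∈ Q, p ≠ q → s ≠ p → s ≠ q → ¬ OnCwArc r p q s

/-- The disk of radius `r` with center `c` is tangent to the circular hull of `Q` at its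
vertex `v`. -/
def IsTangentAt (r : ℝ) (Q : Set Plane) (c v : Plane) : Prop :=
  IsVertex r Q v ∧ v ∈ sphere c r ∧ hull r Q ⊆ closedBall c r

/-- `cw(a, b)` is an upper common tangent of the hulls of `L` and `R`: some disk of radius `r` is
tangent to the first hull at `a` and to the second at `b`, and its minor arc connecting `a` and `b`
leads clockwise from `a` to `b`. -/
def IsUpperTangent (r : ℝ) (L R : Set Plane) (a b : Plane) : Prop :=
  ∃ c, IsTangentAt r L c a ∧ IsTangentAt r R c b ∧ cross (a - c) (b - c) ≤ 0

/-- `ccw(a, b)` is a lower common tangent of the hulls of `L` and `R`: as before, with the minor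
arc leading counterclockwise from `a` to `b`. -/
def IsLowerTangent (r : ℝ) (L R : Set Plane) (a b : Plane) : Prop :=
  ∃ c, IsTangentAt r L c a ∧ IsTangentAt r R c b ∧ 0 ≤ cross (a - c) (b - c)

/-! ### Hulls stored in balanced binary search trees -/

/-- The record in a tree node: a hull vertex and its two neighbors on the hull (`prev` and `next`
refer to the cyclic order in which the vertices are stored). -/
structure VertexRecord where
  pt : Plane
  prev : Plane
  next : Plane

abbrev HullTree : Type := BinaryTree VertexRecord

/-- The records of a tree in symmetric order. -/
def inorder : HullTree → List VertexRecord
  | .nil => []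
  | .node x l r => inorder l ++ x :: inorder r

/-- Height at most `β` times the binary logarithm of the number of nodes plus one. -/
def Balanced (β : ℝ) (T : HullTree) : Prop :=
  (T.height : ℝ) ≤ β * Real.logb 2 (T.numNodes + 1)

/-- The symmetric order of `T` is `l`, each point coming with its cyclic neighbors in `l`. -/
def StoresList (T : HullTree) (l : List Plane) : Prop :=
  (inorder T).map VertexRecord.pt = l ∧
  (inorder T).map VertexRecord.next = l.rotate 1 ∧
  (inorder T).map VertexRecord.prev = l.rotate (l.length - 1)

/-- `l` lists the vertices of the circular hull of `Q`, each of them once, starting from one that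
is farthest in direction `u`. -/
def ListsVertices (r : ℝ) (Q : Set Plane) (u : Plane) (l : List Plane) : Prop :=
  l.Nodup ∧ (∀ v, v ∈ l ↔ IsVertex r Q v) ∧
  ∀ c ∈ l.head?, ∀ v ∈ l, inner ℝ u v ≤ inner ℝ u c

/-- `T` stores the vertices of the circular hull of `Q` in counterclockwise order, starting from
one that is farthest in direction `u`. -/
def StoresHullCcw (r : ℝ) (Q : Set Plane) (u : Plane) (T : HullTree) : Prop :=
  ∃ l, ListsVertices r Q u l ∧ l.Triplewise (fun a b c => 0 < cross (b - a) (c - a)) ∧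
    StoresList T l

/-- `T` stores the vertices of the circular hull of `Q` in clockwise order, starting from
one that is farthest in direction `u`. -/
def StoresHullCw (r : ℝ) (Q : Set Plane) (u : Plane) (T : HullTree) : Prop :=
  ∃ l, ListsVertices r Q u l ∧ l.Triplewise (fun a b c => cross (b - a) (c - a) < 0) ∧
    StoresList T l

/-! ### The machine model

Finite programs on a real RAM with real registers and pointer registers. A pointer is null or
refers to a node of one of the input trees, that is, to the subtree below it. A program can follow
child pointers, read the coordinates stored in a node, compute with exact reals
(`+`, `-`, `*`, `/`, square root) and compare them. Each elementary operation costs one unit. -/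

structure State where
  re : ℕ → ℝ
  ptr : ℕ → HullTree

inductive PtrExpr
  | reg (j : ℕ)
  | left (p : PtrExpr)
  | right (p : PtrExpr)

inductive Field
  | pt
  | prev
  | next

inductive RealExpr
  | reg (i : ℕ)
  | const (q : ℚ)
  | coord (f : Field) (k : Fin 2) (p : PtrExpr)
  | add (e₁ e₂ : RealExpr)
  | sub (e₁ e₂ : RealExpr)
  | mul (e₁ e₂ : RealExpr)
  | div (e₁ e₂ : RealExpr)
  | sqrt (e : RealExpr)

inductive Test
  | le (e₁ e₂ : RealExpr)
  | isNil (p : PtrExpr)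
  | not (b : Test)
  | and (b₁ b₂ : Test)

inductive Program
  | skip
  | setReal (i : ℕ) (e : RealExpr)
  | setPtr (j : ℕ) (p : PtrExpr)
  | seq (P₁ P₂ : Program)
  | cond (b : Test) (P₁ P₂ : Program)
  | loop (b : Test) (P : Program)

/-- A child of a null pointer is null. -/
def leftChild : HullTree → HullTree
  | .nil => .nil
  | .node _ l _ => l

def rightChild : HullTree → HullTree
  | .nil => .nil
  | .node _ _ r => r

/-- Reading a coordinate; a null pointer yields `0`. -/
def readCoord (f : Field) (k : Fin 2) : HullTree → ℝ
  | .nil => 0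
  | .node x _ _ => match f with
    | .pt => x.pt k
    | .prev => x.prev k
    | .next => x.next k

def PtrExpr.eval (s : State) : PtrExpr → HullTree
  | .reg j => s.ptr j
  | .left p => leftChild (p.eval s)
  | .right p => rightChild (p.eval s)

def PtrExpr.cost : PtrExpr → ℕ
  | .reg _ => 1
  | .left p => p.cost + 1
  | .right p => p.cost + 1

noncomputable def RealExpr.eval (s : State) : RealExpr → ℝ
  | .reg i => s.re i
  | .const q => (q : ℝ)
  | .coord f k p => readCoord f k (p.eval s)
  | .add e₁ e₂ => e₁.eval s + e₂.eval s
  | .sub e₁ e₂ => e₁.eval s - e₂.eval s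
  | .mul e₁ e₂ => e₁.eval s * e₂.eval s
  | .div e₁ e₂ => e₁.eval s / e₂.eval s
  | .sqrt e => Real.sqrt (e.eval s)

def RealExpr.cost : RealExpr → ℕ
  | .reg _ => 1
  | .const _ => 1
  | .coord _ _ p => p.cost + 1
  | .add e₁ e₂ => e₁.cost + e₂.cost + 1
  | .sub e₁ e₂ => e₁.cost + e₂.cost + 1
  | .mul e₁ e₂ => e₁.cost + e₂.cost + 1
  | .div e₁ e₂ => e₁.cost + e₂.cost + 1
  | .sqrt e => e.cost + 1

def Test.Holds (s : State) : Test → Prop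
  | .le e₁ e₂ => e₁.eval s ≤ e₂.eval s
  | .isNil p => p.eval s = .nil
  | .not b => ¬ b.Holds s
  | .and b₁ b₂ => b₁.Holds s ∧ b₂.Holds s

def Test.cost : Test → ℕ
  | .le e₁ e₂ => e₁.cost + e₂.cost + 1
  | .isNil p => p.cost + 1
  | .not b => b.cost + 1
  | .and b₁ b₂ => b₁.cost + b₂.cost + 1

/-- `Runs P s n s'`: started in state `s`, the program `P` halts in state `s'` after `n` steps. -/
inductive Runs : Program → State → ℕ → State → Prop
  | skip (s : State) : Runs .skip s 1 s
  | setReal (i : ℕ) (e : RealExpr) (s : State) :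
      Runs (.setReal i e) s (e.cost + 1) { s with re := Function.update s.re i (e.eval s) }
  | setPtr (j : ℕ) (p : PtrExpr) (s : State) :
      Runs (.setPtr j p) s (p.cost + 1) { s with ptr := Function.update s.ptr j (p.eval s) }
  | seq {P₁ P₂ : Program} {s₁ s₂ s₃ : State} {m n : ℕ} :
      Runs P₁ s₁ m s₂ → Runs P₂ s₂ n s₃ → Runs (.seq P₁ P₂) s₁ (m + n) s₃
  | condTrue {b : Test} {P₁ P₂ : Program} {s s' : State} {n : ℕ} :
      b.Holds s → Runs P₁ s n s' → Runs (.cond b P₁ P₂) s (b.cost + 1 + n) s'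
  | condFalse {b : Test} {P₁ P₂ : Program} {s s' : State} {n : ℕ} :
      ¬ b.Holds s → Runs P₂ s n s' → Runs (.cond b P₁ P₂) s (b.cost + 1 + n) s'
  | loopTrue {b : Test} {P : Program} {s₁ s₂ s₃ : State} {m n : ℕ} :
      b.Holds s₁ → Runs P s₁ m s₂ → Runs (.loop b P) s₂ n s₃ →
        Runs (.loop b P) s₁ (b.cost + 1 + m + n) s₃
  | loopFalse {b : Test} {P : Program} {s : State} :
      ¬ b.Holds s → Runs (.loop b P) s (b.cost + 1) s

/-! ### Input and output of the common tangent problem -/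

/-- The input: the radius `r`, the separating line `{x | ⟪u, x⟫ = t}` and the roots of the two
trees. -/
noncomputable def inputState (r : ℝ) (u : Plane) (t : ℝ) (T₁ T₂ : HullTree) : State where
  re := fun i => match i with
    | 0 => r
    | 1 => u 0
    | 2 => u 1
    | 3 => t
    | _ => 0
  ptr := fun j => match j with
    | 0 => T₁
    | 1 => T₂
    | _ => .nil

inductive Outcome
  | noHull
  | leftDominates
  | rightDominates
  | tangents (a₁ a₂ b₁ b₂ : Plane)

/-- The outcome that a final state reports: register `0` holds its kind, and for tangents the
registers `1` to `8` hold the coordinates of the four tangent points. -/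
def Reports (s : State) : Outcome → Prop
  | .noHull => s.re 0 = 0
  | .leftDominates => s.re 0 = 1
  | .rightDominates => s.re 0 = 2
  | .tangents a₁ a₂ b₁ b₂ => s.re 0 = 3 ∧
      a₁ = !₂[s.re 1, s.re 2] ∧ a₂ = !₂[s.re 3, s.re 4] ∧
      b₁ = !₂[s.re 5, s.re 6] ∧ b₂ = !₂[s.re 7, s.re 8]

/-- The outcome is right: the hull of `L ∪ R` does not exist; or it exists and one of the sets lies
in the hull of the other; or it exists, neither set dominates, and the upper and the lower common
tangent are `cw(a₁, a₂)` and `ccw(b₁, b₂)`, there being no other common tangents. -/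
def Correct (r : ℝ) (L R : Set Plane) : Outcome → Prop
  | .noHull => ¬ HullExists r (L ∪ R)
  | .leftDominates => HullExists r (L ∪ R) ∧ R ⊆ hull r L
  | .rightDominates => HullExists r (L ∪ R) ∧ L ⊆ hull r R
  | .tangents a₁ a₂ b₁ b₂ => HullExists r (L ∪ R) ∧ ¬ R ⊆ hull r L ∧ ¬ L ⊆ hull r R ∧
      (∀ a b, IsUpperTangent r L R a b ↔ a = a₁ ∧ b = a₂) ∧
      (∀ a b, IsLowerTangent r L R a b ↔ a = b₁ ∧ b = b₂)

end CircularHull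

/-! A disk of radius `r` is replaced by its center. Take coordinates with the first axis along `u`,
so that `L` lies to the left of `R`. A center covers a set if and only if it lies above the lower
half circles and below the upper half circles of radius `r` around all points of the set. The upper
envelope of the lower half circles thus bounds the feasible centers from below, and the points that
attain it are hull vertices on the upper half of the touching disk. The other boundary is the same
thing after a reflection. Two lower half circles cross at most once, because the half circle is
strictly concave as a function (`psi_increment`). Along the part of the vertex cycle that runs
against the axis, the values of the half circles at a fixed abscissa therefore have no valley,
general position excluding ties (`Chain.no_valley`). So a search tree can locate the vertex that
attains the envelope at a given abscissa, and hence decide in logarithmic time whether a given disk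
covers a set.

Existence. Call a center equidistant if its farthest distances to `L` and to `R` agree and are at
most `r`. If there is an equidistant center, the lowest one has distance exactly `r` and the
orientation of the upper tangent, since otherwise it could be moved further down
(`Equidistant.exists_upper`); reflection gives the lower tangent. If there is none, the intermediate
value theorem on segments of centers shows that one set dominates or no disk covers both
(`cov_of_far_lt`, `Separated.dominates`). Conversely a common tangent excludes domination
(`exists_cov_not_cov`). A tangent of each kind is unique, because no vertex lies in the cap cut off
by a minor arc (`GenPos.eq_of_orient_nonneg`, `upper_unique`).

Search. The center of a tangent disk lies on one boundary of the feasible centers of `L` and on one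
of those of `R`. For the upper tangent the touching points are both on the upper half of the disk,
or one is on the upper and one on the lower half; both on the lower half would give the wrong
orientation. In each of the three cases two trees are searched simultaneously. At the current edge
of each tree the two half circles cross at a computable abscissa. Comparing the crossings of the two
trees tells, for one of them, on which side the unknown center lies (`meet_rules`,
`opposite_rules`), so every step moves a cursor down, and the number of steps is at most the sum of
the heights.

The cases are not distinguished in advance. Every search is run, and its result is kept only if the
disk through the two points found covers both sets. If both tangents are found they are reported.
Otherwise there is no equidistant center, and it suffices to test, for one disk covering `L` with a
vertex on its boundary, whether it covers `R`, and likewise with the roles exchanged. -/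

namespace CircularHull

/-! ### Program semantics -/

/-- The effect of a program without loops. -/
noncomputable def Program.act : Program → State → State
  | .skip, s => s
  | .setReal i e, s => { s with re := Function.update s.re i (e.eval s) }
  | .setPtr j p, s => { s with ptr := Function.update s.ptr j (p.eval s) }
  | .seq P Q, s => Q.act (P.act s)
  | .cond b P Q, s => by
      classical exact if b.Holds s then P.act s else Q.act s
  | .loop _ _, s => s

def Program.LoopFree : Program → Prop
  | .skip => True
  | .setReal _ _ => True
  | .setPtr _ _ => True
  | .seq P Q => P.LoopFree ∧ Q.LoopFree
  | .cond _ P Q => P.LoopFree ∧ Q.LoopFree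
  | .loop _ _ => False

/-- A bound for the cost of a program, every loop being charged one iteration. -/
def Program.weight : Program → ℕ
  | .skip => 1
  | .setReal _ e => e.cost + 1
  | .setPtr _ p => p.cost + 1
  | .seq P Q => P.weight + Q.weight
  | .cond b P Q => b.cost + 1 + P.weight + Q.weight
  | .loop b P => b.cost + 1 + P.weight

theorem Program.LoopFree.runs {P : Program} (hP : P.LoopFree) (s : State) :
    ∃ n, n ≤ P.weight ∧ Runs P s n (P.act s) := by
  induction P generalizing s with
  | skip => exact ⟨1, le_rfl, .skip s⟩
  | setReal i e => exact ⟨_, le_rfl, .setReal i e s⟩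
  | setPtr j p => exact ⟨_, le_rfl, .setPtr j p s⟩
  | seq P Q ihP ihQ =>
    obtain ⟨m, hm, h1⟩ := ihP hP.1 s
    obtain ⟨n, hn, h2⟩ := ihQ hP.2 (P.act s)
    exact ⟨m + n, Nat.add_le_add hm hn, .seq h1 h2⟩
  | cond b P Q ihP ihQ =>
    by_cases hb : b.Holds s
    · obtain ⟨m, hm, h1⟩ := ihP hP.1 s
      refine ⟨b.cost + 1 + m, ?_, ?_⟩
      · simp only [Program.weight]; omega
      · simpa [Program.act, hb] using Runs.condTrue (P₂ := Q) hb h1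
    · obtain ⟨m, hm, h1⟩ := ihQ hP.2 s
      refine ⟨b.cost + 1 + m, ?_, ?_⟩
      · simp only [Program.weight]; omega
      · simpa [Program.act, hb] using Runs.condFalse (P₁ := P) hb h1
  | loop b P _ => exact hP.elim

/-- Started in `s`, the program `P` halts within `P.weight * (h + 1)` steps in a state with the
property `Post`. -/
def Ensures (h : ℕ) (P : Program) (s : State) (Post : State → Prop) : Prop :=
  ∃ n s', Runs P s n s' ∧ n ≤ P.weight * (h + 1) ∧ Post s'

theorem Ensures.mono {h : ℕ} {P : Program} {s : State} {Q Q' : State → Prop}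
    (hP : Ensures h P s Q) (hQ : ∀ s', Q s' → Q' s') : Ensures h P s Q' := by
  obtain ⟨n, s', h1, h2, h3⟩ := hP
  exact ⟨n, s', h1, h2, hQ s' h3⟩

theorem Ensures.of_act {h : ℕ} {P : Program} (hP : P.LoopFree) {s : State} {Q : State → Prop}
    (hQ : Q (P.act s)) : Ensures h P s Q := by
  obtain ⟨n, hn, hr⟩ := hP.runs s
  exact ⟨n, _, hr, hn.trans (Nat.le_mul_of_pos_right _ (Nat.succ_pos h)), hQ⟩

theorem Ensures.seq {h : ℕ} {P P' : Program} {s : State} {Q Q' : State → Prop}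
    (h1 : Ensures h P s Q) (h2 : ∀ s', Q s' → Ensures h P' s' Q') :
    Ensures h (.seq P P') s Q' := by
  obtain ⟨n, s', hr, hn, hq⟩ := h1
  obtain ⟨m, s'', hr', hm, hq'⟩ := h2 s' hq
  refine ⟨n + m, s'', .seq hr hr', ?_, hq'⟩
  simp only [Program.weight, Nat.add_mul]
  omega

theorem Ensures.cond {h : ℕ} {b : Test} {P P' : Program} {s : State} {Q : State → Prop}
    (h1 : b.Holds s → Ensures h P s Q) (h2 : ¬ b.Holds s → Ensures h P' s Q) :
    Ensures h (.cond b P P') s Q := by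
  by_cases hb : b.Holds s
  · obtain ⟨n, s', hr, hn, hq⟩ := h1 hb
    refine ⟨b.cost + 1 + n, s', .condTrue hb hr, ?_, hq⟩
    simp only [Program.weight, Nat.add_mul]
    nlinarith
  · obtain ⟨n, s', hr, hn, hq⟩ := h2 hb
    refine ⟨b.cost + 1 + n, s', .condFalse hb hr, ?_, hq⟩
    simp only [Program.weight, Nat.add_mul]
    nlinarith

/-- Every iteration lowers the measure, which is at most `h` at the start, so there are at most `h`
iterations and one more test. The body is free of loops, so loops are not nested and the bound stays
linear in `h`. -/
theorem Ensures.loop {h : ℕ} {b : Test} {P : Program} (hP : P.LoopFree) (Inv : State → Prop)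
    (μ : State → ℕ)
    (hstep : ∀ s, Inv s → b.Holds s → Inv (P.act s) ∧ μ (P.act s) < μ s)
    {s : State} (hs : Inv s) (hμ : μ s ≤ h) :
    Ensures h (.loop b P) s (fun s' => Inv s' ∧ ¬ b.Holds s') := by
  have key : ∀ k s, Inv s → μ s ≤ k → ∃ n s', Runs (.loop b P) s n s' ∧
      n ≤ (b.cost + 1 + P.weight) * (k + 1) ∧ Inv s' ∧ ¬ b.Holds s' := by
    intro k
    induction k with
    | zero =>
      intro s hs hk
      have hb : ¬ b.Holds s := fun hb => by have := (hstep s hs hb).2; omega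
      exact ⟨_, s, .loopFalse hb, by omega, hs, hb⟩
    | succ k ih =>
      intro s hs hk
      by_cases hb : b.Holds s
      · obtain ⟨h1, h2⟩ := hstep s hs hb
        obtain ⟨m, hm, hr⟩ := hP.runs s
        obtain ⟨n, s', hr', hn, hi, hb'⟩ := ih (P.act s) h1 (by omega)
        refine ⟨_, s', .loopTrue hb hr hr', ?_, hi, hb'⟩
        rw [Nat.mul_succ]
        omega
      · refine ⟨_, s, .loopFalse hb, ?_, hs, hb⟩
        nlinarith [Nat.zero_le k, Nat.zero_le (b.cost + 1 + P.weight), Nat.zero_le P.weight,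
          Nat.zero_le ((b.cost + 1 + P.weight) * (k + 1))]
  obtain ⟨n, s', hr, hn, hq⟩ := key h s hs hμ
  exact ⟨n, s', hr, hn, hq⟩

/-! ### Descending in a search tree -/

open Classical in
/-- Descend in a tree, to the right at `x` if `A x` and to the left otherwise. The result is the
point that separates the last record passed on the left from the first one passed on the right. -/
noncomputable def find (A : VertexRecord → Prop) : HullTree → Plane → Plane
  | .nil, w => w
  | .node x l r, w => if A x then find A r x.next else find A l x.pt

/-- A search evaluates its predicate only at records of the tree. This lets a computable test
replace an ideal predicate. -/
theorem find_congr {A B : VertexRecord → Prop} :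
    ∀ {T : HullTree} (w : Plane) (_ : ∀ x ∈ inorder T, A x ↔ B x), find A T w = find B T w
  | .nil, _, _ => rfl
  | .node x l r, _, h => by
    have hx : A x ↔ B x := h x (by simp [inorder])
    have hl : ∀ w, find A l w = find B l w :=
      fun w => find_congr w fun y hy => h y (by simp [inorder, hy])
    have hr : ∀ w, find A r w = find B r w :=
      fun w => find_congr w fun y hy => h y (by simp [inorder, hy])
    by_cases hA : A x
    · simp only [find, hA, hx.1 hA, if_true, hr]
    · have hB : ¬ B x := fun hB => hA (hx.2 hB)
      simp only [find, hA, hB, if_false, hl]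

/-- The point carried along is the separator for the subtree that has become empty: the `next` of
the last record passed on the left, which is also the `pt` of the first one on the right. The last
hypothesis covers the empty subtree, where the point carried along is the answer. -/
theorem find_eq {A : VertexRecord → Prop} {v : Plane} :
    ∀ {T : HullTree} {w : Plane} {pre post : List VertexRecord}, inorder T = pre ++ post →
      (∀ x ∈ pre, A x) → (∀ x ∈ post, ¬ A x) → (∀ x ∈ pre.getLast?, x.next = v) →
      (∀ x ∈ post.head?, x.pt = v) → (inorder T = [] → w = v) → find A T w = v
  | .nil, _, _, _, _, _, _, _, _, hw => hw rfl
  | .node x l r, w, pre, post, h, hpre, hpost, hlast, hhead, hw => by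
    rw [inorder] at h
    by_cases hx : A x
    · simp only [find, hx, if_true]
      obtain ⟨pre', rfl, h'⟩ : ∃ pre', pre = inorder l ++ x :: pre' ∧ inorder r = pre' ++ post := by
        rcases List.append_eq_append_iff.1 h with ⟨a, ha, hb⟩ | ⟨a, ha, hb⟩
        · rcases a with _ | ⟨y, a⟩
          · simp only [List.nil_append] at hb
            exact absurd hx (hpost x (by rw [← hb]; simp))
          · simp only [List.cons_append, List.cons.injEq] at hb
            exact ⟨a, by rw [ha, hb.1], hb.2⟩
        · exact absurd hx (hpost x (by rw [hb]; simp))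
      refine find_eq h' (fun y hy => hpre y (by simp [hy])) hpost ?_ hhead ?_
      · intro y hy
        apply hlast
        rw [List.getLast?_append, List.getLast?_cons]
        simp only [Option.mem_def] at hy
        simp [hy]
      · intro hr
        have : pre' = [] := by
          rw [hr] at h'
          exact (List.append_eq_nil_iff.1 h'.symm).1
        subst this
        exact hlast x (by simp)
    · simp only [find, hx, if_false]
      obtain ⟨post', rfl, h'⟩ :
          ∃ post', post = post' ++ x :: inorder r ∧ inorder l = pre ++ post' := by
        rcases List.append_eq_append_iff.1 h with ⟨a, ha, hb⟩ | ⟨a, ha, hb⟩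
        · rcases a with _ | ⟨y, a⟩
          · simp only [List.nil_append] at hb
            exact ⟨[], by simp [hb], by simpa using ha.symm⟩
          · simp only [List.cons_append, List.cons.injEq] at hb
            exact absurd (hpre x (by rw [ha, hb.1]; simp)) hx
        · exact ⟨a, hb, ha⟩
      refine find_eq h' hpre (fun y hy => hpost y (by simp [hy])) hlast ?_ ?_
      · intro y hy
        apply hhead
        rw [List.head?_append]
        simp only [Option.mem_def] at hy
        simp [hy]
      · intro hl
        have : post' = [] := by
          rw [hl] at h'
          exact (List.append_eq_nil_iff.1 h'.symm).2
        subst this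
        exact hhead x (by simp)

/-! ### Arcs of circles as functions -/

/-- The height of the circle of radius `r` around `0` over `s`. -/
noncomputable def psi (r s : ℝ) : ℝ := Real.sqrt (r * r - s * s)

/-- The lower half of the circle of radius `r` around `v`, as a function. -/
noncomputable def lo (r : ℝ) (v : ℝ × ℝ) (X : ℝ) : ℝ := v.2 - psi r (X - v.1)

theorem psi_nonneg (r s : ℝ) : 0 ≤ psi r s := Real.sqrt_nonneg _

theorem psi_neg (r s : ℝ) : psi r (-s) = psi r s := by simp [psi]

theorem lo_neg (r x y X : ℝ) : lo r (-x, y) (-X) = lo r (x, y) X := by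
  simp only [lo]
  rw [show -X - -x = -(X - x) by ring, psi_neg]

theorem mul_self_le_of_abs_le {r s : ℝ} (hs : |s| ≤ r) : s * s ≤ r * r :=
  mul_self_le_mul_self (abs_nonneg s) hs |>.trans' (abs_mul_abs_self s).ge

theorem psi_sq {r s : ℝ} (hs : |s| ≤ r) : psi r s * psi r s = r * r - s * s :=
  Real.mul_self_sqrt (by linarith [mul_self_le_of_abs_le hs])

theorem continuous_psi (r : ℝ) : Continuous (psi r) := by
  unfold psi; fun_prop

theorem continuous_lo (r : ℝ) (v : ℝ × ℝ) : Continuous (lo r v) := by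
  unfold lo
  exact continuous_const.sub ((continuous_psi r).comp (continuous_id.sub continuous_const))

theorem le_psi_of_sq_le {r s h : ℝ} (hh : s * s + h * h ≤ r * r) : h ≤ psi r s := by
  unfold psi
  exact Real.le_sqrt_of_sq_le (by nlinarith)

theorem strictConcaveOn_psi (r : ℝ) : StrictConcaveOn ℝ (Set.Icc (-r) r) (psi r) := by
  refine ⟨convex_Icc _ _, fun x hx y hy hxy a b ha hb hab => ?_⟩
  have hx' := psi_sq (abs_le.2 hx)
  have hy' := psi_sq (abs_le.2 hy)
  have px := psi_nonneg r x
  have py := psi_nonneg r y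
  simp only [smul_eq_mul]
  refine Real.lt_sqrt_of_sq_lt ?_
  obtain rfl : b = 1 - a := by linarith
  have hxy' : 0 < (x - y) ^ 2 := by
    have := sub_ne_zero.2 hxy
    positivity
  -- This is the exact difference between the squared height of the half circle over the convex
  -- combination and the square of the convex combination of the heights.
  have h1 : 0 < a * (1 - a) * ((x - y) ^ 2 + (psi r x - psi r y) ^ 2) := by
    have := mul_pos ha hb
    have h2 := sq_nonneg (psi r x - psi r y)
    exact mul_pos this (by linarith)
  nlinarith

/-- The increments of `psi` are strictly decreasing. -/
theorem psi_increment {r a h k : ℝ} (ha : -r ≤ a) (hh : 0 < h) (hk : 0 < k) (hb : a + h + k ≤ r) :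
    psi r a + psi r (a + h + k) < psi r (a + h) + psi r (a + k) := by
  have hhk : 0 < h + k := by linarith
  have m1 : a ∈ Set.Icc (-r) r := ⟨ha, by linarith⟩
  have m2 : a + h + k ∈ Set.Icc (-r) r := ⟨by linarith, hb⟩
  -- The two inner points are convex combinations of the two outer ones with exchanged weights, so
  -- the two concavity inequalities add up to the claim.
  have p1 : 0 < k / (h + k) := by positivity
  have p2 : 0 < h / (h + k) := by positivity
  have p3 : k / (h + k) + h / (h + k) = 1 := by field_simp; ring
  have h1 := (strictConcaveOn_psi r).2 m1 m2 (by linarith) p1 p2 p3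
  have h2 := (strictConcaveOn_psi r).2 m1 m2 (by linarith) p2 p1 (by linarith)
  simp only [smul_eq_mul] at h1 h2
  rw [show k / (h + k) * a + h / (h + k) * (a + h + k) = a + h by field_simp; ring] at h1
  rw [show h / (h + k) * a + k / (h + k) * (a + h + k) = a + k by field_simp; ring] at h2
  have h3 : k / (h + k) * psi r a + h / (h + k) * psi r (a + h + k) +
      (h / (h + k) * psi r a + k / (h + k) * psi r (a + h + k)) = psi r a + psi r (a + h + k) := by
    field_simp; ring
  linarith

/-- Lower half circles cross at most once. -/
theorem lo_sub_lo_lt {r : ℝ} {v w : ℝ × ℝ} {X X' : ℝ} (hvw : v.1 < w.1) (hX : X < X')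
    (h1 : |X - w.1| ≤ r) (h2 : |X' - v.1| ≤ r) :
    lo r v X - lo r w X < lo r v X' - lo r w X' := by
  have := psi_increment (r := r) (a := X - w.1) (h := X' - X) (k := w.1 - v.1)
    (abs_le.1 h1).1 (by linarith) (by linarith) (by linarith [(abs_le.1 h2).2])
  rw [show X - w.1 + (X' - X) + (w.1 - v.1) = X' - v.1 by ring,
    show X - w.1 + (X' - X) = X' - w.1 by ring, show X - w.1 + (w.1 - v.1) = X - v.1 by ring] at this
  simp only [lo]
  linarith

/-- The sum of two lower half circles increases to the right of the midpoint. -/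
theorem lo_add_lo_lt {r : ℝ} {v w : ℝ × ℝ} {X X' : ℝ} (hX : X < X') (hmid : v.1 + w.1 ≤ 2 * X)
    (h2 : |X' - v.1| ≤ r) (h4 : |X' - w.1| ≤ r) :
    lo r v X + lo r w X < lo r v X' + lo r w X' := by
  -- As `psi` is even, the second circle may be reflected. The arguments `w.1 - X'`, `w.1 - X`, `X -
  -- v.1`, `X' - v.1` then have the pattern `a`, `a + h`, `a + k`, `a + h + k`, and `k` is positive
  -- by `hmid`.
  have := psi_increment (r := r) (a := w.1 - X') (h := X' - X) (k := X + X' - v.1 - w.1)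
    (by linarith [(abs_le.1 h4).2]) (by linarith) (by linarith) (by linarith [(abs_le.1 h2).2])
  rw [show w.1 - X' + (X' - X) + (X + X' - v.1 - w.1) = X' - v.1 by ring,
    show w.1 - X' + (X' - X) = -(X - w.1) by ring,
    show w.1 - X' + (X + X' - v.1 - w.1) = X - v.1 by ring,
    show w.1 - X' = -(X' - w.1) by ring, psi_neg, psi_neg] at this
  simp only [lo]
  linarith

theorem convexOn_lo {r : ℝ} (v : ℝ × ℝ) {X Y Z : ℝ} (hXY : X ≤ Y) (hYZ : Y ≤ Z)
    (h1 : |X - v.1| ≤ r) (h3 : |Z - v.1| ≤ r) :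
    (Z - X) * lo r v Y ≤ (Z - Y) * lo r v X + (Y - X) * lo r v Z := by
  rcases eq_or_lt_of_le (hXY.trans hYZ) with h | h
  · obtain rfl : Y = X := by linarith
    obtain rfl : Z = Y := by linarith
    simp
  have h0 : 0 < Z - X := by linarith
  have p1 : 0 ≤ (Z - Y) / (Z - X) := div_nonneg (by linarith) h0.le
  have p2 : 0 ≤ (Y - X) / (Z - X) := div_nonneg (by linarith) h0.le
  have p3 : (Z - Y) / (Z - X) + (Y - X) / (Z - X) = 1 := by field_simp; ring
  have := (strictConcaveOn_psi r).concaveOn.2 (abs_le.1 h1) (abs_le.1 h3) p1 p2 p3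
  simp only [smul_eq_mul] at this
  rw [show (Z - Y) / (Z - X) * (X - v.1) + (Y - X) / (Z - X) * (Z - v.1) = Y - v.1 by
    field_simp; ring] at this
  have h4 := mul_le_mul_of_nonneg_left this h0.le
  rw [show (Z - X) * ((Z - Y) / (Z - X) * psi r (X - v.1) + (Y - X) / (Z - X) * psi r (Z - v.1)) =
    (Z - Y) * psi r (X - v.1) + (Y - X) * psi r (Z - v.1) by field_simp] at h4
  simp only [lo]
  nlinarith

/-! ### Circles through two points -/

/-- Squared distance. -/
def sq (p q : ℝ × ℝ) : ℝ := (p.1 - q.1) ^ 2 + (p.2 - q.2) ^ 2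

/-- The cross product of `p - c` and `q - c`. -/
def orient (c p q : ℝ × ℝ) : ℝ := (p.1 - c.1) * (q.2 - c.2) - (p.2 - c.2) * (q.1 - c.1)

/-- The abscissa at which the lower half circles around `(x₁, y₁)` and `(x₂, y₂)` cross. -/
noncomputable def crossX (r x₁ y₁ x₂ y₂ : ℝ) : ℝ :=
  (x₁ + x₂) / 2 + (x₂ - x₁) * (y₂ - y₁) *
    Real.sqrt (r * r - ((x₂ - x₁) * (x₂ - x₁) + (y₂ - y₁) * (y₂ - y₁)) / 4) /
    (Real.sqrt ((x₂ - x₁) * (x₂ - x₁) + (y₂ - y₁) * (y₂ - y₁)) *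
      Real.sqrt ((x₂ - x₁) * (x₂ - x₁)))

/-- A point `c` at distance `r` from `p` and `q` lies at a known distance from their midpoint, on
their bisector. -/
theorem exists_center_eq {r : ℝ} {p q c : ℝ × ℝ} (hpq : p ≠ q)
    (hp : sq p c = r ^ 2) (hq : sq q c = r ^ 2) :
    ∃ k : ℝ, c.1 = (p.1 + q.1) / 2 - k * (q.2 - p.2) ∧ c.2 = (p.2 + q.2) / 2 + k * (q.1 - p.1) ∧
      0 < sq p q ∧ k ^ 2 * sq p q = r ^ 2 - sq p q / 4 ∧ orient c p q = k * sq p q := by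
  have h0 : 0 < sq p q := by
    unfold sq
    by_contra h
    apply hpq
    have h1 : (p.1 - q.1) ^ 2 = 0 := by nlinarith [sq_nonneg (p.1 - q.1), sq_nonneg (p.2 - q.2)]
    have h2 : (p.2 - q.2) ^ 2 = 0 := by nlinarith [sq_nonneg (p.1 - q.1), sq_nonneg (p.2 - q.2)]
    ext
    · nlinarith [pow_eq_zero_iff (two_ne_zero) |>.1 h1]
    · nlinarith [pow_eq_zero_iff (two_ne_zero) |>.1 h2]
  have hlin : (q.1 - p.1) * (c.1 - (p.1 + q.1) / 2) + (q.2 - p.2) * (c.2 - (p.2 + q.2) / 2) = 0 := by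
    unfold sq at hp hq; nlinarith
  have e1 : c.1 = (p.1 + q.1) / 2 - orient c p q / sq p q * (q.2 - p.2) := by
    field_simp
    unfold orient
    unfold sq
    linear_combination (2 * (q.1 - p.1)) * hlin
  have e2 : c.2 = (p.2 + q.2) / 2 + orient c p q / sq p q * (q.1 - p.1) := by
    field_simp
    unfold orient
    unfold sq
    linear_combination (2 * (q.2 - p.2)) * hlin
  refine ⟨orient c p q / sq p q, e1, e2, h0, ?_, by field_simp⟩
  have h3 : sq p c = sq p q / 4 + (orient c p q / sq p q) ^ 2 * sq p q := by
    generalize orient c p q / sq p q = k at e1 e2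
    unfold sq
    rw [e1, e2]; ring
  linarith

/-- The center is the midpoint shifted by `k` times the normal of the chord. Both points lie at or
above it, which fixes the sign of `k`, and its absolute value comes from the distance of the chord.
The root of a square in `crossX` supplies the absolute value of the difference of the abscissae. -/
theorem crossX_eq {r : ℝ} {p q c : ℝ × ℝ} (hpq : p.1 ≠ q.1) (hp : sq p c = r ^ 2)
    (hq : sq q c = r ^ 2) (hpc : c.2 ≤ p.2) (hqc : c.2 ≤ q.2) :
    c.1 = crossX r p.1 p.2 q.1 q.2 := by
  obtain ⟨k, h1, h2, h0, hk, -⟩ := exists_center_eq (fun h => hpq (by rw [h])) hp hq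
  have hkd : k * (q.1 - p.1) ≤ 0 := by linarith
  have hs : (q.1 - p.1) * (q.1 - p.1) + (q.2 - p.2) * (q.2 - p.2) = sq p q := by unfold sq; ring
  have hd : q.1 - p.1 ≠ 0 := sub_ne_zero.2 hpq.symm
  have e1 : Real.sqrt (r * r - sq p q / 4) = |k| * Real.sqrt (sq p q) := by
    rw [show r * r - sq p q / 4 = k ^ 2 * sq p q by rw [hk]; ring,
      Real.sqrt_mul (sq_nonneg k), Real.sqrt_sq_eq_abs]
  have e2 : Real.sqrt ((q.1 - p.1) * (q.1 - p.1)) = |q.1 - p.1| := Real.sqrt_mul_self_eq_abs _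
  have h5 : 0 < Real.sqrt (sq p q) := Real.sqrt_pos.2 h0
  have h6 : 0 < |q.1 - p.1| := abs_pos.2 hd
  have h7 : (q.1 - p.1) * |k| = - (k * |q.1 - p.1|) := by
    rcases lt_or_gt_of_ne hd with h | h
    · have : 0 ≤ k := by nlinarith
      rw [abs_of_neg h, abs_of_nonneg this]; ring
    · have : k ≤ 0 := by nlinarith
      rw [abs_of_pos h, abs_of_nonpos this]; ring
  rw [crossX, hs, e1, e2, h1]
  field_simp
  linear_combination (-2 * (q.2 - p.2)) * h7

/-- The centers of the circles through two points. -/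
noncomputable def ctr (r : ℝ) (p q : ℝ × ℝ) : ℝ × ℝ :=
  ((p.1 + q.1) / 2 - Real.sqrt (r * r - ((q.1 - p.1) * (q.1 - p.1) + (q.2 - p.2) * (q.2 - p.2)) / 4) *
      (q.2 - p.2) / Real.sqrt ((q.1 - p.1) * (q.1 - p.1) + (q.2 - p.2) * (q.2 - p.2)),
   (p.2 + q.2) / 2 + Real.sqrt (r * r - ((q.1 - p.1) * (q.1 - p.1) + (q.2 - p.2) * (q.2 - p.2)) / 4) *
      (q.1 - p.1) / Real.sqrt ((q.1 - p.1) * (q.1 - p.1) + (q.2 - p.2) * (q.2 - p.2)))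

/-- There are two circles of radius `r` through two points, mirror images of each other in the
chord; the orientation selects one. -/
theorem eq_ctr {r : ℝ} {p q c : ℝ × ℝ} (hpq : p ≠ q) (hp : sq p c = r ^ 2)
    (hq : sq q c = r ^ 2) (h : 0 ≤ orient c p q) : c = ctr r p q := by
  obtain ⟨k, h1, h2, h0, hk, ho⟩ := exists_center_eq hpq hp hq
  have hk0 : 0 ≤ k := by
    rw [ho] at h
    exact nonneg_of_mul_nonneg_left h h0
  have hs : (q.1 - p.1) * (q.1 - p.1) + (q.2 - p.2) * (q.2 - p.2) = sq p q := by unfold sq; ring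
  have e1 : Real.sqrt (r * r - sq p q / 4) = k * Real.sqrt (sq p q) := by
    rw [show r * r - sq p q / 4 = k ^ 2 * sq p q by rw [hk]; ring,
      Real.sqrt_mul (sq_nonneg k), Real.sqrt_sq hk0]
  have h5 : 0 < Real.sqrt (sq p q) := Real.sqrt_pos.2 h0
  ext
  · simp only [ctr, hs, e1]
    rw [h1]; field_simp
  · simp only [ctr, hs, e1]
    rw [h2]; field_simp

/-- Two different points covered by the disk around `ctr r p q` lie on its boundary. -/
theorem ctr_spec {r : ℝ} {p q : ℝ × ℝ} (hpq : p ≠ q) (hp : sq p (ctr r p q) ≤ r ^ 2) :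
    sq p (ctr r p q) = r ^ 2 ∧ sq q (ctr r p q) = r ^ 2 ∧ 0 ≤ orient (ctr r p q) p q := by
  have hs : (q.1 - p.1) * (q.1 - p.1) + (q.2 - p.2) * (q.2 - p.2) = sq p q := by unfold sq; ring
  have h0 : 0 < sq p q := by
    unfold sq
    by_contra h
    apply hpq
    have h1 : (p.1 - q.1) ^ 2 = 0 := by nlinarith [sq_nonneg (p.1 - q.1), sq_nonneg (p.2 - q.2)]
    have h2 : (p.2 - q.2) ^ 2 = 0 := by nlinarith [sq_nonneg (p.1 - q.1), sq_nonneg (p.2 - q.2)]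
    ext
    · nlinarith [pow_eq_zero_iff (two_ne_zero) |>.1 h1]
    · nlinarith [pow_eq_zero_iff (two_ne_zero) |>.1 h2]
  have h5 : 0 < Real.sqrt (sq p q) := Real.sqrt_pos.2 h0
  have h5' := Real.mul_self_sqrt h0.le
  set k := Real.sqrt (r * r - sq p q / 4) / Real.sqrt (sq p q) with hk
  have hk0 : 0 ≤ k := div_nonneg (Real.sqrt_nonneg _) h5.le
  have c1 : (ctr r p q).1 = (p.1 + q.1) / 2 - k * (q.2 - p.2) := by
    simp only [ctr, hs, hk]; ring
  have c2 : (ctr r p q).2 = (p.2 + q.2) / 2 + k * (q.1 - p.1) := by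
    simp only [ctr, hs, hk]; ring
  have hkk : k ^ 2 * sq p q = Real.sqrt (r * r - sq p q / 4) ^ 2 := by
    rw [hk, div_pow, Real.sq_sqrt h0.le]; field_simp
  have d1 : sq p (ctr r p q) = sq p q / 4 + k ^ 2 * sq p q := by
    unfold sq; rw [c1, c2]; ring
  have d2 : sq q (ctr r p q) = sq p q / 4 + k ^ 2 * sq p q := by
    unfold sq; rw [c1, c2]; ring
  -- If the points were more than `2r` apart, the root in `ctr` would be `0` and the center the
  -- midpoint, which is too far from `p`. So the covering hypothesis also shows that the circle
  -- exists.
  have hle : 0 ≤ r * r - sq p q / 4 := by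
    rw [d1] at hp; nlinarith [sq_nonneg k]
  rw [Real.sq_sqrt hle] at hkk
  refine ⟨by rw [d1, hkk]; ring, by rw [d2, hkk]; ring, ?_⟩
  have : orient (ctr r p q) p q = k * sq p q := by
    unfold orient sq; rw [c1, c2]; ring
  rw [this]; positivity

/-! ### Envelopes of lower half circles around points in convex position -/

/-- `p 0, …, p (n - 1)` are the vertices of a circular hull in counterclockwise order, starting from
one with maximal abscissa. -/
structure Chain (r : ℝ) (n : ℕ) (p : ℕ → ℝ × ℝ) : Prop where
  wrap : p n = p 0
  ccw : ∀ i j k, i < j → j < k → k < n → 0 < orient (p i) (p j) (p k)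
  max : ∀ i < n, (p i).1 ≤ (p 0).1
  inj : ∀ i < n, ∀ j < n, p i = p j → i = j
  cov : ∀ i < n, ∃ c, (∀ k < n, sq (p k) c ≤ r ^ 2) ∧ sq (p i) c = r ^ 2
  gp : ∀ i < n, ∀ j < n, ∀ k < n, i ≠ j → j ≠ k → i ≠ k → ∀ c, sq (p i) c = r ^ 2 →
    sq (p j) c = r ^ 2 → sq (p k) c = r ^ 2 →
    ¬ (0 ≤ orient c (p i) (p j) ∧ 0 ≤ orient c (p j) (p k) ∧ 0 ≤ orient c (p i) (p k))

theorem sq_lo {r : ℝ} {v : ℝ × ℝ} {X : ℝ} (hX : |X - v.1| ≤ r) : sq v (X, lo r v X) = r ^ 2 := by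
  have := psi_sq hX
  simp only [sq, lo]; nlinarith

theorem lo_le_of_sq_le {r : ℝ} {v c : ℝ × ℝ} (h : sq v c ≤ r ^ 2) : lo r v c.1 ≤ c.2 := by
  have : v.2 - c.2 ≤ psi r (c.1 - v.1) := by
    apply le_psi_of_sq_le
    unfold sq at h; nlinarith
  unfold lo; linarith

theorem lo_eq_of_sq_eq {r : ℝ} {v c : ℝ × ℝ} (h : sq v c = r ^ 2) (hv : c.2 ≤ v.2) :
    lo r v c.1 = c.2 := by
  have h1 : r * r - (c.1 - v.1) * (c.1 - v.1) = (v.2 - c.2) * (v.2 - c.2) := by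
    unfold sq at h; nlinarith
  rw [lo, psi, h1, Real.sqrt_mul_self (by linarith)]; ring

theorem le_of_eq_lo {r : ℝ} {v : ℝ × ℝ} {X : ℝ} : lo r v X ≤ v.2 := by
  have := psi_nonneg r (X - v.1)
  unfold lo; linarith

theorem abs_sub_le_of_sq_le {r : ℝ} (hr : 0 ≤ r) {v c : ℝ × ℝ} (h : sq v c ≤ r ^ 2) :
    |c.1 - v.1| ≤ r := by
  apply abs_le_of_sq_le_sq _ hr
  unfold sq at h; nlinarith [sq_nonneg (v.2 - c.2)]

/-- On the upper half of a circle, decreasing abscissae give the counterclockwise order. -/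
theorem orient_nonneg_of_lo_eq {r X Y : ℝ} {v w : ℝ × ℝ} (hv : |X - v.1| ≤ r) (hw : |X - w.1| ≤ r)
    (hv' : lo r v X = Y) (hw' : lo r w X = Y) (h : w.1 ≤ v.1) : 0 ≤ orient (X, Y) v w := by
  have e1 : v.2 - Y = psi r (X - v.1) := by rw [← hv']; simp [lo]
  have e2 : w.2 - Y = psi r (X - w.1) := by rw [← hw']; simp [lo]
  have s1 := psi_sq hv
  have s2 := psi_sq hw
  have p1 := psi_nonneg r (X - v.1)
  have p2 := psi_nonneg r (X - w.1)
  simp only [orient, e1, e2]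
  set a := psi r (X - v.1)
  set b := psi r (X - w.1)
  rcases le_total X v.1 with h1 | h1 <;> rcases le_total X w.1 with h2 | h2
  · have : a ≤ b := by nlinarith
    nlinarith
  · nlinarith [mul_nonneg (sub_nonneg.2 h1) p2, mul_nonneg (sub_nonneg.2 h2) p1]
  · obtain : X = v.1 := by linarith
    obtain : X = w.1 := by linarith
    nlinarith
  · have : b ≤ a := by nlinarith
    nlinarith

/-- A point on the envelope is not below a chord. -/
theorem orient_nonneg_of_max {r X : ℝ} {a m b : ℝ × ℝ} (h1 : a.1 ≤ m.1) (h2 : m.1 ≤ b.1)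
    (ha : |X - a.1| ≤ r) (hb : |X - b.1| ≤ r) (hla : lo r a X ≤ lo r m X)
    (hlb : lo r b X ≤ lo r m X) : 0 ≤ orient b m a := by
  have := convexOn_lo (r := r) (X, 0) h1 h2 (by rwa [abs_sub_comm] at ha) (by rwa [abs_sub_comm] at hb)
  simp only [lo, ← psi_neg r (X - _), neg_sub] at this hla hlb
  simp only [orient]
  nlinarith [mul_nonneg (sub_nonneg.2 h2) (sub_nonneg.2 hla),
    mul_nonneg (sub_nonneg.2 h1) (sub_nonneg.2 hlb)]

/-- The middle one of three vertices is not below the envelope of the others, unless all three lie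
on one circle. -/
theorem eq_of_middle_le {r X : ℝ} (hr : 0 ≤ r) {a m b c : ℝ × ℝ} (h1 : a.1 ≤ m.1) (h2 : m.1 ≤ b.1)
    (ha : |X - a.1| ≤ r) (hm : |X - m.1| ≤ r) (hb : |X - b.1| ≤ r)
    (hac : sq a c ≤ r ^ 2) (hbc : sq b c ≤ r ^ 2) (hmc : sq m c = r ^ 2) (ho : 0 < orient b m a)
    (hla : lo r m X ≤ lo r a X) (hlb : lo r m X ≤ lo r b X) :
    lo r a X = lo r m X ∧ lo r b X = lo r m X := by
  have ta : (a.1 - m.1) * (m.1 - c.1) + (a.2 - m.2) * (m.2 - c.2) ≤ 0 := by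
    unfold sq at hac hmc
    nlinarith [sq_nonneg (a.1 - m.1), sq_nonneg (a.2 - m.2)]
  have tb : (b.1 - m.1) * (m.1 - c.1) + (b.2 - m.2) * (m.2 - c.2) ≤ 0 := by
    unfold sq at hbc hmc
    nlinarith [sq_nonneg (b.1 - m.1), sq_nonneg (b.2 - m.2)]
  -- By `ta` and `tb` both neighbors lie on the inner side of the tangent to the circle at `m`. As
  -- `m` is above their chord, the center cannot be above `m`.
  have hcm : c.2 ≤ m.2 := by
    have e : (b.1 - m.1) * ((a.1 - m.1) * (m.1 - c.1) + (a.2 - m.2) * (m.2 - c.2)) +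
        (m.1 - a.1) * ((b.1 - m.1) * (m.1 - c.1) + (b.2 - m.2) * (m.2 - c.2)) =
        - orient b m a * (m.2 - c.2) := by unfold orient; ring
    by_contra hlt
    push Not at hlt
    have := mul_pos ho (sub_pos.2 hlt)
    nlinarith [mul_nonneg (sub_nonneg.2 h2) (neg_nonneg.2 ta),
      mul_nonneg (sub_nonneg.2 h1) (neg_nonneg.2 tb)]
  have lm := lo_eq_of_sq_eq hmc hcm
  have la := lo_le_of_sq_le hac
  have lb := lo_le_of_sq_le hbc
  have dm := abs_sub_le_of_sq_le hr hmc.le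
  have da := abs_sub_le_of_sq_le hr hac
  have db := abs_sub_le_of_sq_le hr hbc
  have same : ∀ v w : ℝ × ℝ, v.1 = w.1 → ∀ Z, lo r v Z - lo r w Z = v.2 - w.2 := by
    intro v w h Z; simp only [lo, h]; ring
  have h1' : a.1 < m.1 := by
    refine lt_of_le_of_ne h1 fun h => ?_
    have e1 := same a m h X
    have e2 := same a m h c.1
    have : a = m := Prod.ext h (by linarith)
    rw [this] at ho; unfold orient at ho; nlinarith
  have h2' : m.1 < b.1 := by
    refine lt_of_le_of_ne h2 fun h => ?_
    have e1 := same m b h X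
    have e2 := same m b h c.1
    have : m = b := Prod.ext h (by linarith)
    rw [this] at ho; unfold orient at ho; nlinarith
  -- At `c.1` the half circle of `m` is at least as high as the other two. The differences `lo a -
  -- lo m` and `lo m - lo b` are increasing, so `m` being lowest at `X` bounds `X` by `c.1` from
  -- both sides.
  have hX : X = c.1 := by
    apply le_antisymm
    · by_contra hlt
      push Not at hlt
      have := lo_sub_lo_lt h2' hlt db hm
      linarith
    · by_contra hlt
      push Not at hlt
      have := lo_sub_lo_lt h1' hlt hm da
      linarith
  subst hX
  constructor <;> linarith

/-! ### Position of the maximum along a chain -/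

namespace Chain

variable {r : ℝ} {n : ℕ} {p : ℕ → ℝ × ℝ}

/-- This is the unimodality behind all searches. A valley would force three vertices onto one
circle, all on its upper half, where decreasing abscissae mean counterclockwise order; general
position forbids that. -/
theorem no_valley (C : Chain r n p) (hr : 0 ≤ r) {X : ℝ} (hX : ∀ k < n, |X - (p k).1| ≤ r)
    {i j k : ℕ} (hij : i < j) (hjk : j < k) (hk : k < n) (h1 : (p k).1 ≤ (p j).1)
    (h2 : (p j).1 ≤ (p i).1) :
    ¬ (lo r (p j) X ≤ lo r (p i) X ∧ lo r (p j) X ≤ lo r (p k) X) := by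
  rintro ⟨hi, hk'⟩
  have hj : j < n := by omega
  have hi' : i < n := by omega
  obtain ⟨c, hc, hcj⟩ := C.cov j hj
  obtain ⟨e1, e2⟩ := eq_of_middle_le hr h1 h2 (hX k hk) (hX j hj) (hX i hi') (hc k hk) (hc i hi')
    hcj (C.ccw i j k hij hjk hk) hk' hi
  refine C.gp i hi' j hj k hk (by omega) (by omega) (by omega) (X, lo r (p j) X) ?_ ?_ ?_ ⟨?_, ?_, ?_⟩
  · rw [← e2]; exact sq_lo (hX i hi')
  · exact sq_lo (hX j hj)
  · rw [← e1]; exact sq_lo (hX k hk)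
  · exact orient_nonneg_of_lo_eq (hX i hi') (hX j hj) e2 rfl h2
  · exact orient_nonneg_of_lo_eq (hX j hj) (hX k hk) rfl e1 h1
  · exact orient_nonneg_of_lo_eq (hX i hi') (hX k hk) e2 e1 (h1.trans h2)

/-- A convex cycle that starts at its rightmost vertex runs to the left and then back to the right.
In the linear relation between the vectors from vertex `i` to the vertices `k`, `0` and `i + 1`, a
violation makes every term nonpositive and the first one negative. -/
theorem antitone_before (C : Chain r n p) {i k : ℕ} (hki : k < i) (hi : i + 1 < n)
    (h : (p (i + 1)).1 ≤ (p i).1) : (p i).1 ≤ (p k).1 := by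
  by_contra hlt
  push Not at hlt
  have hk : 0 < k := by
    rcases Nat.eq_zero_or_pos k with rfl | hk
    · exact absurd (C.max i (by omega)) (not_le.2 hlt)
    · exact hk
  have h0 := C.max i (by omega)
  have o1 := C.ccw 0 k i hk hki (by omega)
  have o2 := C.ccw 0 i (i + 1) (by omega) (by omega) hi
  have o3 := C.ccw k i (i + 1) hki (by omega) hi
  have e : orient (p 0) (p i) (p (i + 1)) * ((p k).1 - (p i).1) -
      orient (p k) (p i) (p (i + 1)) * ((p 0).1 - (p i).1) +
      orient (p 0) (p k) (p i) * ((p (i + 1)).1 - (p i).1) = 0 := by unfold orient; ring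
  nlinarith [mul_pos o2 (sub_pos.2 hlt), mul_nonneg o3.le (sub_nonneg.2 h0),
    mul_nonneg o1.le (sub_nonneg.2 h)]

/-- Once the cycle has turned to the right it never comes back: the same linear relation now writes
the displacement to vertex `j` as a combination of two positive ones, with positive coefficients. -/
theorem not_left_of_ascent (C : Chain r n p) {i j : ℕ} (hij : i + 1 < j) (hj : j < n)
    (h : (p i).1 < (p (i + 1)).1) : (p i).1 < (p j).1 := by
  have h0 := C.max (i + 1) (by omega)
  have hi : 0 < i := by
    rcases Nat.eq_zero_or_pos i with rfl | hi
    · exact absurd h0 (not_le.2 h)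
    · exact hi
  have o1 := C.ccw 0 i (i + 1) hi (by omega) (by omega)
  have o2 := C.ccw 0 i j hi (by omega) hj
  have o3 := C.ccw i (i + 1) j (by omega) hij hj
  have e : orient (p 0) (p i) (p (i + 1)) * ((p j).1 - (p i).1) =
      orient (p i) (p (i + 1)) (p j) * ((p 0).1 - (p i).1) +
      orient (p 0) (p i) (p j) * ((p (i + 1)).1 - (p i).1) := by unfold orient; ring
  have : 0 < orient (p 0) (p i) (p (i + 1)) * ((p j).1 - (p i).1) := by
    rw [e]
    have := mul_pos o3 (sub_pos.2 (h.trans_le h0))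
    have := mul_pos o2 (sub_pos.2 h)
    linarith
  linarith [(mul_pos_iff_of_pos_left o1).1 this]

/-- Where the maximum of the envelope at `X` is attained, relative to an edge. -/
theorem locate (C : Chain r n p) (hr : 0 ≤ r) {X : ℝ} (hX : ∀ k < n, |X - (p k).1| ≤ r) {j : ℕ}
    (hj : j < n) (hmax : ∀ k < n, lo r (p k) X ≤ lo r (p j) X) {i : ℕ} (hi : i < n) :
    (¬ (p (i + 1) ≠ p 0 ∧ (p (i + 1)).1 ≤ (p i).1) → j ≤ i) ∧
    (p (i + 1) ≠ p 0 ∧ (p (i + 1)).1 ≤ (p i).1 →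
      (lo r (p i) X ≤ lo r (p (i + 1)) X → i ≤ j) ∧
      (lo r (p (i + 1)) X ≤ lo r (p i) X → j ≤ i + 1) ∧
      (lo r (p i) X < lo r (p (i + 1)) X → i < j) ∧
      (lo r (p (i + 1)) X < lo r (p i) X → j ≤ i)) := by
  -- A vertex reached after the turn lies strictly below the chord from the earlier vertex to vertex
  -- `0`, so it cannot be on the envelope.
  have below : ∀ k l, k < l → l < n → 0 < k → (p k).1 ≤ (p l).1 → l ≠ j := by
    rintro k l hkl hl hk h rfl
    have h1 := C.ccw 0 k l hk hkl hl
    have h2 := orient_nonneg_of_max h (C.max l hl) (hX k (by omega)) (hX 0 (by omega))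
      (hmax k (by omega)) (hmax 0 (by omega))
    have : orient (p 0) (p l) (p k) = - orient (p 0) (p k) (p l) := by unfold orient; ring
    linarith
  constructor
  · intro h
    by_contra hlt
    push Not at hlt
    have hne : p (i + 1) ≠ p 0 := by
      intro he
      exact absurd (C.inj (i + 1) (by omega) 0 (by omega) he) (by omega)
    have hx : (p i).1 < (p (i + 1)).1 := by
      by_contra hx
      exact h ⟨hne, not_lt.1 hx⟩
    have hi0 : 0 < i := by
      rcases Nat.eq_zero_or_pos i with rfl | hi0
      · exact absurd (C.max 1 (by omega)) (not_le.2 hx)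
      · exact hi0
    rcases eq_or_lt_of_le (Nat.succ_le_of_lt hlt) with h1 | h1
    · exact below i (i + 1) (by omega) (by omega) hi0 hx.le h1
    · exact below i j (by omega) hj hi0 (C.not_left_of_ascent h1 hj hx).le rfl
  · rintro ⟨hne, hx⟩
    have hin : i + 1 < n := by
      rcases eq_or_lt_of_le (Nat.succ_le_of_lt hi) with h1 | h1
      · exact absurd (by rw [show i + 1 = n from h1, C.wrap]) hne
      · exact h1
    have A : lo r (p i) X ≤ lo r (p (i + 1)) X → i ≤ j := by
      intro hD
      by_contra hlt
      push Not at hlt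
      exact C.no_valley hr hX hlt (Nat.lt_succ_self i) hin hx (C.antitone_before hlt hin hx)
        ⟨hmax i hi, hD⟩
    have B : lo r (p (i + 1)) X ≤ lo r (p i) X → j ≤ i + 1 := by
      intro hD
      by_contra hlt
      push Not at hlt
      rcases le_total (p j).1 (p (i + 1)).1 with h1 | h1
      · exact C.no_valley hr hX (Nat.lt_succ_self i) hlt hj h1 hx ⟨hD, hmax _ hin⟩
      · exact below (i + 1) j hlt hj (by omega) h1 rfl
    refine ⟨A, B, fun hD => lt_of_le_of_ne (A hD.le) ?_, fun hD => ?_⟩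
    · rintro rfl
      exact absurd (hmax _ hin) (not_le.2 hD)
    · have := B hD.le
      rcases eq_or_lt_of_le this with rfl | h1
      · exact absurd (hmax _ hi) (not_le.2 hD)
      · omega

/-- The last vertex with minimal abscissa. -/
theorem locate_min (C : Chain r n p) {m : ℕ} (hm : m < n) (hmin : ∀ k < n, (p m).1 ≤ (p k).1)
    (hlast : ∀ k < n, (p k).1 = (p m).1 → k ≤ m) {i : ℕ} (hi : i < n) :
    (p (i + 1) ≠ p 0 ∧ (p (i + 1)).1 ≤ (p i).1) ↔ i < m := by
  constructor
  · rintro ⟨hne, hx⟩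
    have hin : i + 1 < n := by
      rcases eq_or_lt_of_le (Nat.succ_le_of_lt hi) with h1 | h1
      · exact absurd (by rw [show i + 1 = n from h1, C.wrap]) hne
      · exact h1
    by_contra hlt
    push Not at hlt
    have h1 : (p i).1 ≤ (p m).1 := by
      rcases eq_or_lt_of_le hlt with rfl | h1
      · exact le_rfl
      · exact C.antitone_before h1 hin hx
    have h2 := hmin i hi
    have h3 := hmin (i + 1) hin
    have := hlast (i + 1) hin (by linarith)
    omega
  · intro hlt
    refine ⟨fun he => absurd (C.inj (i + 1) (by omega) 0 (by omega) he) (by omega), ?_⟩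
    by_contra hx
    push Not at hx
    rcases eq_or_lt_of_le (Nat.succ_le_of_lt hlt) with h1 | h1
    · have := hmin i hi
      rw [← h1] at this
      exact absurd this (not_le.2 hx)
    · exact absurd (hmin i hi) (not_le.2 (C.not_left_of_ascent h1 hm hx))

end Chain

open Filter Topology

/-! ### Disks covering finite sets -/

/-- The disk of radius `r` around `c` covers `Q`. -/
def Cov (r : ℝ) (c : ℝ × ℝ) (Q : Finset (ℝ × ℝ)) : Prop := ∀ p ∈ Q, sq p c ≤ r ^ 2

/-- General position, in coordinates. -/
def GenPos (r : ℝ) (Q : Set (ℝ × ℝ)) : Prop :=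
  ∀ p ∈ Q, ∀ q ∈ Q, ∀ s ∈ Q, p ≠ q → s ≠ p → s ≠ q → ∀ c, sq p c = r ^ 2 → sq q c = r ^ 2 →
    orient c p q ≤ 0 → sq s c = r ^ 2 → ¬ 0 ≤ orient p q s

/-- Three points of a circle are not on a half circle. -/
theorem GenPos.not_half {r : ℝ} (hr : 0 < r) {Q : Set (ℝ × ℝ)} (h : GenPos r Q) {p q s c : ℝ × ℝ}
    (hp : p ∈ Q) (hq : q ∈ Q) (hs : s ∈ Q) (hpq : p ≠ q) (hqs : q ≠ s) (hps : p ≠ s)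
    (hpc : sq p c = r ^ 2) (hqc : sq q c = r ^ 2) (hsc : sq s c = r ^ 2) :
    ¬ (0 ≤ orient c p q ∧ 0 ≤ orient c q s ∧ 0 ≤ orient c p s) := by
  rintro ⟨h1, h2, h3⟩
  refine h s hs p hp q hq hps.symm hqs hpq.symm c hsc hpc ?_ hqc ?_
  · have : orient c s p = - orient c p s := by unfold orient; ring
    linarith
  · have e : orient s p q = orient c p q + orient c q s - orient c p s := by unfold orient; ring
    -- The addition formula for the sine. Both scalar products are at most `r ^ 2`, so the sine of
    -- the sum is at most the sum of the sines, which places `q` on the minor arc from `s` to `p`.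
    have e2 : r ^ 2 * orient c p s =
        orient c p q * ((q.1 - c.1) * (s.1 - c.1) + (q.2 - c.2) * (s.2 - c.2)) +
        ((p.1 - c.1) * (q.1 - c.1) + (p.2 - c.2) * (q.2 - c.2)) * orient c q s := by
      rw [← hqc]; unfold orient sq; ring
    have d1 : (q.1 - c.1) * (s.1 - c.1) + (q.2 - c.2) * (s.2 - c.2) ≤ r ^ 2 := by
      unfold sq at hqc hsc
      nlinarith [sq_nonneg (q.1 - c.1 - (s.1 - c.1)), sq_nonneg (q.2 - c.2 - (s.2 - c.2))]
    have d2 : (p.1 - c.1) * (q.1 - c.1) + (p.2 - c.2) * (q.2 - c.2) ≤ r ^ 2 := by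
      unfold sq at hqc hpc
      nlinarith [sq_nonneg (q.1 - c.1 - (p.1 - c.1)), sq_nonneg (q.2 - c.2 - (p.2 - c.2))]
    have : r ^ 2 * orient c p s ≤ r ^ 2 * (orient c p q + orient c q s) := by
      rw [e2]
      nlinarith [mul_le_mul_of_nonneg_left d1 h1, mul_le_mul_of_nonneg_left d2 h2]
    have := le_of_mul_le_mul_left this (by positivity)
    linarith

/-- Two points of a circle lie on different sides of the diameter through a third one. -/
theorem GenPos.opposite {r : ℝ} (hr : 0 < r) {Q : Set (ℝ × ℝ)} (h : GenPos r Q) {p q s c : ℝ × ℝ}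
    (hp : p ∈ Q) (hq : q ∈ Q) (hs : s ∈ Q) (hpq : p ≠ q) (hqs : q ≠ s) (hps : p ≠ s)
    (hpc : sq p c = r ^ 2) (hqc : sq q c = r ^ 2) (hsc : sq s c = r ^ 2) :
    orient c p s * orient c q s < 0 := by
  have sw : ∀ a b : ℝ × ℝ, orient c a b = - orient c b a := by intro a b; unfold orient; ring
  by_contra hcon
  push Not at hcon
  -- If `p` and `q` were on the same side of the diameter through `s`, the three points would lie on
  -- a half circle, in one of these four counterclockwise orders.
  have n1 := h.not_half hr hp hq hs hpq hqs hps hpc hqc hsc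
  have n2 := h.not_half hr hq hp hs hpq.symm hps hqs hqc hpc hsc
  have n3 := h.not_half hr hs hp hq hps.symm hpq hqs.symm hsc hpc hqc
  have n4 := h.not_half hr hs hq hp hqs.symm hpq.symm hps.symm hsc hqc hpc
  rw [sw s q, sw s p] at n3 n4
  rw [sw q p] at n2 n4
  rcases mul_nonneg_iff.1 hcon with ⟨h1, h2⟩ | ⟨h1, h2⟩ <;>
    rcases le_total 0 (orient c p q) with h3 | h3
  · exact n1 ⟨h3, h2, h1⟩
  · exact n2 ⟨neg_nonneg.2 h3, h1, h2⟩
  · exact n3 ⟨neg_nonneg.2 h1, h3, neg_nonneg.2 h2⟩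
  · exact n4 ⟨neg_nonneg.2 h2, neg_nonneg.2 h3, neg_nonneg.2 h1⟩

/-! ### Farthest points -/

noncomputable def far (Q : Finset (ℝ × ℝ)) (hQ : Q.Nonempty) (c : ℝ × ℝ) : ℝ :=
  Q.sup' hQ (fun p => sq p c)

theorem continuous_sq (p : ℝ × ℝ) : Continuous (fun c => sq p c) := by
  unfold sq; fun_prop

theorem continuous_far (Q : Finset (ℝ × ℝ)) (hQ : Q.Nonempty) : Continuous (far Q hQ) :=
  Continuous.finset_sup'_apply hQ fun p _ => continuous_sq p

theorem far_le_iff {Q : Finset (ℝ × ℝ)} {hQ : Q.Nonempty} {c : ℝ × ℝ} {r : ℝ} :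
    far Q hQ c ≤ r ^ 2 ↔ Cov r c Q := Finset.sup'_le_iff _ _

theorem sq_le_far {Q : Finset (ℝ × ℝ)} (hQ : Q.Nonempty) {p : ℝ × ℝ} (hp : p ∈ Q) (c : ℝ × ℝ) :
    sq p c ≤ far Q hQ c := Finset.le_sup' (fun p => sq p c) hp

theorem exists_far {Q : Finset (ℝ × ℝ)} (hQ : Q.Nonempty) (c : ℝ × ℝ) :
    ∃ p ∈ Q, far Q hQ c = sq p c := Finset.exists_mem_eq_sup' hQ _

/-- Some point is equally far from `L` and `R`, at distance at most `r`. -/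
def Equidistant (r : ℝ) (L R : Finset (ℝ × ℝ)) (hL : L.Nonempty) (hR : R.Nonempty) : Prop :=
  ∃ c, far L hL c = far R hR c ∧ far L hL c ≤ r ^ 2

/-- A move to the right by `s` changes the squared distance to `p` by `s ^ 2 - 2 * s * (p.1 - x)`,
which is larger for points farther to the left. So equality of the farthest distances is broken in
favor of `L`. -/
theorem far_lt_of_right {L R : Finset (ℝ × ℝ)} (hL : L.Nonempty) (hR : R.Nonempty)
    (hx : ∀ p ∈ L, ∀ q ∈ R, p.1 < q.1) {x y s : ℝ} (h : far L hL (x, y) = far R hR (x, y))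
    (hs : 0 < s) : far R hR (x + s, y) < far L hL (x + s, y) := by
  obtain ⟨b, hb, hb'⟩ := exists_far hR (x + s, y)
  obtain ⟨a, ha, ha'⟩ := exists_far hL (x, y)
  have h1 := sq_le_far hL ha (x + s, y)
  have h2 := sq_le_far hR hb (x, y)
  have h3 := mul_lt_mul_of_pos_left (hx a ha b hb) hs
  rw [← h, ha'] at h2
  rw [hb']
  refine lt_of_lt_of_le ?_ h1
  unfold sq at h2 ⊢
  nlinarith

theorem far_lt_of_left {L R : Finset (ℝ × ℝ)} (hL : L.Nonempty) (hR : R.Nonempty)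
    (hx : ∀ p ∈ L, ∀ q ∈ R, p.1 < q.1) {x y s : ℝ} (h : far L hL (x, y) = far R hR (x, y))
    (hs : 0 < s) : far L hL (x - s, y) < far R hR (x - s, y) := by
  obtain ⟨b, hb, hb'⟩ := exists_far hL (x - s, y)
  obtain ⟨a, ha, ha'⟩ := exists_far hR (x, y)
  have h1 := sq_le_far hR ha (x - s, y)
  have h2 := sq_le_far hL hb (x, y)
  have h3 := mul_lt_mul_of_pos_left (hx b hb a ha) hs
  rw [h, ha'] at h2
  rw [hb']
  refine lt_of_lt_of_le ?_ h1
  unfold sq at h2 ⊢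
  nlinarith

/-- Slightly to the left of `c` the set `R` is farther away, slightly to the right the set `L`. Both
strict inequalities survive a small descent, and the intermediate value theorem applies on the
lowered horizontal segment. The radius `δ` keeps the segment where the distance is below `r`. -/
theorem exists_lower_equidistant {r : ℝ} {L R : Finset (ℝ × ℝ)} (hL : L.Nonempty) (hR : R.Nonempty)
    (hx : ∀ p ∈ L, ∀ q ∈ R, p.1 < q.1) {c : ℝ × ℝ} (h : far L hL c = far R hR c)
    (hc : far L hL c < r ^ 2) :
    ∃ c', far L hL c' = far R hR c' ∧ far L hL c' ≤ r ^ 2 ∧ c'.2 < c.2 := by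
  have cL := continuous_far L hL
  have cR := continuous_far R hR
  obtain ⟨δ, hδ, hball⟩ := Metric.isOpen_iff.1 (isOpen_lt cL continuous_const) c hc
  have hl := far_lt_of_left hL hR hx (x := c.1) (y := c.2) h (half_pos hδ)
  have hr := far_lt_of_right hL hR hx (x := c.1) (y := c.2) h (half_pos hδ)
  have el : ∀ᶠ y in 𝓝 c.2, far L hL (c.1 - δ / 2, y) < far R hR (c.1 - δ / 2, y) := by
    have k : Continuous fun y : ℝ => ((c.1 - δ / 2, y) : ℝ × ℝ) := by fun_prop
    exact (isOpen_lt (cL.comp k) (cR.comp k)).mem_nhds hl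
  have er : ∀ᶠ y in 𝓝 c.2, far R hR (c.1 + δ / 2, y) < far L hL (c.1 + δ / 2, y) := by
    have k : Continuous fun y : ℝ => ((c.1 + δ / 2, y) : ℝ × ℝ) := by fun_prop
    exact (isOpen_lt (cR.comp k) (cL.comp k)).mem_nhds hr
  have eb : ∀ᶠ y in 𝓝 c.2, y ∈ Metric.ball c.2 δ := Metric.ball_mem_nhds _ hδ
  have e3 : ∀ᶠ y in 𝓝[<] c.2, y < c.2 := self_mem_nhdsWithin
  obtain ⟨y, ⟨⟨h1, h2⟩, h3⟩, h4⟩ :=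
    (((el.and er).and eb).filter_mono nhdsWithin_le_nhds |>.and e3).exists
  have hcont : ContinuousOn (fun x : ℝ => far L hL (x, y) - far R hR (x, y))
      (Set.Icc (c.1 - δ / 2) (c.1 + δ / 2)) := by
    have k : Continuous fun x : ℝ => ((x, y) : ℝ × ℝ) := by fun_prop
    exact ((cL.comp k).sub (cR.comp k)).continuousOn
  obtain ⟨x, ⟨hx1, hx2⟩, hx0⟩ := intermediate_value_Icc (by linarith) hcont
    (show (0 : ℝ) ∈ Set.Icc _ _ from ⟨by linarith, by linarith⟩)
  refine ⟨(x, y), by simpa [sub_eq_zero] using hx0, le_of_lt (hball ?_), h4⟩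
  rw [Metric.mem_ball, Prod.dist_eq, max_lt_iff]
  refine ⟨?_, h3⟩
  rw [Real.dist_eq, abs_lt]
  constructor <;> simp only <;> linarith

theorem sq_add_smul (l c w : ℝ × ℝ) (ε : ℝ) : sq l (c + ε • w) =
    sq l c - 2 * ε * (w.1 * (l.1 - c.1) + w.2 * (l.2 - c.2)) + ε ^ 2 * (w.1 ^ 2 + w.2 ^ 2) := by
  simp only [sq, Prod.fst_add, Prod.snd_add, Prod.smul_fst, Prod.smul_snd, smul_eq_mul]; ring

theorem eventually_sq_lt (l a c w : ℝ × ℝ) (h : sq l c < sq a c) :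
    ∀ᶠ ε : ℝ in 𝓝[>] 0, sq l (c + ε • w) < sq a (c + ε • w) := by
  have k : Continuous fun ε : ℝ => c + ε • w := by fun_prop
  have := (isOpen_lt ((continuous_sq l).comp k) ((continuous_sq a).comp k)).mem_nhds
    (show (0 : ℝ) ∈ {ε : ℝ | sq l (c + ε • w) < sq a (c + ε • w)} by simpa using h)
  exact Filter.Eventually.filter_mono nhdsWithin_le_nhds this

/-- The upper tangent exists if some point is equidistant. -/
theorem Equidistant.exists_upper {r : ℝ} (hr : 0 < r) {L R : Finset (ℝ × ℝ)} {hL : L.Nonempty}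
    {hR : R.Nonempty} (hE : Equidistant r L R hL hR) (hx : ∀ p ∈ L, ∀ q ∈ R, p.1 < q.1)
    (hgp : GenPos r (↑L ∪ ↑R)) :
    ∃ a ∈ L, ∃ b ∈ R, ∃ c, Cov r c L ∧ Cov r c R ∧ sq a c = r ^ 2 ∧ sq b c = r ^ 2 ∧
      orient c a b ≤ 0 := by
  have cL := continuous_far L hL
  have cR := continuous_far R hR
  set S : Set (ℝ × ℝ) := {c | far L hL c = far R hR c ∧ far L hL c ≤ r ^ 2} with hS
  have hSc : IsCompact S := by
    obtain ⟨p, hp⟩ := hL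
    refine (isCompact_Icc (a := (p.1 - r, p.2 - r)) (b := (p.1 + r, p.2 + r))).of_isClosed_subset
      ((isClosed_eq cL cR).inter (isClosed_le cL continuous_const)) ?_
    rintro c ⟨-, hc⟩
    have h1 := far_le_iff.1 hc p hp
    unfold sq at h1
    have h2 : |p.1 - c.1| ≤ r := abs_le_of_sq_le_sq (by nlinarith [sq_nonneg (p.2 - c.2)]) hr.le
    have h3 : |p.2 - c.2| ≤ r := abs_le_of_sq_le_sq (by nlinarith [sq_nonneg (p.1 - c.1)]) hr.le
    rw [abs_le] at h2 h3
    exact ⟨⟨by simp only; linarith, by simp only; linarith⟩,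
      ⟨by simp only; linarith, by simp only; linarith⟩⟩
  -- The center of the upper tangent disk is the lowest equidistant point. It has distance exactly
  -- `r` to both sets, because otherwise there is a lower one nearby.
  obtain ⟨c, ⟨hc1, hc2⟩, hmin⟩ := hSc.exists_isMinOn hE continuous_snd.continuousOn
  have hmin' : ∀ c', far L hL c' = far R hR c' → far L hL c' ≤ r ^ 2 → c.2 ≤ c'.2 :=
    fun c' h1 h2 => hmin (show c' ∈ S from ⟨h1, h2⟩)
  have hLc : Cov r c L := far_le_iff.1 hc2
  have hRc : Cov r c R := far_le_iff.1 (hc1 ▸ hc2)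
  have hc3 : far L hL c = r ^ 2 := by
    refine le_antisymm hc2 (not_lt.1 fun hlt => ?_)
    obtain ⟨c', h1, h2, h3⟩ := exists_lower_equidistant hL hR hx hc1 hlt
    exact absurd (hmin' c' h1 h2) (not_le.2 h3)
  obtain ⟨a, ha, ha'⟩ := exists_far hL c
  obtain ⟨b, hb, hb'⟩ := exists_far hR c
  have hac : sq a c = r ^ 2 := by rw [← ha', hc3]
  have hbc : sq b c = r ^ 2 := by rw [← hb', ← hc1, hc3]
  by_contra hno
  push Not at hno
  have hpos : ∀ a' ∈ L, ∀ b' ∈ R, sq a' c = r ^ 2 → sq b' c = r ^ 2 → 0 < orient c a' b' :=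
    fun a' ha' b' hb' h1 h2 => hno a' ha' b' hb' c hLc hRc h1 h2
  have hne : ∀ a' ∈ L, ∀ b' ∈ R, a' ≠ b' := fun a' h1 b' h2 h => by
    have := hx a' h1 b' h2
    rw [h] at this
    exact lt_irrefl _ this
  have hab := hpos a ha b hb hac hbc
  -- Two points of `L` on the circle would be on different sides of the diameter through `b`, but by
  -- `hpos` both have the same orientation with respect to `b`.
  have uL : ∀ a' ∈ L, a' ≠ a → sq a' c < sq a c := by
    intro a' h1 h2
    refine lt_of_le_of_ne (by rw [hac]; exact hLc a' h1) fun h3 => ?_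
    rw [hac] at h3
    have := hgp.opposite hr (Or.inl h1) (Or.inl ha) (Or.inr hb) h2 (hne a ha b hb)
      (hne a' h1 b hb) h3 hac hbc
    nlinarith [hpos a' h1 b hb h3 hbc]
  have uR : ∀ b' ∈ R, b' ≠ b → sq b' c < sq b c := by
    intro b' h1 h2
    refine lt_of_le_of_ne (by rw [hbc]; exact hRc b' h1) fun h3 => ?_
    rw [hbc] at h3
    have := hgp.opposite hr (Or.inr h1) (Or.inr hb) (Or.inl ha) h2 (hne a ha b hb).symm
      (hne a ha b' h1).symm h3 hbc hac
    have e1 : orient c b' a = - orient c a b' := by unfold orient; ring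
    have e2 : orient c b a = - orient c a b := by unfold orient; ring
    nlinarith [hpos a ha b' h1 hac h3]
  -- A shift along `w` keeps `a` and `b` at equal distances, brings them closer, and goes downward
  -- because the orientation has the wrong sign. As `a` and `b` are the only points on the circle,
  -- they remain farthest for small shifts, which contradicts minimality.
  set w : ℝ × ℝ := (a.1 - c.1 + (b.1 - c.1), a.2 - c.2 + (b.2 - c.2)) with hw
  have hw2 : w.2 < 0 := by
    have hδ := hx a ha b hb
    have e : (w.2) * ((b.1 - a.1) ^ 2 + (b.2 - a.2) ^ 2) =
        (sq b c - sq a c) * (b.2 - a.2) - 2 * orient c a b * (b.1 - a.1) := by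
      simp only [hw, sq, orient]; ring
    rw [hac, hbc, sub_self, zero_mul, zero_sub] at e
    have h1 : 0 < 2 * orient c a b * (b.1 - a.1) := mul_pos (by linarith) (by linarith)
    by_contra hcon
    push Not at hcon
    nlinarith [mul_nonneg hcon (by positivity : 0 ≤ (b.1 - a.1) ^ 2 + (b.2 - a.2) ^ 2)]
  have ev1 : ∀ᶠ ε : ℝ in 𝓝[>] 0, ∀ l ∈ L, l ≠ a → sq l (c + ε • w) < sq a (c + ε • w) :=
    (eventually_all_finset L).2 fun l hl => by
      by_cases hla : l = a
      · exact Eventually.of_forall fun ε h => absurd hla h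
      · exact (eventually_sq_lt l a c w (uL l hl hla)).mono fun ε h _ => h
  have ev2 : ∀ᶠ ε : ℝ in 𝓝[>] 0, ∀ l ∈ R, l ≠ b → sq l (c + ε • w) < sq b (c + ε • w) :=
    (eventually_all_finset R).2 fun l hl => by
      by_cases hla : l = b
      · exact Eventually.of_forall fun ε h => absurd hla h
      · exact (eventually_sq_lt l b c w (uR l hl hla)).mono fun ε h _ => h
  have ev3 : ∀ᶠ ε : ℝ in 𝓝[>] 0, ε < 1 :=
    Filter.Eventually.filter_mono nhdsWithin_le_nhds (gt_mem_nhds one_pos)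
  have ev4 : ∀ᶠ ε : ℝ in 𝓝[>] 0, 0 < ε := self_mem_nhdsWithin
  obtain ⟨ε, ⟨⟨h1, h2⟩, h3⟩, h4⟩ := (((ev1.and ev2).and ev3).and ev4).exists
  have q1 : sq a (c + ε • w) = r ^ 2 - (ε - ε ^ 2) * (w.1 ^ 2 + w.2 ^ 2) := by
    rw [sq_add_smul, hac]
    unfold sq at hac hbc
    simp only [hw]
    linear_combination (-ε) * hac + ε * hbc
  have q2 : sq b (c + ε • w) = r ^ 2 - (ε - ε ^ 2) * (w.1 ^ 2 + w.2 ^ 2) := by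
    rw [sq_add_smul, hbc]
    unfold sq at hac hbc
    simp only [hw]
    linear_combination ε * hac + (-ε) * hbc
  have fL : far L hL (c + ε • w) = sq a (c + ε • w) := by
    refine le_antisymm (Finset.sup'_le _ _ fun l hl => ?_) (sq_le_far hL ha _)
    by_cases hla : l = a
    · rw [hla]
    · exact (h1 l hl hla).le
  have fR : far R hR (c + ε • w) = sq b (c + ε • w) := by
    refine le_antisymm (Finset.sup'_le _ _ fun l hl => ?_) (sq_le_far hR hb _)
    by_cases hla : l = b
    · rw [hla]
    · exact (h2 l hl hla).le
  have hε : 0 ≤ ε - ε ^ 2 := by nlinarith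
  have := hmin' (c + ε • w) (by rw [fL, fR, q1, q2])
    (by rw [fL, q1]; nlinarith [mul_nonneg hε (by positivity : 0 ≤ w.1 ^ 2 + w.2 ^ 2)])
  simp only [Prod.snd_add, Prod.smul_snd, smul_eq_mul] at this
  nlinarith

theorem sq_segment_le (p o c : ℝ × ℝ) {s t : ℝ} (h0 : 0 ≤ s) (h1 : s ≤ 1) (ho : sq p o ≤ t)
    (hc : sq p c ≤ t) : sq p (o + s • (c - o)) ≤ t := by
  have e : sq p (o + s • (c - o)) = (1 - s) * sq p o + s * sq p c -
      s * (1 - s) * ((c.1 - o.1) ^ 2 + (c.2 - o.2) ^ 2) := by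
    simp only [sq, Prod.fst_add, Prod.snd_add, Prod.smul_fst, Prod.smul_snd, smul_eq_mul,
      Prod.fst_sub, Prod.snd_sub]; ring
  have h2 : 0 ≤ 1 - s := by linarith
  have := mul_nonneg (mul_nonneg h0 h2) (by positivity : 0 ≤ (c.1 - o.1) ^ 2 + (c.2 - o.2) ^ 2)
  nlinarith [mul_le_mul_of_nonneg_left ho h2, mul_le_mul_of_nonneg_left hc h0]

/-- Without an equidistant point, one of the sets dominates. -/
theorem cov_of_far_lt {r : ℝ} {L R : Finset (ℝ × ℝ)} {hL : L.Nonempty} {hR : R.Nonempty}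
    (hE : ¬ Equidistant r L R hL hR) {o c : ℝ × ℝ} (ho : Cov r o R)
    (hlt : far L hL o < far R hR o) (hc : Cov r c R) : Cov r c L := by
  by_contra hcon
  have h1 : far R hR c < far L hL c := by
    refine lt_of_le_of_lt (far_le_iff.2 hc) (not_le.1 fun h => hcon (far_le_iff.1 h))
  have k : Continuous fun s : ℝ => o + s • (c - o) := by fun_prop
  have hcont : ContinuousOn (fun s : ℝ => far L hL (o + s • (c - o)) - far R hR (o + s • (c - o)))
      (Set.Icc 0 1) :=
    (((continuous_far L hL).comp k).sub ((continuous_far R hR).comp k)).continuousOn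
  -- The difference of the farthest distances changes sign between `o` and `c`. The centers covering
  -- `R` form a convex set, so the zero on the segment is an equidistant point.
  obtain ⟨s, ⟨hs0, hs1⟩, hs⟩ := intermediate_value_Icc zero_le_one hcont
    (show (0 : ℝ) ∈ Set.Icc _ _ from ⟨by simpa using hlt.le, by simpa using h1.le⟩)
  have hs' : far L hL (o + s • (c - o)) = far R hR (o + s • (c - o)) := by
    simpa [sub_eq_zero] using hs
  refine hE ⟨_, hs', ?_⟩
  rw [hs', far_le_iff]
  exact fun p hp => sq_segment_le p o c hs0 hs1 (ho p hp) (hc p hp)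

theorem Equidistant.symm {r : ℝ} {L R : Finset (ℝ × ℝ)} {hL : L.Nonempty} {hR : R.Nonempty}
    (h : Equidistant r L R hL hR) : Equidistant r R L hR hL := by
  obtain ⟨c, h1, h2⟩ := h
  exact ⟨c, h1.symm, h1 ▸ h2⟩

/-- A set with a point on a tangent disk is not dominated. -/
theorem exists_cov_not_cov {r : ℝ} (hr : 0 < r) {L R : Finset (ℝ × ℝ)}
    (hgp : GenPos r (↑L ∪ ↑R)) {a b c : ℝ × ℝ} (hd : ∀ p ∈ L, p ≠ b)
    (hL : Cov r c L) (ha : a ∈ L) (hb : b ∈ R) (hac : sq a c = r ^ 2)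
    (hbc : sq b c = r ^ 2) : ∃ c', Cov r c' L ∧ ¬ Cov r c' R := by
  -- It is enough to have a direction at an acute angle to every point of `L` on the circle and at
  -- an obtuse angle to `b`. A small shift of the center along it keeps `L` covered and loses `b`.
  suffices h : ∃ w : ℝ × ℝ, (∀ l ∈ L, sq l c = r ^ 2 → 0 < w.1 * (l.1 - c.1) + w.2 * (l.2 - c.2)) ∧
      w.1 * (b.1 - c.1) + w.2 * (b.2 - c.2) < 0 by
    obtain ⟨w, h1, h2⟩ := h
    have ev : ∀ᶠ ε : ℝ in 𝓝[>] 0, ∀ l ∈ L, sq l (c + ε • w) < r ^ 2 := by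
      refine (eventually_all_finset L).2 fun l hl => ?_
      rcases eq_or_lt_of_le (hL l hl) with h | h
      · have h3 := h1 l hl h
        have k : Continuous fun ε : ℝ => ε * (w.1 ^ 2 + w.2 ^ 2) := by fun_prop
        have e1 : ∀ᶠ ε : ℝ in 𝓝[>] 0, ε * (w.1 ^ 2 + w.2 ^ 2) <
            2 * (w.1 * (l.1 - c.1) + w.2 * (l.2 - c.2)) :=
          Filter.Eventually.filter_mono nhdsWithin_le_nhds
            ((isOpen_lt k continuous_const).mem_nhds
              (show (0 : ℝ) ∈ {ε : ℝ | _ < _} by simp only [Set.mem_ofPred_eq]; linarith))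
        have e2 : ∀ᶠ ε : ℝ in 𝓝[>] 0, 0 < ε := self_mem_nhdsWithin
        filter_upwards [e1, e2] with ε h4 h5
        rw [sq_add_smul, h]
        nlinarith
      · have k : Continuous fun ε : ℝ => c + ε • w := by fun_prop
        exact Filter.Eventually.filter_mono nhdsWithin_le_nhds
          ((isOpen_lt ((continuous_sq l).comp k) continuous_const).mem_nhds
            (show (0 : ℝ) ∈ {ε : ℝ | sq l (c + ε • w) < r ^ 2} by simpa using h))
    have e2 : ∀ᶠ ε : ℝ in 𝓝[>] 0, 0 < ε := self_mem_nhdsWithin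
    obtain ⟨ε, h3, h4⟩ := (ev.and e2).exists
    refine ⟨_, fun l hl => (h3 l hl).le, fun hcov => ?_⟩
    have := hcov b hb
    rw [sq_add_smul, hbc] at this
    nlinarith [mul_pos h4 (neg_pos.2 h2), mul_nonneg (sq_nonneg ε)
      (by positivity : 0 ≤ w.1 ^ 2 + w.2 ^ 2)]
  -- At most two points of `L` are on the circle, since three could not be pairwise on different
  -- sides of the diameter through `b`. For two points their bisector serves; they are not
  -- antipodal. For one point the direction from `b` to `a` serves.
  by_cases hu : ∃ a' ∈ L, a' ≠ a ∧ sq a' c = r ^ 2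
  · obtain ⟨a', ha', hne, hac'⟩ := hu
    have o1 := hgp.opposite hr (Or.inl ha) (Or.inl ha') (Or.inr hb) hne.symm (hd a' ha') (hd a ha)
      hac hac' hbc
    have o2 := hgp.opposite hr (Or.inl ha') (Or.inr hb) (Or.inl ha) (hd a' ha') (hd a ha).symm
      hne hac' hbc hac
    have e1 : orient c a' a = - orient c a a' := by unfold orient; ring
    have e2 : orient c b a = - orient c a b := by unfold orient; ring
    set D := (a.1 - c.1) * (a'.1 - c.1) + (a.2 - c.2) * (a'.2 - c.2) with hD
    have hDr : 0 < r ^ 2 + D := by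
      have h1 : D ^ 2 + orient c a a' ^ 2 = r ^ 2 * r ^ 2 := by
        rw [← hac]
        nth_rw 2 [hac]
        rw [← hac', hD]; unfold orient sq; ring
      have h2 : 0 < orient c a a' ^ 2 := by
        have : orient c a a' ≠ 0 := by
          intro h
          rw [e1, h] at o2
          simp at o2
        positivity
      nlinarith [sq_nonneg (r ^ 2 + D), sq_nonneg r]
    refine ⟨(a.1 - c.1 + (a'.1 - c.1), a.2 - c.2 + (a'.2 - c.2)), ?_, ?_⟩
    · intro l hl hlc
      by_cases h1 : l = a
      · subst h1; simp only [hD] at hDr; unfold sq at hlc; simp only; linarith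
      · by_cases h2 : l = a'
        · subst h2; simp only [hD] at hDr; unfold sq at hlc; simp only; linarith
        · have p1 := hgp.opposite hr (Or.inl hl) (Or.inl ha) (Or.inr hb) h1 (hd a ha) (hd l hl)
            hlc hac hbc
          have p2 := hgp.opposite hr (Or.inl hl) (Or.inl ha') (Or.inr hb) h2 (hd a' ha') (hd l hl)
            hlc hac' hbc
          exfalso
          rcases mul_neg_iff.1 o1 with ⟨q1, q2⟩ | ⟨q1, q2⟩ <;>
            rcases mul_neg_iff.1 p1 with ⟨q3, q4⟩ | ⟨q3, q4⟩ <;>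
            rcases mul_neg_iff.1 p2 with ⟨q5, q6⟩ | ⟨q5, q6⟩ <;> linarith
    · have e3 : orient c a a' * ((a.1 - c.1 + (a'.1 - c.1)) * (b.1 - c.1) +
          (a.2 - c.2 + (a'.2 - c.2)) * (b.2 - c.2)) =
          - (orient c a' b * (sq a c + D) + orient c b a * (sq a' c + D)) := by
        rw [hD]; unfold orient sq; ring
      rw [hac, hac'] at e3
      rw [e1, e2] at o2
      rw [e2] at e3
      simp only
      generalize (a.1 - c.1 + (a'.1 - c.1)) * (b.1 - c.1) +
          (a.2 - c.2 + (a'.2 - c.2)) * (b.2 - c.2) = W at e3 ⊢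
      by_contra hW
      push Not at hW
      rcases mul_neg_iff.1 o1 with ⟨q1, q2⟩ | ⟨q1, q2⟩
      · have q3 : orient c a a' < 0 := by nlinarith
        nlinarith [mul_pos q1 hDr, mul_pos (neg_pos.2 q2) hDr]
      · have q3 : 0 < orient c a a' := by nlinarith
        nlinarith [mul_pos q2 hDr, mul_pos (neg_pos.2 q1) hDr]
  · push Not at hu
    have hlt : (a.1 - c.1) * (b.1 - c.1) + (a.2 - c.2) * (b.2 - c.2) < r ^ 2 := by
      have h1 : 0 < (a.1 - b.1) ^ 2 + (a.2 - b.2) ^ 2 := by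
        by_contra hcon
        apply hd a ha
        have h1 : (a.1 - b.1) ^ 2 = 0 := by
          nlinarith [sq_nonneg (a.1 - b.1), sq_nonneg (a.2 - b.2)]
        have h2 : (a.2 - b.2) ^ 2 = 0 := by
          nlinarith [sq_nonneg (a.1 - b.1), sq_nonneg (a.2 - b.2)]
        ext
        · nlinarith [pow_eq_zero_iff (two_ne_zero) |>.1 h1]
        · nlinarith [pow_eq_zero_iff (two_ne_zero) |>.1 h2]
      unfold sq at hac hbc
      nlinarith
    refine ⟨(a.1 - b.1, a.2 - b.2), ?_, ?_⟩
    · intro l hl hlc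
      obtain rfl : l = a := by
        by_contra h
        exact hu l hl h hlc
      unfold sq at hac
      simp only; nlinarith
    · unfold sq at hbc
      simp only; nlinarith

/-! ### Uniqueness of tangents -/

theorem dot_lt_of_ne {x y c : ℝ × ℝ} {ρ : ℝ} (hx : sq x c = ρ) (hy : sq y c = ρ) (hxy : x ≠ y) :
    (x.1 - c.1) * (y.1 - c.1) + (x.2 - c.2) * (y.2 - c.2) < ρ := by
  by_contra hcon
  apply hxy
  unfold sq at hx hy
  have h0 : (x.1 - y.1) * (x.1 - y.1) + (x.2 - y.2) * (x.2 - y.2) ≤ 0 := by linarith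
  have h1 := mul_self_nonneg (x.1 - y.1)
  have h2 := mul_self_nonneg (x.2 - y.2)
  ext
  · exact sub_eq_zero.1 (mul_self_eq_zero.1 (by linarith))
  · exact sub_eq_zero.1 (mul_self_eq_zero.1 (by linarith))

/-- The vector `s` is the combination of `a` and `b` with coefficients `α / κ` and `β / κ`, and
`hsum` says that it lies beyond the chord. If the coefficients had opposite signs, the bound on the
scalar product of `a` and `b` would make `s` longer than the radius. -/
theorem cap_aux {a₁ a₂ b₁ b₂ s₁ s₂ ρ : ℝ} (hA : a₁ ^ 2 + a₂ ^ 2 = ρ) (hB : b₁ ^ 2 + b₂ ^ 2 = ρ)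
    (hS : s₁ ^ 2 + s₂ ^ 2 < ρ) (hne : a₁ * b₁ + a₂ * b₂ < ρ) (ho : 0 < a₂ * b₁ - a₁ * b₂)
    (hsum : a₂ * b₁ - a₁ * b₂ ≤ (b₁ * s₂ - b₂ * s₁) + (s₁ * a₂ - s₂ * a₁)) :
    0 ≤ b₁ * s₂ - b₂ * s₁ ∧ 0 ≤ s₁ * a₂ - s₂ * a₁ := by
  have hρ : 0 ≤ ρ := by rw [← hA]; positivity
  obtain ⟨κ, hκ⟩ : ∃ κ, κ = a₂ * b₁ - a₁ * b₂ := ⟨_, rfl⟩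
  obtain ⟨α, hα⟩ : ∃ α, α = b₁ * s₂ - b₂ * s₁ := ⟨_, rfl⟩
  obtain ⟨β, hβ⟩ : ∃ β, β = s₁ * a₂ - s₂ * a₁ := ⟨_, rfl⟩
  obtain ⟨D, hD⟩ : ∃ D, D = a₁ * b₁ + a₂ * b₂ := ⟨_, rfl⟩
  have hS2 : κ ^ 2 * (s₁ ^ 2 + s₂ ^ 2) = (α ^ 2 + β ^ 2) * ρ + 2 * (α * β) * D := by
    have : κ ^ 2 * (s₁ ^ 2 + s₂ ^ 2) =
        α ^ 2 * (a₁ ^ 2 + a₂ ^ 2) + β ^ 2 * (b₁ ^ 2 + b₂ ^ 2) + 2 * (α * β) * D := by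
      rw [hα, hβ, hκ, hD]; ring
    rw [this, hA, hB]; ring
  rw [← hκ] at ho hsum
  rw [← hα, ← hβ] at hsum ⊢
  rw [← hD] at hne
  have hαβ : 0 ≤ α * β := by
    by_contra hneg
    push Not at hneg
    have h0 := mul_pos (neg_pos.2 hneg) (sub_pos.2 hne)
    have h2 : κ ^ 2 ≤ (α + β) ^ 2 := pow_le_pow_left₀ ho.le hsum 2
    have h3 : κ ^ 2 * ρ ≤ (α + β) ^ 2 * ρ := mul_le_mul_of_nonneg_right h2 hρ
    have h4 := mul_lt_mul_of_pos_left hS (by positivity : 0 < κ ^ 2)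
    linarith
  rcases mul_nonneg_iff.1 hαβ with h1 | h1
  · exact h1
  · linarith [h1.1, h1.2]

/-- No vertex lies in the cap that a minor arc cuts off. -/
theorem GenPos.eq_of_orient_nonneg {r : ℝ} {Q : Set (ℝ × ℝ)} (h : GenPos r Q)
    {a b s c c' : ℝ × ℝ} (ha : a ∈ Q) (hb : b ∈ Q) (hs : s ∈ Q) (hab : a ≠ b)
    (hac : sq a c = r ^ 2) (hbc : sq b c = r ^ 2) (ho : orient c a b ≤ 0) (hsc : sq s c ≤ r ^ 2)
    (hac' : sq a c' ≤ r ^ 2) (hbc' : sq b c' ≤ r ^ 2) (hsc' : sq s c' = r ^ 2)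
    (hs0 : 0 ≤ orient a b s) : s = a ∨ s = b := by
  by_contra hcon
  push Not at hcon
  have hlt : sq s c < r ^ 2 :=
    lt_of_le_of_ne hsc fun h1 => h a ha b hb s hs hab hcon.1 hcon.2 c hac hbc ho h1 hs0
  have hD := dot_lt_of_ne hac hbc hab
  obtain ⟨e₁, h₁⟩ : ∃ e, e = c'.1 - c.1 := ⟨_, rfl⟩
  obtain ⟨e₂, h₂⟩ : ∃ e, e = c'.2 - c.2 := ⟨_, rfl⟩
  obtain ⟨E, hE⟩ : ∃ E, E = e₁ * e₁ + e₂ * e₂ := ⟨_, rfl⟩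
  have hE1 := mul_self_nonneg e₁
  have hE2 := mul_self_nonneg e₂
  have shift : ∀ x : ℝ × ℝ, sq x c' = sq x c - 2 * (e₁ * (x.1 - c.1) + e₂ * (x.2 - c.2)) + E := by
    intro x; simp only [hE, h₁, h₂, sq]; ring
  -- Being covered by the disk around `c'` is a lower bound on the projection to the displacement
  -- `c' - c`. A point in the cap is a nonnegative combination of `a` and `b` with coefficient sum
  -- at least one, so it inherits the bound. It would then be strictly inside the disk around `c'`,
  -- but `s` is on its boundary.
  have eA : E ≤ 2 * (e₁ * (a.1 - c.1) + e₂ * (a.2 - c.2)) := by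
    have := shift a; rw [hac] at this; linarith
  have eB : E ≤ 2 * (e₁ * (b.1 - c.1) + e₂ * (b.2 - c.2)) := by
    have := shift b; rw [hbc] at this; linarith
  have eS := shift s
  rw [hsc'] at eS
  unfold orient at ho hs0
  -- If the arc is a half circle, `a` and `b` are antipodal; the two bounds add up to zero and force
  -- `c' = c`.
  rcases eq_or_lt_of_le ho with h0 | h0
  · unfold sq at hac hbc
    have hD2 : ((a.1 - c.1) * (b.1 - c.1) + (a.2 - c.2) * (b.2 - c.2)) ^ 2 = (r ^ 2) ^ 2 := by
      linear_combination (-((a.1 - c.1) * (b.2 - c.2) - (a.2 - c.2) * (b.1 - c.1))) * h0 +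
        ((b.1 - c.1) ^ 2 + (b.2 - c.2) ^ 2) * hac + r ^ 2 * hbc
    have h2 := (sq_eq_sq_iff_eq_or_eq_neg.1 hD2).resolve_left hD.ne
    have h3 : (a.1 - c.1 + (b.1 - c.1)) * (a.1 - c.1 + (b.1 - c.1)) +
        (a.2 - c.2 + (b.2 - c.2)) * (a.2 - c.2 + (b.2 - c.2)) = 0 := by
      linear_combination hac + hbc + 2 * h2
    have k1 := mul_self_nonneg (a.1 - c.1 + (b.1 - c.1))
    have k2 := mul_self_nonneg (a.2 - c.2 + (b.2 - c.2))
    have h4 : a.1 - c.1 + (b.1 - c.1) = 0 := mul_self_eq_zero.1 (by linarith)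
    have h5 : a.2 - c.2 + (b.2 - c.2) = 0 := mul_self_eq_zero.1 (by linarith)
    have e1 : e₁ * (a.1 - c.1) + e₂ * (a.2 - c.2) + (e₁ * (b.1 - c.1) + e₂ * (b.2 - c.2)) = 0 := by
      linear_combination e₁ * h4 + e₂ * h5
    have h7 : e₁ = 0 := mul_self_eq_zero.1 (by linarith)
    have h8 : e₂ = 0 := mul_self_eq_zero.1 (by linarith)
    rw [hE, h7, h8] at eS
    linarith
  · unfold sq at hac hbc
    have hsum : (a.2 - c.2) * (b.1 - c.1) - (a.1 - c.1) * (b.2 - c.2) ≤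
        ((b.1 - c.1) * (s.2 - c.2) - (b.2 - c.2) * (s.1 - c.1)) +
        ((s.1 - c.1) * (a.2 - c.2) - (s.2 - c.2) * (a.1 - c.1)) := by linarith
    have hκ0 : 0 < (a.2 - c.2) * (b.1 - c.1) - (a.1 - c.1) * (b.2 - c.2) := by linarith
    have hpos := cap_aux hac hbc (by unfold sq at hlt; exact hlt) hD hκ0 hsum
    obtain ⟨κ, hκ⟩ : ∃ κ, κ = (a.2 - c.2) * (b.1 - c.1) - (a.1 - c.1) * (b.2 - c.2) := ⟨_, rfl⟩
    obtain ⟨α, hα⟩ : ∃ α, α = (b.1 - c.1) * (s.2 - c.2) - (b.2 - c.2) * (s.1 - c.1) := ⟨_, rfl⟩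
    obtain ⟨β, hβ⟩ : ∃ β, β = (s.1 - c.1) * (a.2 - c.2) - (s.2 - c.2) * (a.1 - c.1) := ⟨_, rfl⟩
    have hκS : κ * (e₁ * (s.1 - c.1) + e₂ * (s.2 - c.2)) =
        α * (e₁ * (a.1 - c.1) + e₂ * (a.2 - c.2)) +
        β * (e₁ * (b.1 - c.1) + e₂ * (b.2 - c.2)) := by
      rw [hα, hβ, hκ]; ring
    rw [← hα, ← hβ] at hpos
    rw [← hκ, ← hα, ← hβ] at hsum
    rw [← hκ] at hκ0
    have k1 := mul_le_mul_of_nonneg_left eA hpos.1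
    have k2 := mul_le_mul_of_nonneg_left eB hpos.2
    have k3 := mul_le_mul_of_nonneg_right hsum (show 0 ≤ E by linarith)
    have h1 : κ * E ≤ κ * (2 * (e₁ * (s.1 - c.1) + e₂ * (s.2 - c.2))) := by linarith
    have h2 := le_of_mul_le_mul_left h1 hκ0
    linarith

/-- No vertex lies in the cap of either arc, so the points of each tangent that are not shared lie
strictly below the chord of the other. Both chords cross the separating line, and there each would
have to be below the other. -/
theorem upper_unique {r t : ℝ} {L R : Finset (ℝ × ℝ)} (hgp : GenPos r (↑L ∪ ↑R))
    (hLt : ∀ p ∈ L, p.1 < t) (hRt : ∀ q ∈ R, t < q.1) {a b c a' b' c' : ℝ × ℝ}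
    (ha : a ∈ L) (hb : b ∈ R) (hcL : Cov r c L) (hcR : Cov r c R) (hac : sq a c = r ^ 2)
    (hbc : sq b c = r ^ 2) (ho : orient c a b ≤ 0)
    (ha' : a' ∈ L) (hb' : b' ∈ R) (hcL' : Cov r c' L) (hcR' : Cov r c' R) (hac' : sq a' c' = r ^ 2)
    (hbc' : sq b' c' = r ^ 2) (ho' : orient c' a' b' ≤ 0) : a = a' ∧ b = b' := by
  have ne : ∀ p ∈ L, ∀ q ∈ R, p ≠ q := fun p hp q hq h => by
    have := (hLt p hp).trans (hRt q hq)
    rw [h] at this; exact lt_irrefl _ this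
  have k1 : a' = a ∨ orient a b a' < 0 := by
    by_contra hcon
    push Not at hcon
    rcases hgp.eq_of_orient_nonneg (Or.inl ha) (Or.inr hb) (Or.inl ha') (ne a ha b hb) hac hbc ho
      (hcL a' ha') (hcL' a ha) (hcR' b hb) hac' hcon.2 with h | h
    · exact hcon.1 h
    · exact ne a' ha' b hb h
  have k2 : b' = b ∨ orient a b b' < 0 := by
    by_contra hcon
    push Not at hcon
    rcases hgp.eq_of_orient_nonneg (Or.inl ha) (Or.inr hb) (Or.inr hb') (ne a ha b hb) hac hbc ho
      (hcR b' hb') (hcL' a ha) (hcR' b hb) hbc' hcon.2 with h | h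
    · exact ne a ha b' hb' h.symm
    · exact hcon.1 h
  have k3 : a = a' ∨ orient a' b' a < 0 := by
    by_contra hcon
    push Not at hcon
    rcases hgp.eq_of_orient_nonneg (Or.inl ha') (Or.inr hb') (Or.inl ha) (ne a' ha' b' hb') hac'
      hbc' ho' (hcL' a ha) (hcL a' ha') (hcR b' hb') hac hcon.2 with h | h
    · exact hcon.1 h
    · exact ne a ha b' hb' h
  have k4 : b = b' ∨ orient a' b' b < 0 := by
    by_contra hcon
    push Not at hcon
    rcases hgp.eq_of_orient_nonneg (Or.inl ha') (Or.inr hb') (Or.inr hb) (ne a' ha' b' hb') hac'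
      hbc' ho' (hcR' b hb) (hcL a' ha') (hcR b' hb') hbc hcon.2 with h | h
    · exact ne a' ha' b hb h.symm
    · exact hcon.1 h
  have p1 := hLt a ha
  have p2 := hLt a' ha'
  have p3 := hRt b hb
  have p4 := hRt b' hb'
  by_cases ea : a = a'
  · subst ea
    refine ⟨rfl, ?_⟩
    rcases k2 with h | h
    · exact h.symm
    rcases k4 with h' | h'
    · exact h'
    have : orient a b b' = - orient a b' b := by unfold orient; ring
    linarith
  · have k1' := k1.resolve_left (Ne.symm ea)
    have k3' := k3.resolve_left ea
    by_cases eb : b = b'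
    · subst eb
      have : orient a b a' = - orient a' b a := by unfold orient; ring
      linarith
    · have k2' := k2.resolve_left (Ne.symm eb)
      have k4' := k4.resolve_left eb
      exfalso
      -- Up to a positive factor each side is the difference of the heights of the two chords at the
      -- abscissa `t`.
      have e : (b'.1 - t) * orient a b a' + (t - a'.1) * orient a b b' =
          - ((b.1 - t) * orient a' b' a + (t - a.1) * orient a' b' b) := by unfold orient; ring
      nlinarith [mul_pos (sub_pos.2 p4) (neg_pos.2 k1'), mul_pos (sub_pos.2 p2) (neg_pos.2 k2'),
        mul_pos (sub_pos.2 p3) (neg_pos.2 k3'), mul_pos (sub_pos.2 p1) (neg_pos.2 k4')]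

/-- A disk that covers the vertices covers everything. -/
theorem cov_of_cov_vertices {r : ℝ} {Q : Finset (ℝ × ℝ)} {o c : ℝ × ℝ} (ho : Cov r o Q)
    (hc : ∀ v ∈ Q, (∃ c', Cov r c' Q ∧ sq v c' = r ^ 2) → sq v c ≤ r ^ 2) : Cov r c Q := by
  by_contra hcon
  have hne : (Q.filter fun q => r ^ 2 < sq q c).Nonempty := by
    unfold Cov at hcon
    push Not at hcon
    obtain ⟨q, hq, h⟩ := hcon
    exact ⟨q, Finset.mem_filter.2 ⟨hq, h⟩⟩
  have hex : ∀ q, ∃ s : ℝ, q ∈ Q.filter (fun q => r ^ 2 < sq q c) →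
      0 ≤ s ∧ s ≤ 1 ∧ sq q (o + s • (c - o)) = r ^ 2 := by
    intro q
    by_cases hq : q ∈ Q.filter fun q => r ^ 2 < sq q c
    · obtain ⟨hqQ, hqc⟩ := Finset.mem_filter.1 hq
      have k : Continuous fun s : ℝ => o + s • (c - o) := by fun_prop
      obtain ⟨s, ⟨h0, h1⟩, hs⟩ := intermediate_value_Icc zero_le_one
        ((continuous_sq q).comp k).continuousOn
        (show r ^ 2 ∈ Set.Icc _ _ from ⟨by simpa using ho q hqQ, by simpa using hqc.le⟩)
      exact ⟨s, fun _ => ⟨h0, h1, hs⟩⟩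
    · exact ⟨0, fun h => absurd h hq⟩
  choose f hf using hex
  -- As the center moves from `o` to `c`, the point `v` is the first to leave the disk. At that
  -- moment `v` is on the boundary and everything is covered, so `v` is a vertex outside the disk
  -- around `c`.
  obtain ⟨v, hv, hmin⟩ := Finset.exists_min_image _ f hne
  obtain ⟨hv0, hv1, hvf⟩ := hf v hv
  obtain ⟨hvQ, hvc⟩ := Finset.mem_filter.1 hv
  refine absurd (hc v hvQ ⟨_, fun q hq => ?_, hvf⟩) (not_le.2 hvc)
  by_cases hqc : sq q c ≤ r ^ 2
  · exact sq_segment_le q o c hv0 hv1 (ho q hq) hqc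
  · have hq' : q ∈ Q.filter fun q => r ^ 2 < sq q c := Finset.mem_filter.2 ⟨hq, not_le.1 hqc⟩
    obtain ⟨h0, -, h2⟩ := hf q hq'
    have hle := hmin q hq'
    rcases eq_or_lt_of_le h0 with h3 | h3
    · have : f v = 0 := le_antisymm (h3 ▸ hle) hv0
      rw [this]; simpa using ho q hq
    · have := sq_segment_le q o (o + f q • (c - o)) (div_nonneg hv0 h0)
        ((div_le_one h3).2 hle) (ho q hq) h2.le
      rwa [add_sub_cancel_left, smul_smul, div_mul_cancel₀ _ h3.ne'] at this

/-! ### Coordinate frames -/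

/-- Coordinates of the plane with first axis in direction `σ u` and orientation `σ τ`, scaled by
the length of `u`. -/
def hat (u : Plane) (σ τ : ℝ) (p : Plane) : ℝ × ℝ :=
  (σ * (u 0 * p 0 + u 1 * p 1), τ * (u 0 * p 1 - u 1 * p 0))

/-- The radius in the coordinates given by `hat`. -/
noncomputable def rad (r : ℝ) (u : Plane) : ℝ := r * Real.sqrt (u 0 * u 0 + u 1 * u 1)

theorem norm_pos_of_ne {u : Plane} (hu : u ≠ 0) : 0 < u 0 * u 0 + u 1 * u 1 := by
  by_contra hcon
  apply hu
  have h1 : u 0 = 0 := by nlinarith [mul_self_nonneg (u 0), mul_self_nonneg (u 1)]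
  have h2 : u 1 = 0 := by nlinarith [mul_self_nonneg (u 0), mul_self_nonneg (u 1)]
  ext i
  fin_cases i
  · exact h1
  · exact h2

theorem dist_sq (p c : Plane) : dist p c ^ 2 = (p 0 - c 0) ^ 2 + (p 1 - c 1) ^ 2 := by
  rw [EuclideanSpace.dist_eq, Real.sq_sqrt (by positivity), Fin.sum_univ_two, Real.dist_eq,
    Real.dist_eq, sq_abs, sq_abs]

/-- With signs for `σ` and `τ`, the map `hat` is a similarity, a reflection if the signs differ.
Scaling the radius takes the place of normalizing `u`. -/
structure Frame (u : Plane) (σ τ : ℝ) : Prop where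
  ne : u ≠ 0
  hσ : σ * σ = 1
  hτ : τ * τ = 1

namespace Frame

variable {u : Plane} {σ τ : ℝ}

theorem sq_hat (F : Frame u σ τ) (p c : Plane) :
    sq (hat u σ τ p) (hat u σ τ c) = (u 0 * u 0 + u 1 * u 1) * dist p c ^ 2 := by
  rw [dist_sq]
  simp only [sq, hat]
  linear_combination (u 0 * (p 0 - c 0) + u 1 * (p 1 - c 1)) ^ 2 * F.hσ +
    (u 0 * (p 1 - c 1) - u 1 * (p 0 - c 0)) ^ 2 * F.hτ

theorem orient_hat (u : Plane) (σ τ : ℝ) (c p q : Plane) :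
    orient (hat u σ τ c) (hat u σ τ p) (hat u σ τ q) =
      σ * τ * (u 0 * u 0 + u 1 * u 1) * cross (p - c) (q - c) := by
  simp only [orient, hat, cross, PiLp.sub_apply]
  ring

theorem surj (F : Frame u σ τ) (z : ℝ × ℝ) : ∃ c, hat u σ τ c = z := by
  have hN := mul_inv_cancel₀ (norm_pos_of_ne F.ne).ne'
  refine ⟨!₂[(u 0 * (σ * z.1) - u 1 * (τ * z.2)) / (u 0 * u 0 + u 1 * u 1),
    (u 1 * (σ * z.1) + u 0 * (τ * z.2)) / (u 0 * u 0 + u 1 * u 1)], ?_⟩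
  ext
  · simp only [hat, Matrix.cons_val_zero, Matrix.cons_val_one, div_eq_mul_inv]
    linear_combination (σ * σ * z.1) * hN + z.1 * F.hσ
  · simp only [hat, Matrix.cons_val_zero, Matrix.cons_val_one, div_eq_mul_inv]
    linear_combination (τ * τ * z.2) * hN + z.2 * F.hτ

theorem rad_sq (F : Frame u σ τ) (r : ℝ) : rad r u ^ 2 = (u 0 * u 0 + u 1 * u 1) * r ^ 2 := by
  rw [rad, mul_pow, Real.sq_sqrt (norm_pos_of_ne F.ne).le]; ring

theorem rad_pos (F : Frame u σ τ) {r : ℝ} (hr : 0 < r) : 0 < rad r u :=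
  mul_pos hr (Real.sqrt_pos.2 (norm_pos_of_ne F.ne))

theorem sq_le_iff (F : Frame u σ τ) {r : ℝ} (hr : 0 < r) (p c : Plane) :
    sq (hat u σ τ p) (hat u σ τ c) ≤ rad r u ^ 2 ↔ dist p c ≤ r := by
  rw [F.sq_hat, F.rad_sq, mul_le_mul_iff_right₀ (norm_pos_of_ne F.ne),
    sq_le_sq₀ dist_nonneg hr.le]

theorem sq_eq_iff (F : Frame u σ τ) {r : ℝ} (hr : 0 < r) (p c : Plane) :
    sq (hat u σ τ p) (hat u σ τ c) = rad r u ^ 2 ↔ dist p c = r := by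
  rw [F.sq_hat, F.rad_sq, mul_right_inj' (norm_pos_of_ne F.ne).ne',
    sq_eq_sq₀ dist_nonneg hr.le]

theorem inj (F : Frame u σ τ) : Function.Injective (hat u σ τ) := by
  intro p q h
  have h1 := F.sq_hat p q
  rw [h] at h1
  have h2 : sq (hat u σ τ q) (hat u σ τ q) = 0 := by unfold sq; ring
  rw [h2] at h1
  rcases mul_eq_zero.1 h1.symm with h3 | h3
  · exact absurd h3 (norm_pos_of_ne F.ne).ne'
  · exact dist_eq_zero.1 (pow_eq_zero_iff two_ne_zero |>.1 h3)

theorem cov_iff (F : Frame u σ τ) {r : ℝ} (hr : 0 < r) (c : Plane) (Q : Finset Plane) :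
    Cov (rad r u) (hat u σ τ c) (Q.image (hat u σ τ)) ↔ Covers r c ↑Q := by
  constructor
  · intro h p hp
    exact (F.sq_le_iff hr p c).1 (h _ (Finset.mem_image_of_mem _ hp))
  · intro h p hp
    obtain ⟨q, hq, rfl⟩ := Finset.mem_image.1 hp
    exact (F.sq_le_iff hr q c).2 (h hq)

/-- A frame that reverses the orientation turns a clockwise arc into a counterclockwise one, so in
that case the two end points are exchanged. -/
theorem genPos (F : Frame u σ τ) {r : ℝ} (hr : 0 < r) {Q : Set Plane} (h : GeneralPosition r Q) :
    GenPos (rad r u) (hat u σ τ '' Q) := by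
  have hN := norm_pos_of_ne F.ne
  rintro _ ⟨p, hp, rfl⟩ _ ⟨q, hq, rfl⟩ _ ⟨s, hs, rfl⟩ hpq hsp hsq c hpc hqc ho hsc ho'
  obtain ⟨c, rfl⟩ := F.surj c
  rw [F.sq_eq_iff hr] at hpc hqc hsc
  rw [orient_hat] at ho ho'
  have hστ : σ * τ = 1 ∨ σ * τ = -1 := by
    have : (σ * τ) * (σ * τ) = 1 := by linear_combination τ * τ * F.hσ + F.hτ
    exact mul_self_eq_one_iff.1 this
  have e1 : cross (p - q) (s - q) = - cross (q - p) (s - p) := by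
    simp only [cross, PiLp.sub_apply]; ring
  have e2 : cross (q - c) (p - c) = - cross (p - c) (q - c) := by
    simp only [cross]; ring
  rcases hστ with h1 | h1
  · rw [h1, one_mul] at ho ho'
    refine h p hp q hq s hs (fun e => hpq (by rw [e])) (fun e => hsp (by rw [e]))
      (fun e => hsq (by rw [e])) ⟨c, hpc, hqc, ?_, hsc, ?_⟩
    · by_contra hcon
      push Not at hcon
      nlinarith [mul_pos hN hcon]
    · by_contra hcon
      push Not at hcon
      nlinarith [mul_pos hN (neg_pos.2 hcon)]
  · rw [h1] at ho ho'
    refine h q hq p hp s hs (fun e => hpq (by rw [e])) (fun e => hsq (by rw [e]))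
      (fun e => hsp (by rw [e])) ⟨c, hqc, hpc, ?_, hsc, ?_⟩
    · rw [e2]
      by_contra hcon
      push Not at hcon
      nlinarith [mul_pos hN hcon]
    · rw [e1]
      by_contra hcon
      push Not at hcon
      nlinarith [mul_pos hN (neg_pos.2 hcon)]

theorem genPos_union (F : Frame u σ τ) {r : ℝ} (hr : 0 < r) {L R : Finset Plane}
    (h : GeneralPosition r (↑L ∪ ↑R)) :
    GenPos (rad r u) (↑(L.image (hat u σ τ)) ∪ ↑(R.image (hat u σ τ))) := by
  have := F.genPos hr h
  rwa [Set.image_union, ← Finset.coe_image, ← Finset.coe_image] at this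

theorem far_image (F : Frame u σ τ) {Q : Finset Plane} (hQ : Q.Nonempty) (c : Plane) :
    far (Q.image (hat u σ τ)) (hQ.image _) (hat u σ τ c) =
      Q.sup' hQ (fun p => (u 0 * u 0 + u 1 * u 1) * dist p c ^ 2) := by
  unfold far
  rw [Finset.sup'_image]
  simp only [Function.comp_def, F.sq_hat]

end Frame

/-- Some point is equally far from `L` and `R`, at distance at most `r`. -/
def Equi (r : ℝ) (u : Plane) (L R : Finset Plane) (hL : L.Nonempty) (hR : R.Nonempty) : Prop :=
  Equidistant (rad r u) (L.image (hat u 1 1)) (R.image (hat u 1 1)) (hL.image _) (hR.image _)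

/-- Farthest distances do not depend on the frame, so equidistance in one frame serves for upper and
lower tangents alike. -/
theorem Equi.equidistant {r : ℝ} {u : Plane} {L R : Finset Plane} {hL : L.Nonempty}
    {hR : R.Nonempty} (h : Equi r u L R hL hR) {σ τ : ℝ} (F : Frame u σ τ) :
    Equidistant (rad r u) (L.image (hat u σ τ)) (R.image (hat u σ τ)) (hL.image _) (hR.image _) := by
  have F1 : Frame u 1 1 := ⟨F.ne, by norm_num, by norm_num⟩
  obtain ⟨c, h1, h2⟩ := h
  obtain ⟨c, rfl⟩ := F1.surj c
  rw [F1.far_image hL, F1.far_image hR] at h1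
  rw [F1.far_image hL] at h2
  exact ⟨hat u σ τ c, by rw [F.far_image hL, F.far_image hR, h1], by rwa [F.far_image hL]⟩

/-- `a` and `b` lie on a disk covering `L` and `R`; the orientation is that of the upper common
tangent for `τ = 1` and that of the lower common tangent for `τ = -1`. -/
def Tangent (τ r : ℝ) (L R : Finset Plane) (a b : Plane) : Prop :=
  ∃ c, Covers r c ↑L ∧ Covers r c ↑R ∧ a ∈ L ∧ b ∈ R ∧ dist a c = r ∧ dist b c = r ∧
    τ * cross (a - c) (b - c) ≤ 0

/-- A disk of radius `r` contains the hull exactly if it contains the set; this removes the hull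
from the notion of a tangent. -/
theorem isTangentAt_iff {r : ℝ} {Q : Finset Plane} {c v : Plane} :
    IsTangentAt r ↑Q c v ↔ Covers r c ↑Q ∧ v ∈ Q ∧ dist v c = r := by
  constructor
  · rintro ⟨⟨h1, -⟩, h2, h3⟩
    refine ⟨fun p hp => h3 ?_, h1, h2⟩
    simp only [hull, Set.mem_iInter]
    exact fun c' hc' => hc' hp
  · rintro ⟨h1, h2, h3⟩
    exact ⟨⟨h2, c, h1, h3⟩, h3, Set.iInter₂_subset c h1⟩

theorem isUpperTangent_iff {r : ℝ} {L R : Finset Plane} {a b : Plane} :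
    IsUpperTangent r ↑L ↑R a b ↔ Tangent 1 r L R a b := by
  simp only [IsUpperTangent, isTangentAt_iff, Tangent, one_mul]
  constructor
  · rintro ⟨c, ⟨h1, h2, h3⟩, ⟨h4, h5, h6⟩, h7⟩
    exact ⟨c, h1, h4, h2, h5, h3, h6, h7⟩
  · rintro ⟨c, h1, h4, h2, h5, h3, h6, h7⟩
    exact ⟨c, ⟨h1, h2, h3⟩, ⟨h4, h5, h6⟩, h7⟩

theorem isLowerTangent_iff {r : ℝ} {L R : Finset Plane} {a b : Plane} :
    IsLowerTangent r ↑L ↑R a b ↔ Tangent (-1) r L R a b := by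
  simp only [IsLowerTangent, isTangentAt_iff, Tangent]
  constructor
  · rintro ⟨c, ⟨h1, h2, h3⟩, ⟨h4, h5, h6⟩, h7⟩
    exact ⟨c, h1, h4, h2, h5, h3, h6, by linarith⟩
  · rintro ⟨c, h1, h4, h2, h5, h3, h6, h7⟩
    exact ⟨c, ⟨h1, h2, h3⟩, ⟨h4, h5, h6⟩, by linarith⟩

theorem subset_hull_iff {r : ℝ} {Q : Set Plane} {S : Set Plane} :
    S ⊆ hull r Q ↔ ∀ c, Covers r c Q → Covers r c S := by
  simp only [hull, Set.subset_iInter_iff]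
  rfl

theorem inner_eq (u p : Plane) : inner ℝ u p = u 0 * p 0 + u 1 * p 1 := by
  simp only [PiLp.inner_apply, Fin.sum_univ_two, RCLike.inner_apply, conj_trivial]
  ring

/-- The two sets are separated by the line `⟪u, x⟫ = t`. -/
structure Separated (r : ℝ) (u : Plane) (t : ℝ) (L R : Finset Plane) : Prop where
  pos : 0 < r
  left : ∀ p ∈ L, u 0 * p 0 + u 1 * p 1 < t
  right : ∀ q ∈ R, t < u 0 * q 0 + u 1 * q 1
  gp : GeneralPosition r (↑L ∪ ↑R)
  neL : L.Nonempty
  neR : R.Nonempty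

/-! ### Tangents and domination for separated sets -/

namespace Separated

variable {r t : ℝ} {u : Plane} {L R : Finset Plane}

theorem ne (S : Separated r u t L R) : u ≠ 0 := by
  rintro rfl
  obtain ⟨p, hp⟩ := S.neL
  obtain ⟨q, hq⟩ := S.neR
  have h1 := S.left p hp
  have h2 := S.right q hq
  simp at h1 h2
  linarith

theorem frame (S : Separated r u t L R) {τ : ℝ} (hτ : τ * τ = 1) : Frame u 1 τ :=
  ⟨S.ne, by norm_num, hτ⟩

theorem mem_ne (S : Separated r u t L R) {p q : Plane} (hp : p ∈ L) (hq : q ∈ R) : p ≠ q := by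
  rintro rfl
  linarith [S.left p hp, S.right p hq]

/-- The frame with `τ = -1` reflects the plane in the first axis and turns lower tangents into upper
ones. -/
theorem exists_tangent (S : Separated r u t L R) (hE : Equi r u L R S.neL S.neR) {τ : ℝ}
    (hτ : τ * τ = 1) : ∃ a b, Tangent τ r L R a b := by
  have F := S.frame hτ
  obtain ⟨a, ha, b, hb, c, h1, h2, h3, h4, h5⟩ := (hE.equidistant F).exists_upper (F.rad_pos S.pos)
    (by
      intro p hp q hq
      obtain ⟨p, hp', rfl⟩ := Finset.mem_image.1 hp
      obtain ⟨q, hq', rfl⟩ := Finset.mem_image.1 hq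
      simp only [hat, one_mul]
      exact (S.left p hp').trans (S.right q hq')) (F.genPos_union S.pos S.gp)
  obtain ⟨a, ha', rfl⟩ := Finset.mem_image.1 ha
  obtain ⟨b, hb', rfl⟩ := Finset.mem_image.1 hb
  obtain ⟨c, rfl⟩ := F.surj c
  rw [Frame.orient_hat] at h5
  refine ⟨a, b, c, (F.cov_iff S.pos c L).1 h1, (F.cov_iff S.pos c R).1 h2, ha', hb',
    (F.sq_eq_iff S.pos a c).1 h3, (F.sq_eq_iff S.pos b c).1 h4, ?_⟩
  have hN := norm_pos_of_ne S.ne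
  by_contra hcon
  push Not at hcon
  nlinarith [mul_pos hN hcon]

theorem tangent_unique (S : Separated r u t L R) {τ : ℝ} (hτ : τ * τ = 1) {a b a' b' : Plane}
    (h : Tangent τ r L R a b) (h' : Tangent τ r L R a' b') : a = a' ∧ b = b' := by
  have F := S.frame hτ
  have hN := norm_pos_of_ne S.ne
  obtain ⟨c, h1, h2, h3, h4, h5, h6, h7⟩ := h
  obtain ⟨c', g1, g2, g3, g4, g5, g6, g7⟩ := h'
  have := upper_unique (t := t) (F.genPos_union S.pos S.gp)
    (by
      intro p hp
      obtain ⟨p, hp', rfl⟩ := Finset.mem_image.1 hp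
      simpa only [hat, one_mul] using S.left p hp')
    (by
      intro p hp
      obtain ⟨p, hp', rfl⟩ := Finset.mem_image.1 hp
      simpa only [hat, one_mul] using S.right p hp')
    (Finset.mem_image_of_mem _ h3) (Finset.mem_image_of_mem _ h4) ((F.cov_iff S.pos c L).2 h1)
    ((F.cov_iff S.pos c R).2 h2) ((F.sq_eq_iff S.pos a c).2 h5) ((F.sq_eq_iff S.pos b c).2 h6)
    (by rw [Frame.orient_hat]; nlinarith)
    (Finset.mem_image_of_mem _ g3) (Finset.mem_image_of_mem _ g4) ((F.cov_iff S.pos c' L).2 g1)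
    ((F.cov_iff S.pos c' R).2 g2) ((F.sq_eq_iff S.pos a' c').2 g5) ((F.sq_eq_iff S.pos b' c').2 g6)
    (by rw [Frame.orient_hat]; nlinarith)
  exact ⟨F.inj this.1, F.inj this.2⟩

theorem not_dominated (S : Separated r u t L R) {τ : ℝ} {a b : Plane}
    (h : Tangent τ r L R a b) : ¬ (↑R ⊆ hull r (↑L : Set Plane)) ∧ ¬ (↑L ⊆ hull r (↑R : Set Plane)) := by
  have F := S.frame (τ := 1) (by norm_num)
  obtain ⟨c, h1, h2, h3, h4, h5, h6, -⟩ := h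
  have gp := F.genPos_union S.pos S.gp
  rw [subset_hull_iff, subset_hull_iff]
  constructor
  · intro hdom
    obtain ⟨c', k1, k2⟩ := exists_cov_not_cov (F.rad_pos S.pos) gp
      (a := hat u 1 1 a) (b := hat u 1 1 b) (c := hat u 1 1 c)
      (by
        intro p hp e
        obtain ⟨p, hp', rfl⟩ := Finset.mem_image.1 hp
        exact S.mem_ne hp' h4 (F.inj e))
      ((F.cov_iff S.pos c L).2 h1) (Finset.mem_image_of_mem _ h3) (Finset.mem_image_of_mem _ h4)
      ((F.sq_eq_iff S.pos a c).2 h5) ((F.sq_eq_iff S.pos b c).2 h6)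
    obtain ⟨c', rfl⟩ := F.surj c'
    exact k2 ((F.cov_iff S.pos c' R).2 (hdom c' ((F.cov_iff S.pos c' L).1 k1)))
  · intro hdom
    obtain ⟨c', k1, k2⟩ := exists_cov_not_cov (F.rad_pos S.pos) (Set.union_comm _ _ ▸ gp)
      (a := hat u 1 1 b) (b := hat u 1 1 a) (c := hat u 1 1 c)
      (by
        intro p hp e
        obtain ⟨p, hp', rfl⟩ := Finset.mem_image.1 hp
        exact S.mem_ne h3 hp' (F.inj e).symm)
      ((F.cov_iff S.pos c R).2 h2) (Finset.mem_image_of_mem _ h4) (Finset.mem_image_of_mem _ h3)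
      ((F.sq_eq_iff S.pos b c).2 h6) ((F.sq_eq_iff S.pos a c).2 h5)
    obtain ⟨c', rfl⟩ := F.surj c'
    exact k2 ((F.cov_iff S.pos c' L).2 (hdom c' ((F.cov_iff S.pos c' R).1 k1)))

/-- Without an equidistant point, `L` dominates if a disk covering both sets touches it. -/
theorem dominates_left (S : Separated r u t L R) (hE : ¬ Equi r u L R S.neL S.neR) {o : Plane}
    (h1 : Covers r o ↑L) (h2 : Covers r o ↑R) {p : Plane} (hp : p ∈ L) (hpo : dist p o = r) :
    ↑R ⊆ hull r (↑L : Set Plane) := by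
  have F := S.frame (τ := 1) (by norm_num)
  rw [subset_hull_iff]
  intro c hc
  have k1 := (F.cov_iff S.pos o L).2 h1
  have k2 := (F.cov_iff S.pos o R).2 h2
  have e1 : far _ (S.neL.image (hat u 1 1)) (hat u 1 1 o) = rad r u ^ 2 := by
    refine le_antisymm (far_le_iff.2 k1) ?_
    rw [← (F.sq_eq_iff S.pos p o).2 hpo]
    exact sq_le_far _ (Finset.mem_image_of_mem _ hp) _
  refine (F.cov_iff S.pos c R).1 (cov_of_far_lt (fun h => hE h.symm) k1
    (hL := S.neR.image _) (hR := S.neL.image _) ?_ ((F.cov_iff S.pos c L).2 hc))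
  refine lt_of_le_of_ne ?_ fun h => hE ⟨_, h.symm, e1.le⟩
  rw [e1]
  exact far_le_iff.2 k2

theorem dominates_right (S : Separated r u t L R) (hE : ¬ Equi r u L R S.neL S.neR) {o : Plane}
    (h1 : Covers r o ↑L) (h2 : Covers r o ↑R) {p : Plane} (hp : p ∈ R) (hpo : dist p o = r) :
    ↑L ⊆ hull r (↑R : Set Plane) := by
  have F := S.frame (τ := 1) (by norm_num)
  rw [subset_hull_iff]
  intro c hc
  have k1 := (F.cov_iff S.pos o L).2 h1
  have k2 := (F.cov_iff S.pos o R).2 h2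
  have e1 : far _ (S.neR.image (hat u 1 1)) (hat u 1 1 o) = rad r u ^ 2 := by
    refine le_antisymm (far_le_iff.2 k2) ?_
    rw [← (F.sq_eq_iff S.pos p o).2 hpo]
    exact sq_le_far _ (Finset.mem_image_of_mem _ hp) _
  refine (F.cov_iff S.pos c L).1 (cov_of_far_lt hE k2
    (hL := S.neL.image _) (hR := S.neR.image _) ?_ ((F.cov_iff S.pos c R).2 hc))
  refine lt_of_le_of_ne ?_ fun h => hE ⟨_, h, far_le_iff.2 k1⟩
  rw [e1]
  exact far_le_iff.2 k1

/-- Without an equidistant point, the hull of the union exists only if one set dominates. -/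
theorem dominates (S : Separated r u t L R) (hE : ¬ Equi r u L R S.neL S.neR) {o : Plane}
    (h1 : Covers r o ↑L) (h2 : Covers r o ↑R) :
    (∀ c, Covers r c ↑L → Covers r c ↑R) ∨ (∀ c, Covers r c ↑R → Covers r c ↑L) := by
  have F := S.frame (τ := 1) (by norm_num)
  have k1 := (F.cov_iff S.pos o L).2 h1
  have k2 := (F.cov_iff S.pos o R).2 h2
  rcases lt_trichotomy (far _ (S.neL.image (hat u 1 1)) (hat u 1 1 o))
    (far _ (S.neR.image (hat u 1 1)) (hat u 1 1 o)) with h | h | h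
  · exact Or.inr fun c hc => (F.cov_iff S.pos c L).1
      (cov_of_far_lt hE k2 h ((F.cov_iff S.pos c R).2 hc))
  · exact absurd ⟨_, h, far_le_iff.2 k1⟩ hE
  · exact Or.inl fun c hc => (F.cov_iff S.pos c R).1
      (cov_of_far_lt (fun h => hE h.symm) k1 h ((F.cov_iff S.pos c L).2 hc))

end Separated

/-- From every vertex leads an edge of the hull, unless there is no other point. -/
theorem exists_edge {r : ℝ} (hr : 0 < r) {Q : Finset Plane} (hgp : GeneralPosition r ↑Q)
    {p c₀ : Plane} (hp : p ∈ Q) (hc₀ : Covers r c₀ ↑Q) (hpc₀ : dist p c₀ = r)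
    (hne : ∃ q ∈ Q, q ≠ p) :
    ∃ v ∈ Q, v ≠ p ∧ ∃ c, Covers r c ↑Q ∧ dist p c = r ∧ dist v c = r ∧
      0 ≤ cross (p - c) (v - c) := by
  classical
  have hL : (Q.erase p).Nonempty := by
    obtain ⟨q, hq, h⟩ := hne
    exact ⟨q, Finset.mem_erase.2 ⟨h, hq⟩⟩
  -- The point `p` is strictly extreme in the direction from the center of its disk, so a line
  -- separates it from the rest. The edge at `p` is then a common tangent of `Q.erase p` and `{p}`.
  have key : ∀ q ∈ Q.erase p, (p - c₀) 0 * q 0 + (p - c₀) 1 * q 1 <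
      (p - c₀) 0 * p 0 + (p - c₀) 1 * p 1 := by
    intro q hq
    obtain ⟨h1, h2⟩ := Finset.mem_erase.1 hq
    have h3 : dist q c₀ ≤ r := hc₀ h2
    have h4 : dist q c₀ ^ 2 ≤ r ^ 2 := pow_le_pow_left₀ dist_nonneg h3 2
    have h5 : dist p c₀ ^ 2 = r ^ 2 := by rw [hpc₀]
    have h6 : 0 < dist q p ^ 2 := by
      have := dist_pos.2 h1
      positivity
    rw [dist_sq] at h4 h5 h6
    simp only [PiLp.sub_apply]
    nlinarith
  obtain ⟨m, hm, hmax⟩ := Finset.exists_max_image (Q.erase p)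
    (fun q => (p - c₀) 0 * q 0 + (p - c₀) 1 * q 1) hL
  have hlt := key m hm
  have S : Separated r (p - c₀) (((p - c₀) 0 * m 0 + (p - c₀) 1 * m 1 +
      ((p - c₀) 0 * p 0 + (p - c₀) 1 * p 1)) / 2) (Q.erase p) {p} := by
    refine ⟨hr, fun q hq => ?_, fun q hq => ?_, ?_, hL, Finset.singleton_nonempty p⟩
    · have := hmax q hq
      linarith
    · rw [Finset.mem_singleton.1 hq]; linarith
    · refine fun a ha b hb s hs => hgp a ?_ b ?_ s ?_
      all_goals
        have aux : ∀ x : Plane, x ∈ (↑(Q.erase p) ∪ ↑({p} : Finset Plane) : Set Plane) →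
            x ∈ (↑Q : Set Plane) := by
          rintro x (hx | hx)
          · exact Finset.mem_of_mem_erase hx
          · rw [Finset.mem_singleton.1 (Finset.mem_coe.1 hx)]; exact hp
        apply aux; assumption
  have F := S.frame (τ := 1) (by norm_num)
  -- Seen from `c₀` no point is farther than `p`, seen from `p` itself none is nearer; somewhere on
  -- the segment the distances agree.
  have hE : Equi r (p - c₀) (Q.erase p) {p} S.neL S.neR := by
    set H := hat (p - c₀) 1 1
    have k : Continuous fun s : ℝ => H c₀ + s • (H p - H c₀) := by fun_prop
    have f1 : ∀ z, far _ (S.neR.image H) z = sq (H p) z := by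
      intro z
      refine le_antisymm (Finset.sup'_le _ _ fun x hx => ?_)
        (sq_le_far _ (Finset.mem_image_of_mem _ (Finset.mem_singleton_self p)) _)
      obtain ⟨y, hy, rfl⟩ := Finset.mem_image.1 hx
      rw [Finset.mem_singleton.1 hy]
    have hcont : ContinuousOn (fun s : ℝ => far _ (S.neL.image H) (H c₀ + s • (H p - H c₀)) -
        far _ (S.neR.image H) (H c₀ + s • (H p - H c₀))) (Set.Icc 0 1) :=
      (((continuous_far _ _).comp k).sub ((continuous_far _ _).comp k)).continuousOn
    have hp0 : sq (H p) (H c₀) = rad r (p - c₀) ^ 2 := (F.sq_eq_iff hr p c₀).2 hpc₀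
    have hpp : sq (H p) (H p) = 0 := by unfold sq; ring
    obtain ⟨s, ⟨hs0, hs1⟩, hs⟩ := intermediate_value_Icc zero_le_one hcont
      (show (0 : ℝ) ∈ Set.Icc _ _ from by
        constructor
        · simp only [zero_smul, add_zero, f1, hp0, sub_nonpos]
          refine far_le_iff.2 ((F.cov_iff hr c₀ _).2 fun x hx => hc₀ (Finset.mem_of_mem_erase hx))
        · simp only [one_smul, add_sub_cancel, f1, hpp, sub_zero]
          exact le_trans (by unfold sq; positivity)
            (sq_le_far _ (Finset.mem_image_of_mem _ hm) _))
    have hs' := sub_eq_zero.1 hs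
    refine ⟨_, hs', ?_⟩
    rw [hs', f1]
    refine sq_segment_le _ _ _ hs0 hs1 hp0.le ?_
    rw [hpp]; positivity
  obtain ⟨a, b, c, h1, h2, h3, h4, h5, h6, h7⟩ := S.exists_tangent hE (τ := 1) (by norm_num)
  rw [Finset.mem_singleton] at h4
  subst h4
  obtain ⟨h8, h9⟩ := Finset.mem_erase.1 h3
  refine ⟨a, h9, h8, c, ?_, h6, h5, ?_⟩
  · intro x hx
    by_cases hxb : x = b
    · rw [hxb]; exact h6.le
    · exact h1 (Finset.mem_erase.2 ⟨hxb, hx⟩)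
  · simp only [cross] at h7 ⊢; linarith

/-! ### Hulls stored in trees -/

/-- `T` stores the vertices of the hull of `Q`, in counterclockwise order for `σ = 1` and in
clockwise order for `σ = -1`, starting from one that is farthest in direction `σ u`. -/
def Stored (r : ℝ) (Q : Set Plane) (u : Plane) (σ : ℝ) (T : HullTree) : Prop :=
  ∃ l, ListsVertices r Q (σ • u) l ∧ l.Triplewise (fun a b c => 0 < σ * cross (b - a) (c - a)) ∧
    StoresList T l

/-- The vertices of the hull of `Q` are `v 0, …, v (n - 1)`, stored in this order in `T`. -/
structure HullCycle (r : ℝ) (Q : Finset Plane) (u : Plane) (σ : ℝ) (T : HullTree) (n : ℕ)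
    (v : ℕ → Plane) : Prop where
  pos : 0 < n
  len : (inorder T).length = n
  pt : ∀ i (h : i < (inorder T).length), (inorder T)[i].pt = v i
  next : ∀ i (h : i < (inorder T).length), (inorder T)[i].next = v (i + 1)
  wrap : v n = v 0
  inj : ∀ i < n, ∀ j < n, v i = v j → i = j
  vertex : ∀ p, (∃ i < n, v i = p) ↔ IsVertex r ↑Q p
  ccw : ∀ i j k, i < j → j < k → k < n → 0 < σ * cross (v j - v i) (v k - v i)
  max : ∀ i < n, σ * (u 0 * v i 0 + u 1 * v i 1) ≤ σ * (u 0 * v 0 0 + u 1 * v 0 1)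

/-- Without vertices, `cov_of_cov_vertices` would hold vacuously for every disk, even for one that
misses a given point. -/
theorem exists_isVertex {r : ℝ} (hr : 0 < r) {Q : Finset Plane} (hQ : Q.Nonempty)
    (h : HullExists r ↑Q) : ∃ v, IsVertex r ↑Q v := by
  by_contra hcon
  push Not at hcon
  obtain ⟨o, ho⟩ := h
  have F : Frame !₂[1, 0] 1 1 := ⟨fun h => by simpa using congrArg (fun v : Plane => v 0) h,
    by norm_num, by norm_num⟩
  obtain ⟨p, hp⟩ := hQ
  obtain ⟨c, hc⟩ : ∃ c : Plane, r < dist p c := by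
    refine ⟨p + !₂[r + 1, 0], ?_⟩
    have h1 : dist p (p + !₂[r + 1, 0]) ^ 2 = (r + 1) ^ 2 := by
      rw [dist_sq]; simp; ring
    nlinarith [dist_nonneg (x := p) (y := p + !₂[r + 1, 0])]
  have := cov_of_cov_vertices (c := hat !₂[1, 0] 1 1 c) ((F.cov_iff hr o Q).2 ho)
    (fun v hv ⟨c', h1, h2⟩ => by
      obtain ⟨v, hv', rfl⟩ := Finset.mem_image.1 hv
      obtain ⟨c', rfl⟩ := F.surj c'
      exact absurd ⟨hv', c', (F.cov_iff hr c' Q).1 h1, (F.sq_eq_iff hr v c').1 h2⟩ (hcon v))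
  exact absurd ((F.cov_iff hr c Q).1 this hp) (not_le.2 hc)

/-- Indices are read modulo the length of the list, so that the successor of every record is `v (i +
1)` and `v n = v 0`. -/
theorem Stored.ring {r : ℝ} (hr : 0 < r) {Q : Finset Plane} (hQ : Q.Nonempty)
    (hex : HullExists r ↑Q) {u : Plane} {σ : ℝ} {T : HullTree} (h : Stored r ↑Q u σ T) :
    ∃ n v, HullCycle r Q u σ T n v := by
  obtain ⟨l, ⟨h1, h2, h3⟩, h4, h5, h6, -⟩ := h
  obtain ⟨w, hw⟩ := exists_isVertex hr hQ hex
  have hpos : 0 < l.length := List.length_pos_of_mem ((h2 w).2 hw)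
  have hlen : (inorder T).length = l.length := by rw [← h5, List.length_map]
  have hv : ∀ i (h : i < l.length), l.getD (i % l.length) 0 = l[i] := by
    intro i h
    rw [Nat.mod_eq_of_lt h, List.getD_eq_getElem _ _ h]
  refine ⟨l.length, fun i => l.getD (i % l.length) 0, hpos, hlen, ?_, ?_, by simp, ?_, ?_, ?_, ?_⟩
  · intro i h
    rw [hv i (hlen ▸ h)]
    simp only [← h5, List.getElem_map]
  · intro i h
    have hi : i < ((inorder T).map VertexRecord.next).length := by rwa [List.length_map]
    have e1 : (inorder T)[i].next = ((inorder T).map VertexRecord.next)[i] := by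
      rw [List.getElem_map]
    have e2 : ((inorder T).map VertexRecord.next)[i] = (l.rotate 1)[i]'(by rwa [← h6]) := by
      simp only [h6]
    rw [e1, e2, List.getElem_rotate, List.getD_eq_getElem]
  · intro i hi j hj hij
    simp only [hv i hi, hv j hj] at hij
    exact (List.Nodup.getElem_inj_iff h1).1 hij
  · intro p
    rw [← h2 p]
    constructor
    · rintro ⟨i, hi, rfl⟩
      simp only [hv i hi]
      exact List.getElem_mem hi
    · intro hp
      obtain ⟨i, hi, rfl⟩ := List.getElem_of_mem hp
      exact ⟨i, hi, hv i hi⟩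
  · intro i j k hij hjk hk
    simp only [hv i (by omega), hv j (by omega), hv k hk]
    exact List.triplewise_iff_getElem.1 h4 i j k hij hjk hk
  · intro i hi
    have := h3 l[0] (by rw [List.head?_eq_getElem?, List.getElem?_eq_getElem hpos]; rfl) l[i]
      (List.getElem_mem hi)
    simp only [inner_eq, PiLp.smul_apply, smul_eq_mul] at this
    simp only [hv i hi, hv 0 hpos]
    linarith

/-- The sign coded by a truth value. -/
def sgn (b : Bool) : ℝ := if b then 1 else -1

@[simp] theorem sgn_true : sgn true = 1 := rfl
@[simp] theorem sgn_false : sgn false = -1 := rfl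

theorem sgn_mul_self (b : Bool) : sgn b * sgn b = 1 := by cases b <;> simp

/-- The edge from `p` to `q` belongs to the lower (`d = true`) or upper (`d = false`) envelope of
the half circles; `o` is the first vertex. -/
def Active (u : Plane) (σ : ℝ) (d : Bool) (o p q : Plane) : Prop :=
  if d then q ≠ o ∧ σ * (u 0 * q 0 + u 1 * q 1) ≤ σ * (u 0 * p 0 + u 1 * p 1)
  else p ≠ o ∧ σ * (u 0 * p 0 + u 1 * p 1) ≤ σ * (u 0 * q 0 + u 1 * q 1)

/-! ### Hull cycles as chains -/

namespace HullCycle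

variable {r : ℝ} {Q : Finset Plane} {u : Plane} {σ : ℝ} {T : HullTree} {n : ℕ} {v : ℕ → Plane}

theorem exists_index (R : HullCycle r Q u σ T n v) {x : VertexRecord} (hx : x ∈ inorder T) :
    ∃ i < n, x.pt = v i ∧ x.next = v (i + 1) := by
  obtain ⟨i, h, rfl⟩ := List.mem_iff_getElem.1 hx
  exact ⟨i, R.len ▸ h, R.pt i h, R.next i h⟩

theorem isVertex (R : HullCycle r Q u σ T n v) {i : ℕ} (hi : i ≤ n) : IsVertex r ↑Q (v i) := by
  rcases eq_or_lt_of_le hi with rfl | h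
  · rw [R.wrap]; exact (R.vertex _).1 ⟨0, R.pos, rfl⟩
  · exact (R.vertex _).1 ⟨i, h, rfl⟩

theorem mem (R : HullCycle r Q u σ T n v) {i : ℕ} (hi : i ≤ n) : v i ∈ Q := (R.isVertex hi).1

/-- Splitting a tree at position `j`. -/
theorem find_eq (R : HullCycle r Q u σ T n v) {j : ℕ} (hj : j ≤ n) {A : VertexRecord → Prop}
    (hA : ∀ x ∈ inorder T, ∀ i < n, x.pt = v i → x.next = v (i + 1) → (A x ↔ i < j)) (w : Plane) :
    find A T w = v j := by
  have key : ∀ i (h : i < (inorder T).length), A (inorder T)[i] ↔ i < j := fun i h =>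
    hA _ (List.getElem_mem h) i (R.len ▸ h) (R.pt i h) (R.next i h)
  refine CircularHull.find_eq (List.take_append_drop j (inorder T)).symm ?_ ?_ ?_ ?_ ?_
  · intro x hx
    obtain ⟨i, h, rfl⟩ := List.mem_iff_getElem.1 hx
    rw [List.length_take] at h
    rw [List.getElem_take, key]
    omega
  · intro x hx
    obtain ⟨i, h, rfl⟩ := List.mem_iff_getElem.1 hx
    rw [List.getElem_drop, key]
    omega
  · intro x hx
    rcases Nat.eq_zero_or_pos j with rfl | hj0
    · simp at hx
    · have h1 : j - 1 < (inorder T).length := by rw [R.len]; omega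
      rw [List.getLast?_take, if_neg (by omega), List.getElem?_eq_getElem h1] at hx
      simp only [Option.some_or, Option.mem_def, Option.some.injEq] at hx
      rw [← hx, R.next _ h1, Nat.sub_add_cancel hj0]
  · intro x hx
    rw [List.head?_drop] at hx
    obtain ⟨h1, rfl⟩ := List.getElem?_eq_some_iff.1 hx
    exact R.pt j h1
  · intro h
    have := R.len
    rw [h] at this
    exact absurd this.symm R.pos.ne'

/-- The reindexing `f` is either the identity or `i ↦ n - i`, for the two envelopes. -/
theorem chain_aux (R : HullCycle r Q u σ T n v) (hr : 0 < r) {τ : ℝ} (F : Frame u σ τ)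
    (hgp : GeneralPosition r ↑Q) {f : ℕ → ℕ} (hf : ∀ i < n, f i ≤ n)
    (hf' : ∀ i < n, ∀ j < n, v (f i) = v (f j) → i = j) (hw : v (f n) = v (f 0))
    (h0 : v (f 0) = v 0)
    (ho : ∀ i j k, i < j → j < k → k < n →
      0 < orient (hat u σ τ (v (f i))) (hat u σ τ (v (f j))) (hat u σ τ (v (f k)))) :
    Chain (rad r u) n (fun i => hat u σ τ (v (f i))) := by
  have gp := F.genPos hr hgp
  have mem : ∀ i < n, hat u σ τ (v (f i)) ∈ hat u σ τ '' ↑Q :=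
    fun i hi => ⟨_, R.mem (hf i hi), rfl⟩
  refine ⟨by simp only [hw], ho, ?_, fun i hi j hj h => hf' i hi j hj (F.inj h), ?_, ?_⟩
  · intro i hi
    simp only [h0, hat]
    rcases eq_or_lt_of_le (hf i hi) with h | h
    · rw [h, R.wrap]
    · exact R.max _ h
  · intro i hi
    obtain ⟨-, c, h1, h2⟩ := R.isVertex (hf i hi)
    refine ⟨hat u σ τ c, fun k hk => ?_, (F.sq_eq_iff hr _ c).2 h2⟩
    exact (F.sq_le_iff hr _ c).2 (h1 (R.mem (hf k hk)))
  · intro i hi j hj k hk hij hjk hik c h1 h2 h3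
    have ne : ∀ i < n, ∀ j < n, i ≠ j → hat u σ τ (v (f i)) ≠ hat u σ τ (v (f j)) :=
      fun i hi j hj h h' => h (hf' i hi j hj (F.inj h'))
    exact gp.not_half (F.rad_pos hr) (mem i hi) (mem j hj) (mem k hk) (ne i hi j hj hij)
      (ne j hj k hk hjk) (ne i hi k hk hik) h1 h2 h3

theorem frame (hu : u ≠ 0) {s d : Bool} : Frame u (sgn s) (sgn d) :=
  ⟨hu, sgn_mul_self s, sgn_mul_self d⟩

variable {s : Bool}

theorem chain_fwd (R : HullCycle r Q u (sgn s) T n v) (hr : 0 < r) (hu : u ≠ 0)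
    (hgp : GeneralPosition r ↑Q) : Chain (rad r u) n (fun i => hat u (sgn s) 1 (v i)) := by
  refine R.chain_aux hr (frame hu (d := true)) hgp (f := id) (fun i hi => hi.le) R.inj R.wrap rfl ?_
  intro i j k hij hjk hk
  have h1 := R.ccw i j k hij hjk hk
  have h2 := norm_pos_of_ne hu
  rw [sgn_true, Frame.orient_hat]
  simp only [id, mul_one]
  have := mul_pos h2 h1
  linarith

/-- The reflection reverses the cyclic order and reading backward restores it. The reading starts at
index `n`, which is again the vertex with maximal abscissa. -/
theorem chain_rev (R : HullCycle r Q u (sgn s) T n v) (hr : 0 < r) (hu : u ≠ 0)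
    (hgp : GeneralPosition r ↑Q) : Chain (rad r u) n (fun i => hat u (sgn s) (-1) (v (n - i))) := by
  have hn := R.pos
  have h2 := norm_pos_of_ne hu
  refine R.chain_aux hr (frame hu (d := false)) hgp (f := fun i => n - i) (fun i hi => by omega) ?_
    (by simp [R.wrap]) (by simp [R.wrap]) ?_
  · intro i hi j hj h
    rcases Nat.eq_zero_or_pos i with rfl | h1 <;> rcases Nat.eq_zero_or_pos j with rfl | h3
    · rfl
    · rw [Nat.sub_zero, R.wrap] at h
      have := R.inj 0 hn (n - j) (by omega) h
      omega
    · rw [Nat.sub_zero, R.wrap] at h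
      have := R.inj (n - i) (by omega) 0 hn h
      omega
    · have := R.inj (n - i) (by omega) (n - j) (by omega) h
      omega
  · intro i j k hij hjk hk
    rw [sgn_false, Frame.orient_hat]
    rcases Nat.eq_zero_or_pos i with rfl | h1
    · have h3 := R.ccw 0 (n - k) (n - j) (by omega) (by omega) (by omega)
      simp only [Nat.sub_zero, R.wrap]
      have := mul_pos h2 h3
      simp only [cross] at this ⊢
      linarith
    · have h3 := R.ccw (n - k) (n - j) (n - i) (by omega) (by omega) (by omega)
      have := mul_pos h2 h3
      simp only [cross, PiLp.sub_apply] at this ⊢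
      linarith

/-- The position of a vertex whose half circle is the highest one at `X`, relative to an edge. -/
theorem locate (R : HullCycle r Q u (sgn s) T n v) (hr : 0 < r) (hu : u ≠ 0)
    (hgp : GeneralPosition r ↑Q) {d : Bool} {X : ℝ}
    (hX : ∀ p, IsVertex r ↑Q p → |X - (hat u (sgn s) (sgn d) p).1| ≤ rad r u) {j : ℕ}
    (hj : if d then j < n else 0 < j ∧ j ≤ n)
    (hmax : ∀ i ≤ n, lo (rad r u) (hat u (sgn s) (sgn d) (v i)) X ≤
      lo (rad r u) (hat u (sgn s) (sgn d) (v j)) X) {i : ℕ} (hi : i < n) :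
    (¬ Active u (sgn s) d (v 0) (v i) (v (i + 1)) → (i < j ↔ d = false)) ∧
    (Active u (sgn s) d (v 0) (v i) (v (i + 1)) → v i ≠ v (i + 1) ∧
      (lo (rad r u) (hat u (sgn s) (sgn d) (v i)) X <
        lo (rad r u) (hat u (sgn s) (sgn d) (v (i + 1))) X → i < j) ∧
      (lo (rad r u) (hat u (sgn s) (sgn d) (v (i + 1))) X <
        lo (rad r u) (hat u (sgn s) (sgn d) (v i)) X → j ≤ i) ∧
      (lo (rad r u) (hat u (sgn s) (sgn d) (v i)) X =
        lo (rad r u) (hat u (sgn s) (sgn d) (v (i + 1))) X → j = i ∨ j = i + 1)) := by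
  have F : Frame u (sgn s) (sgn d) := frame hu
  have hρ := (F.rad_pos hr).le
  cases d with
  | true =>
    simp only [if_true, sgn_true] at hj hX hmax F ⊢
    obtain ⟨h1, h2⟩ := (R.chain_fwd hr hu hgp).locate hρ (fun k hk => hX _ (R.isVertex hk.le)) hj
      (fun k hk => hmax k hk.le) hi
    have hact : Active u (sgn s) true (v 0) (v i) (v (i + 1)) ↔
        (hat u (sgn s) 1 (v (i + 1)) ≠ hat u (sgn s) 1 (v 0) ∧
          (hat u (sgn s) 1 (v (i + 1))).1 ≤ (hat u (sgn s) 1 (v i)).1) := by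
      simp only [Active, if_true]
      rw [F.inj.ne_iff]
      rfl
    rw [hact]
    refine ⟨fun h => ?_, fun h => ?_⟩
    · have := h1 h
      simp only [Bool.true_eq_false, iff_false]
      omega
    · obtain ⟨k1, k2, k3, k4⟩ := h2 h
      refine ⟨fun e => ?_, k3, k4, fun e => ?_⟩
      · have : n ≠ 1 := by
          rintro rfl
          obtain rfl : i = 0 := by omega
          exact h.1 (by rw [e])
        rcases eq_or_lt_of_le (Nat.succ_le_of_lt hi) with h5 | h5
        · exact h.1 (by rw [show i + 1 = n from h5, R.wrap])
        · have := R.inj i hi (i + 1) h5 e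
          omega
      · have := k1 e.le
        have := k2 e.ge
        omega
  | false =>
    simp only [Bool.false_eq_true, if_false, sgn_false] at hj hX hmax F ⊢
    have e1 : n - (n - j) = j := by omega
    -- In the reversed chain the edge at position `i` is traversed from `v (i + 1)` to `v i`, at
    -- position `n - 1 - i`.
    have e2 : n - (n - 1 - i) = i + 1 := by omega
    have e3 : n - (n - 1 - i + 1) = i := by omega
    obtain ⟨h1, h2⟩ := (R.chain_rev hr hu hgp).locate hρ (fun k hk => hX _ (R.isVertex (by omega)))
      (j := n - j) (by omega) (fun k hk => by simpa only [e1] using hmax (n - k) (by omega))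
      (i := n - 1 - i) (by omega)
    simp only [e2, e3, Nat.sub_zero, R.wrap] at h1 h2
    have hact : Active u (sgn s) false (v 0) (v i) (v (i + 1)) ↔
        (hat u (sgn s) (-1) (v i) ≠ hat u (sgn s) (-1) (v 0) ∧
          (hat u (sgn s) (-1) (v i)).1 ≤ (hat u (sgn s) (-1) (v (i + 1))).1) := by
      simp only [Active, Bool.false_eq_true, if_false]
      rw [F.inj.ne_iff]
      rfl
    rw [hact]
    refine ⟨fun h => ?_, fun h => ?_⟩
    · have := h1 h
      simp only [iff_true]
      omega
    · obtain ⟨k1, k2, k3, k4⟩ := h2 h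
      refine ⟨fun e => ?_, fun e => ?_, fun e => ?_, fun e => ?_⟩
      · rcases eq_or_lt_of_le (Nat.succ_le_of_lt hi) with h5 | h5
        · exact h.1 (by rw [e, show i + 1 = n from h5, R.wrap])
        · have := R.inj i hi (i + 1) h5 e
          omega
      · have := k4 e
        omega
      · have := k3 e
        omega
      · have := k1 e.ge
        have := k2 e.le
        omega

/-- The first position at which the maximum is attained. -/
theorem exists_first (R : HullCycle r Q u σ T n v) (d : Bool) (f : Plane → ℝ) :
    ∃ j ≤ n, (if d then j < n else 0 < j ∧ j ≤ n) ∧ (∀ i ≤ n, f (v i) ≤ f (v j)) ∧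
      ∀ i, (if d then i < n else 0 < i ∧ i ≤ n) → f (v i) = f (v j) → j ≤ i := by
  classical
  obtain ⟨m, hm, hmax⟩ := Finset.exists_max_image (Finset.range (n + 1)) (fun i => f (v i)) ⟨0, by simp⟩
  have hmax' : ∀ i ≤ n, f (v i) ≤ f (v m) := fun i hi => hmax i (by simp; omega)
  have hn := R.pos
  have hw := R.wrap
  have hm' : m ≤ n := by simp at hm; omega
  have hex : ∃ j, (if d then j < n else 0 < j ∧ j ≤ n) ∧ f (v j) = f (v m) := by
    cases d with
    | true =>
      simp only [if_true]
      rcases eq_or_lt_of_le hm' with h | h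
      · exact ⟨0, hn, by rw [h, hw]⟩
      · exact ⟨m, h, rfl⟩
    | false =>
      simp only [Bool.false_eq_true, if_false]
      rcases Nat.eq_zero_or_pos m with h | h
      · exact ⟨n, ⟨hn, le_rfl⟩, by rw [h, hw]⟩
      · exact ⟨m, ⟨h, hm'⟩, rfl⟩
  obtain ⟨h1, h2⟩ := Nat.find_spec hex
  refine ⟨Nat.find hex, ?_, h1, fun i hi => (hmax' i hi).trans_eq h2.symm,
    fun i hi hi' => Nat.find_min' hex ⟨hi, hi'.trans h2⟩⟩
  cases d with
  | true => simp only [if_true] at h1; exact h1.le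
  | false => simp only [Bool.false_eq_true, if_false] at h1; exact h1.2

end HullCycle

/-- The order in the tree `s` refers to the frame `sgn s`, while a search uses one frame for both
trees. Mirror images of half circles agree at mirrored abscissae. -/
theorem lo_hat_flip (u : Plane) (s s' : Bool) (τ r X : ℝ) (p : Plane) :
    lo r (hat u (sgn s) τ p) (sgn s * (sgn s' * X)) = lo r (hat u (sgn s') τ p) X := by
  simp only [hat]
  cases s <;> cases s' <;> simp [← lo_neg r (u 0 * p 0 + u 1 * p 1)]

theorem abs_hat_flip (u : Plane) (s s' : Bool) (τ X : ℝ) (p : Plane) :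
    |sgn s * (sgn s' * X) - (hat u (sgn s) τ p).1| = |X - (hat u (sgn s') τ p).1| := by
  simp only [hat]
  rw [show sgn s * (sgn s' * X) - sgn s * (u 0 * p 0 + u 1 * p 1) =
    sgn s * sgn s' * (X - sgn s' * (u 0 * p 0 + u 1 * p 1)) by
      linear_combination (sgn s * (u 0 * p 0 + u 1 * p 1)) * sgn_mul_self s', abs_mul]
  cases s <;> cases s' <;> simp

/-- A predicate that guides the search for `a`, in terms of the half circles at `z`. -/
structure Guide (r : ℝ) (u : Plane) (s x d : Bool) (T : HullTree) (o a : Plane) (z : ℝ)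
    (A : VertexRecord → Prop) : Prop where
  find_eq : ∀ w, find A T w = a
  passive : ∀ e ∈ inorder T, ¬ Active u (sgn s) d o e.pt e.next → (A e ↔ d = false)
  ne : ∀ e ∈ inorder T, Active u (sgn s) d o e.pt e.next → e.pt ≠ e.next
  lt : ∀ e ∈ inorder T, Active u (sgn s) d o e.pt e.next →
    lo (rad r u) (hat u (sgn x) (sgn d) e.pt) z < lo (rad r u) (hat u (sgn x) (sgn d) e.next) z → A e
  gt : ∀ e ∈ inorder T, Active u (sgn s) d o e.pt e.next →
    lo (rad r u) (hat u (sgn x) (sgn d) e.next) z < lo (rad r u) (hat u (sgn x) (sgn d) e.pt) z → ¬ A e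
  eq : ∀ e ∈ inorder T, Active u (sgn s) d o e.pt e.next →
    lo (rad r u) (hat u (sgn x) (sgn d) e.pt) z = lo (rad r u) (hat u (sgn x) (sgn d) e.next) z →
    (A e ∧ a = e.next) ∨ (¬ A e ∧ a = e.pt)

/-! ### Searching the tree of one hull -/

namespace HullCycle

variable {r : ℝ} {Q : Finset Plane} {u : Plane} {T : HullTree} {n : ℕ} {v : ℕ → Plane} {s : Bool}

theorem guide_index (R : HullCycle r Q u (sgn s) T n v) (hr : 0 < r) (hu : u ≠ 0)
    (hgp : GeneralPosition r ↑Q) {x d : Bool} {z : ℝ}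
    (hz : ∀ p, IsVertex r ↑Q p → |z - (hat u (sgn x) (sgn d) p).1| ≤ rad r u) {j : ℕ} (hjn : j ≤ n)
    (hj : if d then j < n else 0 < j ∧ j ≤ n)
    (hmax : ∀ i ≤ n, lo (rad r u) (hat u (sgn x) (sgn d) (v i)) z ≤
      lo (rad r u) (hat u (sgn x) (sgn d) (v j)) z) :
    Guide r u s x d T (v 0) (v j) z (fun e => ∃ i < j, v i = e.pt ∧ v (i + 1) = e.next) := by
  have key : ∀ i < n, ∀ e : VertexRecord, e.pt = v i → e.next = v (i + 1) →
      ((∃ i < j, v i = e.pt ∧ v (i + 1) = e.next) ↔ i < j) := by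
    intro i hi e h1 h2
    refine ⟨?_, fun h => ⟨i, h, h1.symm, h2.symm⟩⟩
    rintro ⟨k, hk, h3, -⟩
    rw [h1] at h3
    exact R.inj k (by omega) i hi h3 ▸ hk
  have loc := fun i (hi : i < n) => R.locate hr hu hgp (d := d) (X := sgn s * (sgn x * z)) (j := j)
    (fun p hp => by rw [abs_hat_flip]; exact hz p hp) hj
    (fun i hi => by simp only [lo_hat_flip]; exact hmax i hi) hi
  simp only [lo_hat_flip] at loc
  constructor
  · exact R.find_eq hjn fun e _ i hi h1 h2 => key i hi e h1 h2
  all_goals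
    intro e he
    obtain ⟨i, hi, h1, h2⟩ := R.exists_index he
    try rw [key i hi e h1 h2]
    rw [h1, h2]
    obtain ⟨k1, k2⟩ := loc i hi
  · exact k1
  · exact fun h => (k2 h).1
  · exact fun h => (k2 h).2.1
  · exact fun h h' => not_lt.2 ((k2 h).2.2.1 h')
  · intro h h'
    rcases (k2 h).2.2.2 h' with h3 | h3
    · exact Or.inr ⟨by omega, by rw [h3]⟩
    · exact Or.inl ⟨by omega, by rw [h3]⟩

theorem exists_guide (R : HullCycle r Q u (sgn s) T n v) (hr : 0 < r) (hu : u ≠ 0)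
    (hgp : GeneralPosition r ↑Q) {x d : Bool} {z : ℝ}
    (hz : ∀ p, IsVertex r ↑Q p → |z - (hat u (sgn x) (sgn d) p).1| ≤ rad r u) {a : Plane}
    (ha : IsVertex r ↑Q a)
    (hmax : ∀ p, IsVertex r ↑Q p → lo (rad r u) (hat u (sgn x) (sgn d) p) z ≤
      lo (rad r u) (hat u (sgn x) (sgn d) a) z) :
    ∃ A, Guide r u s x d T (v 0) a z A := by
  obtain ⟨j, hj, rfl⟩ := (R.vertex a).2 ha
  have hm := fun i (hi : i ≤ n) => hmax _ (R.isVertex hi)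
  cases d with
  | true => exact ⟨_, R.guide_index hr hu hgp hz hj.le (by simpa using hj) hm⟩
  | false =>
    rcases Nat.eq_zero_or_pos j with rfl | h
    · have := R.guide_index hr hu hgp hz le_rfl (j := n) (by simpa using R.pos)
        (by rw [R.wrap]; exact hm)
      rw [R.wrap] at this
      exact ⟨_, this⟩
    · exact ⟨_, R.guide_index hr hu hgp hz hj.le (by simpa using ⟨h, hj.le⟩) hm⟩

/-- The search for a vertex whose half circle is the highest one at `z`. -/
theorem find_max (R : HullCycle r Q u (sgn s) T n v) (hr : 0 < r) (hu : u ≠ 0)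
    (hgp : GeneralPosition r ↑Q) {d : Bool} {z : ℝ}
    (hz : ∀ p, IsVertex r ↑Q p → |z - (hat u 1 (sgn d) p).1| ≤ rad r u) (w : Plane) :
    ∃ j ≤ n, (∀ i ≤ n, lo (rad r u) (hat u 1 (sgn d) (v i)) z ≤
      lo (rad r u) (hat u 1 (sgn d) (v j)) z) ∧
      find (fun e => if d then Active u (sgn s) d (v 0) e.pt e.next ∧
        ¬ lo (rad r u) (hat u 1 (sgn d) e.next) z ≤ lo (rad r u) (hat u 1 (sgn d) e.pt) z
        else ¬ (Active u (sgn s) d (v 0) e.pt e.next ∧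
          lo (rad r u) (hat u 1 (sgn d) e.next) z ≤ lo (rad r u) (hat u 1 (sgn d) e.pt) z)) T w =
        v j := by
  obtain ⟨j, hjn, hj, hmax, hmin⟩ := R.exists_first d fun p => lo (rad r u) (hat u 1 (sgn d) p) z
  refine ⟨j, hjn, hmax, ?_⟩
  have G := R.guide_index hr hu hgp (x := true) hz hjn hj hmax
  rw [← G.find_eq w]
  apply find_congr
  intro e he
  -- On a tie the test sends the search to the left for both values of `d`, so it ends at the first
  -- position of the maximum; this is why `j` was chosen minimal.
  have tie : Active u (sgn s) d (v 0) e.pt e.next →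
      lo (rad r u) (hat u 1 (sgn d) e.next) z ≤ lo (rad r u) (hat u 1 (sgn d) e.pt) z →
      ¬ ∃ i < j, v i = e.pt ∧ v (i + 1) = e.next := by
    intro h h1
    rcases eq_or_lt_of_le h1 with h2 | h2
    · rcases G.eq e he h h2.symm with ⟨⟨i, h3, h4, h5⟩, h6⟩ | h3
      · exfalso
        have h7 := hmin i (by
          cases d with
          | true => simp only [if_true] at hj ⊢; omega
          | false =>
            simp only [Bool.false_eq_true, if_false] at hj ⊢
            refine ⟨Nat.pos_of_ne_zero ?_, by omega⟩
            rintro rfl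
            simp only [Active, Bool.false_eq_true, if_false] at h
            exact h.1 h4.symm) (by rw [h6, h4]; exact h2.symm)
        omega
      · exact h3.1
    · exact G.gt e he h h2
  by_cases hact : Active u (sgn s) d (v 0) e.pt e.next
  · by_cases hle : lo (rad r u) (hat u 1 (sgn d) e.next) z ≤ lo (rad r u) (hat u 1 (sgn d) e.pt) z
    · have := tie hact hle
      cases d <;> simp_all
    · have := G.lt e he hact (not_le.1 hle)
      cases d <;> simp_all
  · have := G.passive e he hact
    cases d <;> simp_all

/-- The search for a vertex that is extreme in direction `-σ u`. -/
theorem find_min (R : HullCycle r Q u (sgn s) T n v) (hr : 0 < r) (hu : u ≠ 0)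
    (hgp : GeneralPosition r ↑Q) (w : Plane) :
    ∃ j ≤ n, (∀ i ≤ n, sgn s * (u 0 * v j 0 + u 1 * v j 1) ≤
      sgn s * (u 0 * v i 0 + u 1 * v i 1)) ∧
      find (fun e => Active u (sgn s) true (v 0) e.pt e.next) T w = v j := by
  classical
  obtain ⟨m, hm, hmin⟩ := Finset.exists_min_image (Finset.range n)
    (fun i => sgn s * (u 0 * v i 0 + u 1 * v i 1)) ⟨0, by simpa using R.pos⟩
  obtain ⟨j, hj, hlast⟩ := Finset.exists_max_image ((Finset.range n).filter fun i =>
    sgn s * (u 0 * v i 0 + u 1 * v i 1) = sgn s * (u 0 * v m 0 + u 1 * v m 1)) id ⟨m, by simpa using hm⟩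
  simp only [Finset.mem_filter, Finset.mem_range] at hm hmin hj hlast
  have F : Frame u (sgn s) 1 := frame hu (d := true)
  refine ⟨j, hj.1.le, fun i hi => ?_, R.find_eq hj.1.le (fun e _ i hi h1 h2 => ?_) w⟩
  · rw [hj.2]
    rcases eq_or_lt_of_le hi with h | h
    · rw [h, R.wrap]; exact hmin 0 R.pos
    · exact hmin i h
  · rw [← (R.chain_fwd hr hu hgp).locate_min hj.1 (fun k hk => by
      simp only [hat]; rw [hj.2]; exact hmin k hk) (fun k hk h => hlast k ⟨hk, by
        simp only [hat] at h; rw [h, hj.2]⟩) hi, h1, h2]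
    simp only [Active, if_true]
    rw [F.inj.ne_iff]
    rfl

theorem find_first (R : HullCycle r Q u (sgn s) T n v) (w : Plane) : find (fun _ => False) T w = v 0 :=
  R.find_eq (Nat.zero_le n) (fun _ _ _ _ _ _ => by simp) w

end HullCycle

/-! ### Crossings of half circles -/

/-- Half circles that cross at most once and have the same order at both ends of an interval have it
throughout. An edge can thus be decided without knowing the abscissa `z` of the center. -/
theorem lo_lt_between {ρ α β z : ℝ} {p q : ℝ × ℝ} (hz : α ≤ z) (hz' : z ≤ β)
    (hαp : |α - p.1| ≤ ρ) (hαq : |α - q.1| ≤ ρ) (hβp : |β - p.1| ≤ ρ) (hβq : |β - q.1| ≤ ρ)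
    (hα : lo ρ p α < lo ρ q α) (hβ : lo ρ p β < lo ρ q β) : lo ρ p z < lo ρ q z := by
  have btw : ∀ x : ℝ, |α - x| ≤ ρ → |β - x| ≤ ρ → |z - x| ≤ ρ := by
    intro x h1 h2
    rw [abs_le] at *
    constructor <;> linarith
  rcases eq_or_lt_of_le hz with rfl | h1
  · exact hα
  rcases eq_or_lt_of_le hz' with rfl | h2
  · exact hβ
  rcases lt_trichotomy p.1 q.1 with h | h | h
  · have := lo_sub_lo_lt h h2 (btw _ hαq hβq) hβp
    linarith
  · simp only [lo, h] at *
    linarith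
  · have := lo_sub_lo_lt h h1 hαp (btw _ hαq hβq)
    linarith

/-- Points with equal abscissae have a constant difference of half circles, and one strict order at
both ends. Otherwise the order changes or there is a tie at an end, and the crossing is given by the
formula. -/
theorem exists_cross {ρ α β : ℝ} {p q : ℝ × ℝ} (hαβ : α ≤ β)
    (hp : ∀ X, α ≤ X → X ≤ β → |X - p.1| ≤ ρ) (hq : ∀ X, α ≤ X → X ≤ β → |X - q.1| ≤ ρ)
    (hpq : p ≠ q) (h1 : ¬ (lo ρ p α < lo ρ q α ∧ lo ρ p β < lo ρ q β))
    (h2 : ¬ (lo ρ q α < lo ρ p α ∧ lo ρ q β < lo ρ p β)) :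
    p.1 ≠ q.1 ∧ ∃ X, α ≤ X ∧ X ≤ β ∧ lo ρ p X = lo ρ q X ∧ X = crossX ρ p.1 p.2 q.1 q.2 := by
  have hne : p.1 ≠ q.1 := by
    intro h
    have h3 : p.2 ≠ q.2 := fun h' => hpq (Prod.ext h h')
    simp only [lo, h] at h1 h2
    rcases lt_or_gt_of_ne h3 with h4 | h4
    · exact h1 ⟨by linarith, by linarith⟩
    · exact h2 ⟨by linarith, by linarith⟩
  have hc : ContinuousOn (fun X => lo ρ p X - lo ρ q X) (Set.Icc α β) :=
    ((continuous_lo ρ p).sub (continuous_lo ρ q)).continuousOn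
  obtain ⟨X, ⟨hX1, hX2⟩, hX⟩ : ∃ X ∈ Set.Icc α β, lo ρ p X - lo ρ q X = 0 := by
    rcases le_or_gt (lo ρ q α) (lo ρ p α) with h | h
    · have h3 : lo ρ p β ≤ lo ρ q β ∨ lo ρ q α = lo ρ p α := by
        by_contra hcon
        push Not at hcon
        exact h2 ⟨lt_of_le_of_ne h hcon.2, hcon.1⟩
      rcases h3 with h3 | h3
      · exact intermediate_value_Icc' hαβ hc ⟨by linarith, by linarith⟩
      · exact ⟨α, ⟨le_rfl, hαβ⟩, by linarith⟩
    · have h3 : lo ρ q β ≤ lo ρ p β := by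
        by_contra hcon
        push Not at hcon
        exact h1 ⟨h, hcon⟩
      exact intermediate_value_Icc hαβ hc ⟨by linarith, by linarith⟩
  have hX' : lo ρ p X = lo ρ q X := by linarith
  refine ⟨hne, X, hX1, hX2, hX', ?_⟩
  exact crossX_eq (c := (X, lo ρ p X)) hne (sq_lo (hp X hX1 hX2))
    (by rw [hX']; exact sq_lo (hq X hX1 hX2)) le_of_eq_lo (by
      show lo ρ p X ≤ q.2
      rw [hX']; exact le_of_eq_lo)

/-! ### Deciding on which side of a crossing the tangent lies -/

/-- The increasing envelope of the left set meets the decreasing envelope of the right set at `z`. -/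
theorem meet_rules {α β z X Y : ℝ} {fa fp fb fq : ℝ → ℝ} (hz : α ≤ z ∧ z ≤ β) (hX : α ≤ X ∧ X ≤ β)
    (hY : α ≤ Y ∧ Y ≤ β)
    (ia : StrictMonoOn fa (Set.Icc α β)) (ip : StrictMonoOn fp (Set.Icc α β))
    (ib : StrictAntiOn fb (Set.Icc α β)) (iq : StrictAntiOn fq (Set.Icc α β))
    (h : fa z = fb z) (hp : fp z ≤ fa z) (hq : fq z ≤ fb z) (hpX : fa X ≤ fp X)
    (hqY : fb Y ≤ fq Y) :
    (X ≤ Y → fp X ≤ fq Y → X ≤ z) ∧ (X ≤ Y → ¬ fp X ≤ fq Y → z < Y) ∧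
    (¬ X ≤ Y → fq Y ≤ fp X → z < X) ∧ (¬ X ≤ Y → ¬ fq Y ≤ fp X → Y ≤ z) := by
  refine ⟨fun h1 h2 => ?_, fun h1 h2 => ?_, fun h1 h2 => ?_, fun h1 h2 => ?_⟩
  -- If `z < X`, then `fp X ≥ fa X > fa z = fb z ≥ fq z > fq X ≥ fq Y ≥ fp X`. The other three cases
  -- are similar chains.
  · by_contra hcon
    push Not at hcon
    have k1 := ia hz hX hcon
    have k2 := iq.antitoneOn hX hY h1
    have k3 := iq hz hX hcon
    linarith
  · by_contra hcon
    push Not at hcon h2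
    have k1 := ib.antitoneOn hY hz hcon
    have k2 := ip.monotoneOn hX hz (h1.trans hcon)
    linarith
  · by_contra hcon
    push Not at hcon h1
    have k1 := ib hY hz (h1.trans_le hcon)
    have k2 := ip.monotoneOn hX hz hcon
    linarith
  · by_contra hcon
    push Not at hcon h1 h2
    have k1 := ia hz hX (hcon.trans h1)
    have k2 := iq hz hY hcon
    linarith

/-- The two envelopes are opposite to each other at `z` and cross over to the right of it. -/
theorem opposite_rules {ρ α β z X Y : ℝ} {a b p q : ℝ × ℝ} (hz : α ≤ z ∧ z ≤ β)
    (hX : α ≤ X ∧ X ≤ β) (hY : α ≤ Y ∧ Y ≤ β)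
    (da : ∀ X, α ≤ X → X ≤ β → |X - a.1| ≤ ρ) (db : ∀ X, α ≤ X → X ≤ β → |X - b.1| ≤ ρ)
    (dp : ∀ X, α ≤ X → X ≤ β → |X - p.1| ≤ ρ) (dq : ∀ X, α ≤ X → X ≤ β → |X - q.1| ≤ ρ)
    (h : lo ρ a z + lo ρ b z = 0) (hmid : a.1 + b.1 ≤ 2 * z) (hp : lo ρ p z ≤ lo ρ a z)
    (hq : lo ρ q z ≤ lo ρ b z) (hpX : lo ρ a X ≤ lo ρ p X) (hqY : lo ρ b Y ≤ lo ρ q Y) :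
    (0 < lo ρ p Y + lo ρ q Y → Y + Y < p.1 + q.1 → Y ≤ z) ∧
    (0 < lo ρ p Y + lo ρ q Y → ¬ Y + Y < p.1 + q.1 → z < Y) ∧
    (0 < lo ρ p X + lo ρ q X → X + X < p.1 + q.1 → X ≤ z) ∧
    (0 < lo ρ p X + lo ρ q X → ¬ X + X < p.1 + q.1 → z < X) ∧
    (¬ 0 < lo ρ p Y + lo ρ q Y → ¬ 0 < lo ρ p X + lo ρ q X → X ≤ Y → X ≤ z) ∧
    (¬ 0 < lo ρ p Y + lo ρ q Y → ¬ 0 < lo ρ p X + lo ρ q X → ¬ X ≤ Y → Y ≤ z) := by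
  -- The sum for `p` and `q` is symmetric about their midpoint, grows away from it, and is not
  -- positive at `z`. Where it is positive, `z` is on the side of the midpoint.
  have left : ∀ Z, α ≤ Z → Z ≤ β → 0 < lo ρ p Z + lo ρ q Z → Z + Z < p.1 + q.1 → Z ≤ z := by
    intro Z h1 h2 h3 h4
    by_contra hcon
    push Not at hcon
    have := lo_add_lo_lt (r := ρ) (v := (-p.1, p.2)) (w := (-q.1, q.2)) (X := -Z) (X' := -z)
      (by linarith) (by simp only; linarith)
      (by rw [show -z - -p.1 = -(z - p.1) by ring, abs_neg]; exact dp z hz.1 hz.2)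
      (by rw [show -z - -q.1 = -(z - q.1) by ring, abs_neg]; exact dq z hz.1 hz.2)
    simp only [lo_neg] at this
    linarith
  have right : ∀ Z, α ≤ Z → Z ≤ β → 0 < lo ρ p Z + lo ρ q Z → ¬ Z + Z < p.1 + q.1 → z < Z := by
    intro Z h1 h2 h3 h4
    by_contra hcon
    push Not at hcon h4
    rcases eq_or_lt_of_le hcon with h5 | h5
    · rw [h5] at h3
      linarith
    · have := lo_add_lo_lt (r := ρ) h5 (by linarith) (dp z hz.1 hz.2) (dq z hz.1 hz.2)
      linarith
  -- The sum for the true points vanishes at `z`, which is not to the left of their midpoint, so it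
  -- is positive farther to the right.
  have beyond : ∀ Z, z < Z → Z ≤ β → 0 < lo ρ a Z + lo ρ b Z := by
    intro Z h1 h2
    have := lo_add_lo_lt (r := ρ) h1 hmid (da Z (hz.1.trans h1.le) h2) (db Z (hz.1.trans h1.le) h2)
    linarith
  refine ⟨left Y hY.1 hY.2, right Y hY.1 hY.2, left X hX.1 hX.2, right X hX.1 hX.2,
    fun h1 h2 h3 => ?_, fun h1 h2 h3 => ?_⟩
  · by_contra hcon
    push Not at hcon h1 h2
    have k1 := beyond X hcon hX.2
    have k2 := beyond Y (hcon.trans_le h3) hY.2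
    rcases eq_or_lt_of_le h3 with h4 | h4
    · rw [h4] at hpX
      linarith
    -- The half circle of `p` is not above that of `a` at `z`, not below it at `X`, and below it at
    -- `Y`. That would need two crossings.
    · have k3 : lo ρ p Y < lo ρ a Y := by linarith
      rcases lt_trichotomy p.1 a.1 with h5 | h5 | h5
      · have := lo_sub_lo_lt h5 h4 (da X hX.1 hX.2) (dp Y hY.1 hY.2)
        linarith
      · simp only [lo, h5] at *
        linarith
      · have := lo_sub_lo_lt h5 hcon (dp z hz.1 hz.2) (da X hX.1 hX.2)
        have := lo_sub_lo_lt h5 h4 (dp X hX.1 hX.2) (da Y hY.1 hY.2)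
        linarith
  · by_contra hcon
    push Not at hcon h1 h2 h3
    have k1 := beyond Y hcon hY.2
    have k2 := beyond X (hcon.trans h3) hX.2
    have k3 : lo ρ q X < lo ρ b X := by linarith
    rcases lt_trichotomy q.1 b.1 with h5 | h5 | h5
    · have := lo_sub_lo_lt h5 h3 (db Y hY.1 hY.2) (dq X hX.1 hX.2)
      linarith
    · simp only [lo, h5] at *
      linarith
    · have := lo_sub_lo_lt h5 hcon (dq z hz.1 hz.2) (db Y hY.1 hY.2)
      have := lo_sub_lo_lt h5 h3 (dq Y hY.1 hY.2) (db X hX.1 hX.2)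
      linarith

/-! ### The input -/

/-- The two sets, `Q true` to the left and `Q false` to the right of the line, with the vertices of
their hulls stored in trees. -/
structure Input (r t : ℝ) (u : Plane) (Q : Bool → Finset Plane) (T : Bool → HullTree)
    (n : Bool → ℕ) (v : Bool → ℕ → Plane) : Prop where
  sep : Separated r u t (Q true) (Q false)
  ring : ∀ s, HullCycle r (Q s) u (sgn s) (T s) (n s) (v s)

/-- The range of abscissae within reach of all vertices, between the extremes `m false` and
`m true` of the two sets. -/
noncomputable def loX (ρ : ℝ) (m : Bool → ℝ) (x : Bool) : ℝ := if x then m false - ρ else 0 - (m true + ρ)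

noncomputable def hiX (ρ : ℝ) (m : Bool → ℝ) (x : Bool) : ℝ := if x then m true + ρ else 0 - (m false - ρ)

/-- The half circle below a point. -/
noncomputable def low (r : ℝ) (u : Plane) (x d : Bool) (p : Plane) (X : ℝ) : ℝ :=
  lo (rad r u) (hat u (sgn x) (sgn d) p) X

/-- `m s` is the abscissa of a vertex of `Q s` that is closest to the line. -/
def Extreme (r : ℝ) (u : Plane) (Q : Bool → Finset Plane) (m : Bool → ℝ) : Prop :=
  ∀ s, ∃ p, IsVertex r ↑(Q s) p ∧ m s = u 0 * p 0 + u 1 * p 1 ∧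
    ∀ q, IsVertex r ↑(Q s) q → sgn s * m s ≤ sgn s * (u 0 * q 0 + u 1 * q 1)

/-- The disk touching both sets, at `w true` and `w false`, that a search with parameters `x`, `d`
is to find; its center has abscissa `z`. -/
structure Target (r t : ℝ) (u : Plane) (Q : Bool → Finset Plane) (m : Bool → ℝ) (x : Bool)
    (d : Bool → Bool) (w : Bool → Plane) (z : ℝ) : Prop where
  vertex : ∀ s, IsVertex r ↑(Q s) (w s)
  mem : loX (rad r u) m x ≤ z ∧ z ≤ hiX (rad r u) m x
  max : ∀ s p, IsVertex r ↑(Q s) p → low r u x (d s) p z ≤ low r u x (d s) (w s) z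
  tie : ∀ s p, IsVertex r ↑(Q s) p → p ≠ w s → low r u x (d s) p z = low r u x (d s) (w s) z →
    (hat u (sgn x) (sgn (d s)) (w s)).1 < (hat u (sgn x) (sgn (d s)) p).1
  meet : d true = d false →
    x = true ∧ low r u x (d true) (w true) z = low r u x (d false) (w false) z
  opposite : d true ≠ d false →
    low r u x (d true) (w true) z + low r u x (d false) (w false) z = 0 ∧
    (hat u (sgn x) (sgn (d true)) (w true)).1 + (hat u (sgn x) (sgn (d false)) (w false)).1 ≤ 2 * z

namespace Input

variable {r t : ℝ} {u : Plane} {Q : Bool → Finset Plane} {T : Bool → HullTree} {n : Bool → ℕ}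
  {v : Bool → ℕ → Plane}

theorem pos (I : Input r t u Q T n v) : 0 < r := I.sep.pos

theorem ne (I : Input r t u Q T n v) : u ≠ 0 := I.sep.ne

theorem gp (I : Input r t u Q T n v) (s : Bool) : GeneralPosition r ↑(Q s) := by
  have := I.sep.gp
  cases s with
  | true => exact fun p hp q hq w hw => this p (Or.inl hp) q (Or.inl hq) w (Or.inl hw)
  | false => exact fun p hp q hq w hw => this p (Or.inr hp) q (Or.inr hq) w (Or.inr hw)

theorem rad_pos (I : Input r t u Q T n v) : 0 < rad r u :=
  (I.sep.frame (τ := 1) (by norm_num)).rad_pos I.pos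

theorem side (I : Input r t u Q T n v) {s : Bool} {p : Plane} (hp : p ∈ Q s) :
    sgn s * (u 0 * p 0 + u 1 * p 1) < sgn s * t := by
  cases s with
  | true => have := I.sep.left p hp; simpa using this
  | false => have := I.sep.right p hp; simp only [sgn_false]; linarith

/-- The abscissae of all vertices lie between `m true`, the leftmost of `L`, and `m false`, the
rightmost of `R`, so two extremes bound the admissible range for both sets. -/
theorem dom (I : Input r t u Q T n v) {m : Bool → ℝ} (hm : Extreme r u Q m) {x : Bool} {X : ℝ}
    (h1 : loX (rad r u) m x ≤ X) (h2 : X ≤ hiX (rad r u) m x) (τ : ℝ) {s : Bool} {p : Plane}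
    (hp : IsVertex r ↑(Q s) p) : |X - (hat u (sgn x) τ p).1| ≤ rad r u := by
  obtain ⟨a, ha, ha', hl⟩ := hm true
  obtain ⟨b, hb, hb', hr⟩ := hm false
  have k1 := I.sep.left a ha.1
  have k2 := I.sep.right b hb.1
  have key : m true ≤ u 0 * p 0 + u 1 * p 1 ∧ u 0 * p 0 + u 1 * p 1 ≤ m false := by
    cases s with
    | true =>
      have := hl p hp
      have := I.sep.left p hp.1
      simp only [sgn_true] at *
      constructor <;> linarith
    | false =>
      have := hr p hp
      have := I.sep.right p hp.1
      simp only [sgn_false] at *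
      constructor <;> linarith
  rw [abs_le]
  simp only [hat]
  cases x <;> simp [loX, hiX] at * <;> constructor <;> linarith [key.1, key.2]

/-- The separating abscissa also lies between the extremes, so the half circle around `(t, 0)` can
serve as a reference on the whole range. -/
theorem dom_sep (I : Input r t u Q T n v) {m : Bool → ℝ} (hm : Extreme r u Q m) {X : ℝ}
    (h1 : loX (rad r u) m true ≤ X) (h2 : X ≤ hiX (rad r u) m true) : |X - t| ≤ rad r u := by
  obtain ⟨a, ha, ha', -⟩ := hm true
  obtain ⟨b, hb, hb', -⟩ := hm false
  have k1 := I.sep.left a ha.1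
  have k2 := I.sep.right b hb.1
  rw [abs_le]
  simp only [loX, hiX, if_true] at h1 h2
  constructor <;> linarith

/-- The crossing at an edge of the envelope is on the envelope. -/
theorem low_le_of_eq (I : Input r t u Q T n v) {m : Bool → ℝ} (hm : Extreme r u Q m) {x d : Bool}
    {X : ℝ} (h1 : loX (rad r u) m x ≤ X) (h2 : X ≤ hiX (rad r u) m x) {s : Bool} {e : VertexRecord}
    (he : e ∈ inorder (T s)) (hact : Active u (sgn s) d (v s 0) e.pt e.next)
    (h : low r u x d e.pt X = low r u x d e.next X) {p : Plane} (hp : IsVertex r ↑(Q s) p) :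
    low r u x d p X ≤ low r u x d e.pt X := by
  have R := I.ring s
  obtain ⟨j, hjn, hj, hmax, -⟩ := R.exists_first d fun p => low r u x d p X
  have G := R.guide_index I.pos I.ne (I.gp s) (x := x) (fun p hp => I.dom hm h1 h2 _ hp) hjn hj hmax
  obtain ⟨i, hi, rfl⟩ := (R.vertex p).2 hp
  have h3 := hmax i hi.le
  rcases G.eq e he hact h with h4 | h4
  · rw [h, ← h4.2]; exact h3
  · rw [← h4.2]; exact h3

end Input

/-! ### Moves at an edge, given the side of its crossing -/

namespace Target

variable {r t : ℝ} {u : Plane} {Q : Bool → Finset Plane} {T : Bool → HullTree} {n : Bool → ℕ}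
  {v : Bool → ℕ → Plane} {m : Bool → ℝ} {x : Bool} {d : Bool → Bool} {w : Bool → Plane} {z : ℝ}

theorem exists_guide (G : Target r t u Q m x d w z) (I : Input r t u Q T n v)
    (hm : Extreme r u Q m) (s : Bool) : ∃ A, Guide r u s x (d s) (T s) (v s 0) (w s) z A :=
  (I.ring s).exists_guide I.pos I.ne (I.gp s) (fun _ hp => I.dom hm G.mem.1 G.mem.2 _ hp)
    (G.vertex s) (G.max s)

variable {s : Bool} {A : VertexRecord → Prop} {e : VertexRecord} {X : ℝ}

/-- To the right of the crossing the higher half circle belongs to the point farther left. If the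
center is exactly at the crossing, `tie` makes the target the leftmost of the tied vertices, so the
same comparison is right. -/
theorem after_iff_of_le (G : Target r t u Q m x d w z) (I : Input r t u Q T n v)
    (hm : Extreme r u Q m) (hA : Guide r u s x (d s) (T s) (v s 0) (w s) z A)
    (h1 : loX (rad r u) m x ≤ X) (h2 : X ≤ hiX (rad r u) m x) (he : e ∈ inorder (T s))
    (hpt : IsVertex r ↑(Q s) e.pt) (hnext : IsVertex r ↑(Q s) e.next)
    (hact : Active u (sgn s) (d s) (v s 0) e.pt e.next)
    (hne : (hat u (sgn x) (sgn (d s)) e.pt).1 ≠ (hat u (sgn x) (sgn (d s)) e.next).1)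
    (h : low r u x (d s) e.pt X = low r u x (d s) e.next X) (hX : X ≤ z) :
    A e ↔ (hat u (sgn x) (sgn (d s)) e.next).1 < (hat u (sgn x) (sgn (d s)) e.pt).1 := by
  have dX := fun p (hp : IsVertex r ↑(Q s) p) => I.dom hm h1 h2 (sgn (d s)) hp
  have dz := fun p (hp : IsVertex r ↑(Q s) p) => I.dom hm G.mem.1 G.mem.2 (sgn (d s)) hp
  rcases eq_or_lt_of_le hX with rfl | hlt
  · rcases hA.eq e he hact h with ⟨h3, h4⟩ | ⟨h3, h4⟩
    · have h5 := G.tie s e.pt hpt (fun h' => hne (by rw [h', h4])) (by rw [h4]; exact h)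
      rw [h4] at h5
      exact iff_of_true h3 h5
    · have h5 := G.tie s e.next hnext (fun h' => hne (by rw [h', h4])) (by rw [h4]; exact h.symm)
      rw [h4] at h5
      exact iff_of_false h3 (not_lt.2 h5.le)
  · unfold low at h
    rcases lt_or_gt_of_ne hne with h3 | h3
    · refine iff_of_false (hA.gt e he hact ?_) (not_lt.2 h3.le)
      have := lo_sub_lo_lt h3 hlt (dX _ hnext) (dz _ hpt)
      linarith
    · refine iff_of_true (hA.lt e he hact ?_) h3
      have := lo_sub_lo_lt h3 hlt (dX _ hpt) (dz _ hnext)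
      linarith

/-- To the left of the crossing the higher half circle belongs to the point farther right; there is
no tie. -/
theorem after_iff_of_lt (G : Target r t u Q m x d w z) (I : Input r t u Q T n v)
    (hm : Extreme r u Q m) (hA : Guide r u s x (d s) (T s) (v s 0) (w s) z A)
    (h1 : loX (rad r u) m x ≤ X) (h2 : X ≤ hiX (rad r u) m x) (he : e ∈ inorder (T s))
    (hpt : IsVertex r ↑(Q s) e.pt) (hnext : IsVertex r ↑(Q s) e.next)
    (hact : Active u (sgn s) (d s) (v s 0) e.pt e.next)
    (hne : (hat u (sgn x) (sgn (d s)) e.pt).1 ≠ (hat u (sgn x) (sgn (d s)) e.next).1)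
    (h : low r u x (d s) e.pt X = low r u x (d s) e.next X) (hX : z < X) :
    A e ↔ (hat u (sgn x) (sgn (d s)) e.pt).1 < (hat u (sgn x) (sgn (d s)) e.next).1 := by
  have dX := fun p (hp : IsVertex r ↑(Q s) p) => I.dom hm h1 h2 (sgn (d s)) hp
  have dz := fun p (hp : IsVertex r ↑(Q s) p) => I.dom hm G.mem.1 G.mem.2 (sgn (d s)) hp
  unfold low at h
  rcases lt_or_gt_of_ne hne with h3 | h3
  · refine iff_of_true (hA.lt e he hact ?_) h3
    have := lo_sub_lo_lt h3 hX (dz _ hnext) (dX _ hpt)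
    linarith
  · refine iff_of_false (hA.gt e he hact ?_) (not_lt.2 h3.le)
    have := lo_sub_lo_lt h3 hX (dz _ hpt) (dX _ hnext)
    linarith

/-- The side of the crossings on which the center lies, if both sets have envelopes of the same
kind. -/
theorem meet_rules (G : Target r t u Q m x d w z) (I : Input r t u Q T n v)
    (hm : Extreme r u Q m) (hd : d true = d false) {X : Bool → ℝ} {P : Bool → Plane}
    (hX : ∀ s, loX (rad r u) m x ≤ X s ∧ X s ≤ hiX (rad r u) m x)
    (hP : ∀ s, IsVertex r ↑(Q s) (P s))
    (hPX : ∀ s, low r u x (d s) (w s) (X s) ≤ low r u x (d s) (P s) (X s)) {H : Bool → ℝ}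
    (hH : ∀ s, H s = low r u x (d s) (P s) (X s) + psi (rad r u) (X s - t)) :
    (X true ≤ X false → H true ≤ H false → X true ≤ z) ∧
    (X true ≤ X false → ¬ H true ≤ H false → z < X false) ∧
    (¬ X true ≤ X false → H false ≤ H true → z < X true) ∧
    (¬ X true ≤ X false → ¬ H false ≤ H true → X false ≤ z) := by
  obtain ⟨rfl, heq⟩ := G.meet hd
  -- Adding `psi` subtracts the lower half circle around the point `(t, 0)` of the separating line.
  -- Relative to it, half circles of points on the left increase and those on the right decrease, as
  -- `CircularHull.meet_rules` requires.
  have ht : ∀ Z, lo (rad r u) (t, 0) Z = - psi (rad r u) (Z - t) := fun Z => by simp [lo]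
  have inc : ∀ p, IsVertex r ↑(Q true) p →
      StrictMonoOn (fun Z => low r u true (d true) p Z + psi (rad r u) (Z - t))
        (Set.Icc (loX (rad r u) m true) (hiX (rad r u) m true)) := by
    intro p hp Z hZ Z' hZ' hlt
    have := lo_sub_lo_lt (r := rad r u) (v := hat u (sgn true) (sgn (d true)) p) (w := (t, 0))
      (by have := I.sep.left p hp.1; simpa [hat] using this) hlt (I.dom_sep hm hZ.1 hZ.2)
      (I.dom hm hZ'.1 hZ'.2 _ hp)
    rw [ht, ht] at this
    simp only [low]
    linarith
  have dec : ∀ p, IsVertex r ↑(Q false) p →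
      StrictAntiOn (fun Z => low r u true (d false) p Z + psi (rad r u) (Z - t))
        (Set.Icc (loX (rad r u) m true) (hiX (rad r u) m true)) := by
    intro p hp Z hZ Z' hZ' hlt
    have := lo_sub_lo_lt (r := rad r u) (w := hat u (sgn true) (sgn (d false)) p) (v := (t, 0))
      (by have := I.sep.right p hp.1; simpa [hat] using this) hlt (I.dom hm hZ.1 hZ.2 _ hp)
      (I.dom_sep hm hZ'.1 hZ'.2)
    rw [ht, ht] at this
    simp only [low]
    linarith
  rw [hH, hH]
  exact CircularHull.meet_rules G.mem (hX true) (hX false) (inc _ (G.vertex true))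
    (inc _ (hP true)) (dec _ (G.vertex false)) (dec _ (hP false)) (by rw [heq])
    (by simpa using G.max true _ (hP true)) (by simpa using G.max false _ (hP false))
    (by simpa using hPX true) (by simpa using hPX false)

theorem opposite_rules (G : Target r t u Q m x d w z) (I : Input r t u Q T n v)
    (hm : Extreme r u Q m) (hd : d true ≠ d false) {X : Bool → ℝ} {P : Bool → Plane}
    (hX : ∀ s, loX (rad r u) m x ≤ X s ∧ X s ≤ hiX (rad r u) m x)
    (hP : ∀ s, IsVertex r ↑(Q s) (P s))
    (hPX : ∀ s, low r u x (d s) (w s) (X s) ≤ low r u x (d s) (P s) (X s)) {F : Bool → ℝ} {M : ℝ}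
    (hF : ∀ s, F s = low r u x (d true) (P true) (X s) + low r u x (d false) (P false) (X s))
    (hM : M = (hat u (sgn x) (sgn (d true)) (P true)).1 +
      (hat u (sgn x) (sgn (d false)) (P false)).1) :
    (0 < F false → X false + X false < M → X false ≤ z) ∧
    (0 < F false → ¬ X false + X false < M → z < X false) ∧
    (0 < F true → X true + X true < M → X true ≤ z) ∧
    (0 < F true → ¬ X true + X true < M → z < X true) ∧
    (¬ 0 < F false → ¬ 0 < F true → X true ≤ X false → X true ≤ z) ∧
    (¬ 0 < F false → ¬ 0 < F true → ¬ X true ≤ X false → X false ≤ z) := by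
  obtain ⟨h1, h2⟩ := G.opposite hd
  rw [hF, hF, hM]
  exact CircularHull.opposite_rules G.mem (hX true) (hX false)
    (fun Z k1 k2 => I.dom hm k1 k2 _ (G.vertex true))
    (fun Z k1 k2 => I.dom hm k1 k2 _ (G.vertex false))
    (fun Z k1 k2 => I.dom hm k1 k2 _ (hP true)) (fun Z k1 k2 => I.dom hm k1 k2 _ (hP false))
    h1 h2 (G.max true _ (hP true)) (G.max false _ (hP false)) (hPX true) (hPX false)

end Target

/-! ### Expressions -/

/-- The real registers: 0 to 3 the input, 4 the scaled radius, 5 to 8 the first vertices, 9 and 10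
the extremes, 11 to 18 the tangent points found, 19 and 20 their flags, 21 to 24 a saved pair, 25
and 26 a center, 27 the verdict of a test, 30 to 33 the candidates, 34 to 39 the crossings.
Shorter-lived values have higher numbers, so `Keep` needs only one bound. -/
def cur (s : Bool) : ℕ := if s then 2 else 3
def root (s : Bool) : ℕ := if s then 0 else 1
def candX (s : Bool) : ℕ := if s then 30 else 32
def candY (s : Bool) : ℕ := if s then 31 else 33
def firstX (s : Bool) : ℕ := if s then 5 else 7
def firstY (s : Bool) : ℕ := if s then 6 else 8
def extR (s : Bool) : ℕ := if s then 9 else 10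
def absR (s : Bool) : ℕ := if s then 34 else 37
def hatXR (s : Bool) : ℕ := if s then 35 else 38
def hatYR (s : Bool) : ℕ := if s then 36 else 39

theorem plane_eta (p : Plane) : !₂[p 0, p 1] = p := by
  ext i; fin_cases i <;> rfl

/-- The candidate that a search keeps in registers. -/
def cand (s : Bool) (σ : State) : Plane := !₂[σ.re (candX s), σ.re (candY s)]

/-- The registers below `k` and the two roots are unchanged. -/
def Keep (k : ℕ) (σ σ' : State) : Prop :=
  (∀ i < k, σ'.re i = σ.re i) ∧ ∀ s, σ'.ptr (root s) = σ.ptr (root s)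

theorem Keep.refl (k : ℕ) (σ : State) : Keep k σ σ := ⟨fun _ _ => rfl, fun _ => rfl⟩

theorem Keep.trans {k : ℕ} {σ σ' σ'' : State} (h : Keep k σ σ') (h' : Keep k σ' σ'') : Keep k σ σ'' :=
  ⟨fun i hi => (h'.1 i hi).trans (h.1 i hi), fun s => (h'.2 s).trans (h.2 s)⟩

theorem Keep.mono {k l : ℕ} (hkl : k ≤ l) {σ σ' : State} (h : Keep l σ σ') : Keep k σ σ' :=
  ⟨fun i hi => h.1 i (by omega), h.2⟩

/-- The basic quantities are in their registers. -/
structure Basic (r t : ℝ) (u : Plane) (T : Bool → HullTree) (σ : State) : Prop where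
  radius : σ.re 0 = r
  u0 : σ.re 1 = u 0
  u1 : σ.re 2 = u 1
  line : σ.re 3 = t
  scaled : σ.re 4 = rad r u
  root : ∀ s, σ.ptr (root s) = T s

/-- So are the first vertices of both hulls and the extreme abscissae. -/
structure Env (r t : ℝ) (u : Plane) (T : Bool → HullTree) (v : Bool → ℕ → Plane) (m : Bool → ℝ)
    (σ : State) : Prop extends Basic r t u T σ where
  first : ∀ s, σ.re (firstX s) = v s 0 0 ∧ σ.re (firstY s) = v s 0 1
  ext : ∀ s, σ.re (extR s) = m s

section

variable {r t : ℝ} {u : Plane} {T : Bool → HullTree} {v : Bool → ℕ → Plane} {m : Bool → ℝ}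
  {σ σ' : State}

theorem Basic.keep {k : ℕ} (hk : 5 ≤ k) (h : Keep k σ σ') (B : Basic r t u T σ) :
    Basic r t u T σ' :=
  ⟨(h.1 0 (by omega)).trans B.radius, (h.1 1 (by omega)).trans B.u0, (h.1 2 (by omega)).trans B.u1,
    (h.1 3 (by omega)).trans B.line, (h.1 4 (by omega)).trans B.scaled, fun s => (h.2 s).trans (B.root s)⟩

theorem Env.keep {k : ℕ} (hk : 11 ≤ k) (h : Keep k σ σ') (E : Env r t u T v m σ) :
    Env r t u T v m σ' := by
  refine ⟨E.toBasic.keep (by omega) h, fun s => ⟨?_, ?_⟩, fun s => ?_⟩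
  · rw [← (E.first s).1]; exact h.1 _ (by cases s <;> simp [firstX] <;> omega)
  · rw [← (E.first s).2]; exact h.1 _ (by cases s <;> simp [firstY] <;> omega)
  · rw [← E.ext s]; exact h.1 _ (by cases s <;> simp [extR] <;> omega)

/-- A pair of expressions evaluates to the coordinates of a point. -/
def Rep (σ : State) (e : RealExpr × RealExpr) (p : Plane) : Prop :=
  e.1.eval σ = p 0 ∧ e.2.eval σ = p 1

def fieldE (f : Field) (s : Bool) : RealExpr × RealExpr :=
  (.coord f 0 (.reg (cur s)), .coord f 1 (.reg (cur s)))

def candE (s : Bool) : RealExpr × RealExpr := (.reg (candX s), .reg (candY s))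

def firstE (s : Bool) : RealExpr × RealExpr := (.reg (firstX s), .reg (firstY s))

theorem rep_pt {s : Bool} {e : VertexRecord} {l r' : HullTree} (h : σ.ptr (cur s) = .node e l r') :
    Rep σ (fieldE .pt s) e.pt := by
  simp [Rep, fieldE, RealExpr.eval, PtrExpr.eval, h, readCoord]

theorem rep_next {s : Bool} {e : VertexRecord} {l r' : HullTree}
    (h : σ.ptr (cur s) = .node e l r') : Rep σ (fieldE .next s) e.next := by
  simp [Rep, fieldE, RealExpr.eval, PtrExpr.eval, h, readCoord]

theorem rep_cand (s : Bool) : Rep σ (candE s) (cand s σ) := by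
  simp [Rep, candE, RealExpr.eval, cand]

theorem Env.rep_first (E : Env r t u T v m σ) (s : Bool) : Rep σ (firstE s) (v s 0) := E.first s

def sgnE (b : Bool) : RealExpr := .const (if b then 1 else -1)

@[simp] theorem sgnE_eval (b : Bool) : (sgnE b).eval σ = sgn b := by
  cases b <;> simp [sgnE, RealExpr.eval]

def hatXE (x : Bool) (e : RealExpr × RealExpr) : RealExpr :=
  .mul (sgnE x) (.add (.mul (.reg 1) e.1) (.mul (.reg 2) e.2))

def hatYE (d : Bool) (e : RealExpr × RealExpr) : RealExpr :=
  .mul (sgnE d) (.sub (.mul (.reg 1) e.2) (.mul (.reg 2) e.1))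

theorem hatXE_eval (B : Basic r t u T σ) {e : RealExpr × RealExpr} {p : Plane} (h : Rep σ e p)
    (x : Bool) (τ : ℝ) : (hatXE x e).eval σ = (hat u (sgn x) τ p).1 := by
  simp [hatXE, RealExpr.eval, hat, B.u0, B.u1, h.1, h.2]

theorem hatYE_eval (B : Basic r t u T σ) {e : RealExpr × RealExpr} {p : Plane} (h : Rep σ e p)
    (τ : ℝ) (d : Bool) : (hatYE d e).eval σ = (hat u τ (sgn d) p).2 := by
  simp [hatYE, RealExpr.eval, hat, B.u0, B.u1, h.1, h.2]

def psiE (e : RealExpr) : RealExpr := .sqrt (.sub (.mul (.reg 4) (.reg 4)) (.mul e e))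

theorem psiE_eval (B : Basic r t u T σ) (e : RealExpr) :
    (psiE e).eval σ = psi (rad r u) (e.eval σ) := by
  simp [psiE, RealExpr.eval, psi, B.scaled]

def loE (X x y : RealExpr) : RealExpr := .sub y (psiE (.sub X x))

theorem loE_eval (B : Basic r t u T σ) (X x y : RealExpr) :
    (loE X x y).eval σ = lo (rad r u) (x.eval σ, y.eval σ) (X.eval σ) := by
  simp [loE, RealExpr.eval, lo, psiE_eval B]

def lowE (x d : Bool) (e : RealExpr × RealExpr) (X : RealExpr) : RealExpr :=
  loE X (hatXE x e) (hatYE d e)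

theorem lowE_eval (B : Basic r t u T σ) {e : RealExpr × RealExpr} {p : Plane} (h : Rep σ e p)
    (x d : Bool) (X : RealExpr) : (lowE x d e X).eval σ = low r u x d p (X.eval σ) := by
  rw [lowE, loE_eval B, hatXE_eval B h x (sgn d), hatYE_eval B h (sgn x) d]; rfl

def sqE (x₁ y₁ x₂ y₂ : RealExpr) : RealExpr :=
  .add (.mul (.sub x₂ x₁) (.sub x₂ x₁)) (.mul (.sub y₂ y₁) (.sub y₂ y₁))

def crossE (x₁ y₁ x₂ y₂ : RealExpr) : RealExpr :=
  .add (.div (.add x₁ x₂) (.const 2))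
    (.div (.mul (.mul (.sub x₂ x₁) (.sub y₂ y₁))
        (.sqrt (.sub (.mul (.reg 4) (.reg 4)) (.div (sqE x₁ y₁ x₂ y₂) (.const 4)))))
      (.mul (.sqrt (sqE x₁ y₁ x₂ y₂)) (.sqrt (.mul (.sub x₂ x₁) (.sub x₂ x₁)))))

theorem crossE_eval (B : Basic r t u T σ) (x₁ y₁ x₂ y₂ : RealExpr) : (crossE x₁ y₁ x₂ y₂).eval σ =
    crossX (rad r u) (x₁.eval σ) (y₁.eval σ) (x₂.eval σ) (y₂.eval σ) := by
  simp [crossE, sqE, RealExpr.eval, crossX, B.scaled]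

def loXE (x : Bool) : RealExpr :=
  if x then .sub (.reg 10) (.reg 4) else .sub (.const 0) (.add (.reg 9) (.reg 4))

def hiXE (x : Bool) : RealExpr :=
  if x then .add (.reg 9) (.reg 4) else .sub (.const 0) (.sub (.reg 10) (.reg 4))

theorem loXE_eval (E : Env r t u T v m σ) (x : Bool) :
    (loXE x).eval σ = loX (rad r u) m x := by
  have h1 := E.ext true
  have h2 := E.ext false
  cases x <;> simp_all [loXE, loX, RealExpr.eval, E.scaled, extR]

theorem hiXE_eval (E : Env r t u T v m σ) (x : Bool) :
    (hiXE x).eval σ = hiX (rad r u) m x := by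
  have h1 := E.ext true
  have h2 := E.ext false
  cases x <;> simp_all [hiXE, hiX, RealExpr.eval, E.scaled, extR]

def ltT (e f : RealExpr) : Test := .not (.le f e)

theorem ltT_holds {e f : RealExpr} : (ltT e f).Holds σ ↔ e.eval σ < f.eval σ := not_le

def eqT (e f : RealExpr × RealExpr) : Test :=
  .and (.and (.le e.1 f.1) (.le f.1 e.1)) (.and (.le e.2 f.2) (.le f.2 e.2))

theorem eqT_holds {e f : RealExpr × RealExpr} {p q : Plane} (he : Rep σ e p) (hf : Rep σ f q) :
    (eqT e f).Holds σ ↔ p = q := by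
  simp only [eqT, Test.Holds, he.1, he.2, hf.1, hf.2, ← le_antisymm_iff]
  constructor
  · rintro ⟨h1, h2⟩
    ext i; fin_cases i <;> assumption
  · rintro rfl
    exact ⟨rfl, rfl⟩

def activeT (s d : Bool) : Test :=
  if d then .and (.not (eqT (fieldE .next s) (firstE s)))
    (.le (hatXE s (fieldE .next s)) (hatXE s (fieldE .pt s)))
  else .and (.not (eqT (fieldE .pt s) (firstE s)))
    (.le (hatXE s (fieldE .pt s)) (hatXE s (fieldE .next s)))

theorem activeT_holds (B : Basic r t u T σ) {s d : Bool} {o : Plane} (ho : Rep σ (firstE s) o)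
    {e : VertexRecord} {l r' : HullTree} (h : σ.ptr (cur s) = .node e l r') :
    (activeT s d).Holds σ ↔ Active u (sgn s) d o e.pt e.next := by
  have h1 := hatXE_eval B (rep_pt h) s 0
  have h2 := hatXE_eval B (rep_next h) s 0
  have h3 := eqT_holds (rep_pt h) ho
  have h4 := eqT_holds (rep_next h) ho
  cases d <;> simp only [activeT, Active, Bool.false_eq_true, if_true, if_false, Test.Holds, h1, h2,
    h3, h4, hat, ne_eq]

end

/-! ### Moving the cursors -/

def moveTo (s : Bool) (f : Field) (q : PtrExpr) : Program :=
  .seq (.setReal (candX s) (fieldE f s).1) (.seq (.setReal (candY s) (fieldE f s).2)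
    (.setPtr (cur s) q))

def moveR (s : Bool) : Program := moveTo s .next (.right (.reg (cur s)))

def moveL (s : Bool) : Program := moveTo s .pt (.left (.reg (cur s)))

structure Moved (s : Bool) (σ σ' : State) (S : HullTree) (p : Plane) : Prop where
  ptr : σ'.ptr (cur s) = S
  cand : cand s σ' = p
  ptr_other : σ'.ptr (cur !s) = σ.ptr (cur !s)
  cand_other : CircularHull.cand (!s) σ' = CircularHull.cand (!s) σ
  keep : Keep 30 σ σ'

section

variable {s : Bool} {σ : State} {e : VertexRecord} {l r' : HullTree}

theorem moved_of_moveR (h : σ.ptr (cur s) = .node e l r') :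
    Moved s σ ((moveR s).act σ) r' e.next := by
  constructor
  · simp [moveR, moveTo, Program.act, PtrExpr.eval, h, rightChild]
  · rw [← plane_eta e.next]
    cases s <;> simp [cand, moveR, moveTo, Program.act, fieldE, RealExpr.eval, PtrExpr.eval, h,
      readCoord, candX, candY]
  · cases s <;> simp [moveR, moveTo, Program.act, cur]
  · cases s <;> simp [cand, moveR, moveTo, Program.act, candX, candY]
  · constructor
    · intro i hi
      cases s <;> simp only [moveR, moveTo, Program.act, candX, candY, if_true,
        Bool.false_eq_true, if_false] <;> rw [Function.update_of_ne (by omega),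
          Function.update_of_ne (by omega)]
    · intro s'
      cases s <;> cases s' <;> simp [moveR, moveTo, Program.act, cur, root]

theorem moved_of_moveL (h : σ.ptr (cur s) = .node e l r') :
    Moved s σ ((moveL s).act σ) l e.pt := by
  constructor
  · simp [moveL, moveTo, Program.act, PtrExpr.eval, h, leftChild]
  · rw [← plane_eta e.pt]
    cases s <;> simp [cand, moveL, moveTo, Program.act, fieldE, RealExpr.eval, PtrExpr.eval, h,
      readCoord, candX, candY]
  · cases s <;> simp [moveL, moveTo, Program.act, cur]
  · cases s <;> simp [cand, moveL, moveTo, Program.act, candX, candY]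
  · constructor
    · intro i hi
      cases s <;> simp only [moveL, moveTo, Program.act, candX, candY, if_true,
        Bool.false_eq_true, if_false] <;> rw [Function.update_of_ne (by omega),
          Function.update_of_ne (by omega)]
    · intro s'
      cases s <;> cases s' <;> simp [moveL, moveTo, Program.act, cur, root]

end

theorem Program.act_cond_pos {b : Test} {P P' : Program} {σ : State} (h : b.Holds σ) :
    (Program.cond b P P').act σ = P.act σ := by simp [Program.act, h]

theorem Program.act_cond_neg {b : Test} {P P' : Program} {σ : State} (h : ¬ b.Holds σ) :
    (Program.cond b P P').act σ = P'.act σ := by simp [Program.act, h]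

/-- Search from the root. -/
def search (s : Bool) (b : Test) : Program :=
  .seq (.setPtr (cur s) (.reg (root s)))
    (.loop (.not (.isNil (.reg (cur s)))) (.cond b (moveR s) (moveL s)))

/-- The invariant is that `find`, continued from the current subtree with the current candidate,
still gives the final result; the height of the subtree is the measure. The test may use the stored
registers, hence `hb` is asked only as long as they are kept. -/
theorem Ensures.search {h : ℕ} {s : Bool} {b : Test} {A : VertexRecord → Prop} {σ : State}
    {T : HullTree} (hT : σ.ptr (root s) = T) (hh : T.height ≤ h)
    (hb : ∀ σ', Keep 30 σ σ' → ∀ e ∈ inorder T, ∀ l r', σ'.ptr (cur s) = .node e l r' →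
      (b.Holds σ' ↔ A e)) :
    Ensures h (CircularHull.search s b) σ fun σ' => Keep 30 σ σ' ∧
      CircularHull.cand s σ' = find A T (CircularHull.cand s σ) := by
  set σ₁ : State := (Program.setPtr (cur s) (.reg (root s))).act σ with hσ₁
  have k₁ : Keep 30 σ σ₁ := ⟨fun i _ => rfl, fun s' => by
    cases s <;> cases s' <;> simp [hσ₁, Program.act, cur, root]⟩
  have p₁ : σ₁.ptr (cur s) = T := by simp [hσ₁, Program.act, PtrExpr.eval, hT]
  refine (Ensures.of_act (P := .setPtr (cur s) (.reg (root s))) (Q := fun σ' => σ' = σ₁)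
    trivial rfl).seq ?_
  rintro _ rfl
  have lf : (Program.cond b (moveR s) (moveL s)).LoopFree :=
    ⟨⟨trivial, trivial, trivial⟩, trivial, trivial, trivial⟩
  refine (Ensures.loop (h := h) lf
    (fun σ' => Keep 30 σ σ' ∧ (∀ e ∈ inorder (σ'.ptr (cur s)), e ∈ inorder T) ∧
      find A (σ'.ptr (cur s)) (CircularHull.cand s σ') = find A T (CircularHull.cand s σ))
    (fun σ' => (σ'.ptr (cur s)).height) ?_ ⟨k₁, ?_, ?_⟩ ?_).mono ?_
  · rintro σ' ⟨h1, h2, h3⟩ h4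
    obtain ⟨e, l, r', hp⟩ : ∃ e l r', σ'.ptr (cur s) = .node e l r' := by
      cases hp : σ'.ptr (cur s) with
      | nil => exact absurd hp h4
      | node e l r' => exact ⟨e, l, r', rfl⟩
    have he := hb σ' h1 e (h2 e (by rw [hp]; simp [inorder])) l r' hp
    rw [hp] at h2 h3
    by_cases hA : A e
    · have M := moved_of_moveR hp
      rw [Program.act_cond_pos (he.2 hA), M.ptr, M.cand]
      refine ⟨⟨h1.trans M.keep, fun e' he' => h2 e' (by simp [inorder, he']), ?_⟩, ?_⟩
      · rw [← h3]; simp [find, hA]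
      · rw [hp]; simp only [BinaryTree.height]; omega
    · have M := moved_of_moveL hp
      rw [Program.act_cond_neg (mt he.1 hA), M.ptr, M.cand]
      refine ⟨⟨h1.trans M.keep, fun e' he' => h2 e' (by simp [inorder, he']), ?_⟩, ?_⟩
      · rw [← h3]; simp [find, hA]
      · rw [hp]; simp only [BinaryTree.height]; omega
  · rw [p₁]; exact fun _ h => h
  · rw [p₁]; rfl
  · rw [p₁]; exact hh
  · rintro σ' ⟨⟨h1, h2, h3⟩, h4⟩
    have hp : σ'.ptr (cur s) = .nil := by simpa [Test.Holds, PtrExpr.eval] using h4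
    rw [hp] at h3
    exact ⟨h1, h3⟩

/-! ### The simultaneous search in two trees -/

def geMove (s x : Bool) : Program :=
  .cond (ltT (hatXE x (fieldE .next s)) (hatXE x (fieldE .pt s))) (moveR s) (moveL s)

def ltMove (s x : Bool) : Program :=
  .cond (ltT (hatXE x (fieldE .pt s)) (hatXE x (fieldE .next s))) (moveR s) (moveL s)

/-- Move, knowing that the center is not to the left of the crossing in the tree `s`. -/
def ge (s x : Bool) : Program := .cond (.isNil (.reg (cur s))) (geMove (!s) x) (geMove s x)

/-- Move, knowing that the center is to the left of the crossing in the tree `s`. -/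
def lt (s x : Bool) : Program := .cond (.isNil (.reg (cur s))) (ltMove (!s) x) (ltMove s x)

/-- Move in the tree `s` if its edge has no crossing in the range of abscissae. -/
def freeStep (s x d : Bool) (P : Program) : Program :=
  .cond (.isNil (.reg (cur s))) P
    (.cond (.not (activeT s d)) (if d then moveL s else moveR s)
      (.cond (.and (ltT (lowE x d (fieldE .pt s) (loXE x)) (lowE x d (fieldE .next s) (loXE x)))
          (ltT (lowE x d (fieldE .pt s) (hiXE x)) (lowE x d (fieldE .next s) (hiXE x)))) (moveR s)
        (.cond (.and (ltT (lowE x d (fieldE .next s) (loXE x)) (lowE x d (fieldE .pt s) (loXE x)))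
          (ltT (lowE x d (fieldE .next s) (hiXE x)) (lowE x d (fieldE .pt s) (hiXE x)))) (moveL s)
          P)))

/-- Compute the crossing at the edge in the tree `s`. -/
def setup (s x d : Bool) : Program :=
  .cond (.isNil (.reg (cur s)))
    (.seq (.setReal (hatXR s) (hatXE x (candE s))) (.setReal (hatYR s) (hatYE d (candE s))))
    (.seq (.setReal (absR s) (crossE (hatXE x (fieldE .pt s)) (hatYE d (fieldE .pt s))
        (hatXE x (fieldE .next s)) (hatYE d (fieldE .next s))))
      (.seq (.setReal (hatXR s) (hatXE x (fieldE .pt s)))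
        (.setReal (hatYR s) (hatYE d (fieldE .pt s)))))

/-- A finished search has no edge and no crossing. It takes over the abscissa of the other one, and
its final candidate stands in for the vertex on the envelope, so that the rules for two crossings
still apply. -/
def sync : Program :=
  .cond (.isNil (.reg (cur true))) (.setReal (absR true) (.reg (absR false)))
    (.cond (.isNil (.reg (cur false))) (.setReal (absR false) (.reg (absR true))) .skip)

def heightE (s : Bool) : RealExpr :=
  .add (loE (.reg (absR s)) (.reg (hatXR s)) (.reg (hatYR s))) (psiE (.sub (.reg (absR s)) (.reg 3)))

def sumE (s : Bool) : RealExpr :=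
  .add (loE (.reg (absR s)) (.reg (hatXR true)) (.reg (hatYR true)))
    (loE (.reg (absR s)) (.reg (hatXR false)) (.reg (hatYR false)))

def midT (s : Bool) : Test :=
  ltT (.add (.reg (absR s)) (.reg (absR s))) (.add (.reg (hatXR true)) (.reg (hatXR false)))

def leT : Test := .le (.reg (absR true)) (.reg (absR false))

def decideMeet (x : Bool) : Program :=
  .cond leT
    (.cond (.le (heightE true) (heightE false)) (ge true x) (lt false x))
    (.cond (.le (heightE false) (heightE true)) (lt true x) (ge false x))

def decideOpposite (x : Bool) : Program :=
  .cond (ltT (.const 0) (sumE false)) (.cond (midT false) (ge false x) (lt false x))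
    (.cond (ltT (.const 0) (sumE true)) (.cond (midT true) (ge true x) (lt true x))
      (.cond leT (ge true x) (ge false x)))

def crossStep (x : Bool) (d : Bool → Bool) : Program :=
  .seq (.seq (setup true x (d true)) (.seq (setup false x (d false)) sync))
    (if d true = d false then decideMeet x else decideOpposite x)

def start (s : Bool) : Program :=
  .seq (.setPtr (cur s) (.reg (root s)))
    (.seq (.setReal (candX s) (fieldE .pt s).1) (.setReal (candY s) (fieldE .pt s).2))

/-- Search simultaneously in both trees. -/
def double (x : Bool) (d : Bool → Bool) : Program :=
  .seq (.seq (start true) (start false))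
    (.loop (.not (.and (.isNil (.reg (cur true))) (.isNil (.reg (cur false)))))
      (freeStep true x (d true) (freeStep false x (d false) (crossStep x d))))

/-- The half circles of the edge `e` cross at `X`. -/
structure Crossing (r : ℝ) (u : Plane) (m : Bool → ℝ) (s x d : Bool) (o : Plane) (e : VertexRecord)
    (X : ℝ) : Prop where
  act : Active u (sgn s) d o e.pt e.next
  ne : (hat u (sgn x) (sgn d) e.pt).1 ≠ (hat u (sgn x) (sgn d) e.next).1
  mem : loX (rad r u) m x ≤ X ∧ X ≤ hiX (rad r u) m x
  eq : low r u x d e.pt X = low r u x d e.next X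
  val : X = crossX (rad r u) (hat u (sgn x) (sgn d) e.pt).1 (hat u (sgn x) (sgn d) e.pt).2
    (hat u (sgn x) (sgn d) e.next).1 (hat u (sgn x) (sgn d) e.next).2

/-- The proposition `G` says that the search has a target. Without it the search is still guaranteed
to terminate with vertices as candidates, but nothing is claimed about them. -/
structure SearchInv (r : ℝ) (Q : Bool → Finset Plane) (T : Bool → HullTree) (G : Prop)
    (A : Bool → VertexRecord → Prop) (w : Bool → Plane) (σ₀ σ : State) : Prop where
  keep : Keep 30 σ₀ σ
  sub : ∀ s, ∀ e ∈ inorder (σ.ptr (cur s)), e ∈ inorder (T s)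
  vertex : ∀ s, IsVertex r ↑(Q s) (cand s σ)
  find : G → ∀ s, find (A s) (σ.ptr (cur s)) (cand s σ) = w s

def size (σ : State) : ℕ := (σ.ptr (cur true)).height + (σ.ptr (cur false)).height

theorem forall_side {p : Bool → Prop} (s : Bool) (h : p s) (h' : p (!s)) : ∀ s', p s' := by
  intro s'
  cases s <;> cases s' <;> assumption

theorem size_lt {s : Bool} {σ σ' : State} (h : (σ'.ptr (cur s)).height < (σ.ptr (cur s)).height)
    (h' : σ'.ptr (cur !s) = σ.ptr (cur !s)) : size σ' < size σ := by
  unfold size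
  cases s <;> simp only [Bool.not_true, Bool.not_false] at h' <;> rw [h'] <;> omega

section

variable {r t : ℝ} {u : Plane} {Q : Bool → Finset Plane} {T : Bool → HullTree} {n : Bool → ℕ}
  {v : Bool → ℕ → Plane} {m : Bool → ℝ} {x : Bool} {d : Bool → Bool} {w : Bool → Plane} {z : ℝ}
  {G : Prop} {A : Bool → VertexRecord → Prop} {σ₀ σ : State} {s : Bool} {e : VertexRecord}
  {l r' : HullTree}

theorem Input.isVertex_pt (I : Input r t u Q T n v) (he : e ∈ inorder (T s)) :
    IsVertex r ↑(Q s) e.pt := by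
  obtain ⟨i, hi, h, -⟩ := (I.ring s).exists_index he
  rw [h]; exact (I.ring s).isVertex hi.le

theorem Input.isVertex_next (I : Input r t u Q T n v) (he : e ∈ inorder (T s)) :
    IsVertex r ↑(Q s) e.next := by
  obtain ⟨i, hi, -, h⟩ := (I.ring s).exists_index he
  rw [h]; exact (I.ring s).isVertex hi

theorem SearchInv.mem (h : SearchInv r Q T G A w σ₀ σ) (hp : σ.ptr (cur s) = .node e l r') :
    e ∈ inorder (T s) := h.sub s e (by rw [hp]; simp [inorder])

theorem SearchInv.moved {σ' : State} {S : HullTree} {p : Plane} (h : SearchInv r Q T G A w σ₀ σ)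
    (M : Moved s σ σ' S p) (hS : S.height < (σ.ptr (cur s)).height)
    (hsub : ∀ e ∈ inorder S, e ∈ inorder (σ.ptr (cur s))) (hp : IsVertex r ↑(Q s) p)
    (hf : G → CircularHull.find (A s) S p = w s) : SearchInv r Q T G A w σ₀ σ' ∧ size σ' < size σ := by
  refine ⟨⟨h.keep.trans M.keep, ?_, ?_, fun g => ?_⟩, size_lt (M.ptr ▸ hS) M.ptr_other⟩
  · refine forall_side (p := fun s => ∀ e ∈ inorder (σ'.ptr (cur s)), e ∈ inorder (T s)) s ?_ ?_
    · rw [M.ptr]; exact fun e he => h.sub s e (hsub e he)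
    · rw [M.ptr_other]; exact h.sub _
  · refine forall_side (p := fun s => IsVertex r ↑(Q s) (cand s σ')) s ?_ ?_
    · rw [M.cand]; exact hp
    · rw [M.cand_other]; exact h.vertex _
  · refine forall_side
      (p := fun s => CircularHull.find (A s) (σ'.ptr (cur s)) (cand s σ') = w s) s ?_ ?_
    · rw [M.ptr, M.cand]; exact hf g
    · rw [M.ptr_other, M.cand_other]; exact h.find g _

theorem SearchInv.moveR (h : SearchInv r Q T G A w σ₀ σ) (I : Input r t u Q T n v)
    (hp : σ.ptr (cur s) = .node e l r') (hA : G → A s e) :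
    SearchInv r Q T G A w σ₀ ((moveR s).act σ) ∧ size ((CircularHull.moveR s).act σ) < size σ := by
  refine h.moved (moved_of_moveR hp) ?_ ?_ (I.isVertex_next (h.mem hp)) ?_
  · rw [hp]; simp only [BinaryTree.height]; omega
  · rw [hp]; intro e he; simp [inorder, he]
  · intro g
    have := h.find g s
    rw [hp] at this
    simpa [CircularHull.find, hA g] using this

theorem SearchInv.moveL (h : SearchInv r Q T G A w σ₀ σ) (I : Input r t u Q T n v)
    (hp : σ.ptr (cur s) = .node e l r') (hA : G → ¬ A s e) :
    SearchInv r Q T G A w σ₀ ((moveL s).act σ) ∧ size ((CircularHull.moveL s).act σ) < size σ := by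
  refine h.moved (moved_of_moveL hp) ?_ ?_ (I.isVertex_pt (h.mem hp)) ?_
  · rw [hp]; simp only [BinaryTree.height]; omega
  · rw [hp]; intro e he; simp [inorder, he]
  · intro g
    have := h.find g s
    rw [hp] at this
    simpa [CircularHull.find, hA g] using this

theorem SearchInv.env (h : SearchInv r Q T G A w σ₀ σ) (E : Env r t u T v m σ₀) :
    Env r t u T v m σ := E.keep (by norm_num) h.keep

/-- A step at an edge without a crossing in the range. -/
theorem SearchInv.freeStep (h : SearchInv r Q T G A w σ₀ σ) (I : Input r t u Q T n v)
    (hm : Extreme r u Q m) (E : Env r t u T v m σ₀)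
    (hz : G → loX (rad r u) m x ≤ z ∧ z ≤ hiX (rad r u) m x)
    (hg : G → Guide r u s x (d s) (T s) (v s 0) (w s) z (A s)) {P : Program}
    (hnil : σ.ptr (cur s) = .nil →
      SearchInv r Q T G A w σ₀ (P.act σ) ∧ size (P.act σ) < size σ)
    (hnode : ∀ e l r', σ.ptr (cur s) = .node e l r' →
      (G → ∃ X, Crossing r u m s x (d s) (v s 0) e X) →
      SearchInv r Q T G A w σ₀ (P.act σ) ∧ size (P.act σ) < size σ) :
    SearchInv r Q T G A w σ₀ ((freeStep s x (d s) P).act σ) ∧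
      size ((CircularHull.freeStep s x (d s) P).act σ) < size σ := by
  have E' := h.env E
  have B := E'.toBasic
  unfold CircularHull.freeStep
  cases hp : σ.ptr (cur s) with
  | nil =>
    rw [Program.act_cond_pos (by simpa [Test.Holds, PtrExpr.eval] using hp)]
    exact hnil hp
  | node e l r' =>
    rw [Program.act_cond_neg (by simp [Test.Holds, PtrExpr.eval, hp])]
    have he := h.mem hp
    have vp := I.isVertex_pt he
    have vn := I.isVertex_next he
    have hact := activeT_holds B (d := d s) (E'.rep_first s) hp
    by_cases ha : Active u (sgn s) (d s) (v s 0) e.pt e.next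
    · rw [Program.act_cond_neg (by simp only [Test.Holds, hact, not_not]; exact ha)]
      have t1 : ∀ {f g : RealExpr × RealExpr} {p q : Plane}, Rep σ f p → Rep σ g q →
          ((Test.and (ltT (lowE x (d s) f (loXE x)) (lowE x (d s) g (loXE x)))
            (ltT (lowE x (d s) f (hiXE x)) (lowE x (d s) g (hiXE x)))).Holds σ ↔
          low r u x (d s) p (loX (rad r u) m x) < low r u x (d s) q (loX (rad r u) m x) ∧
          low r u x (d s) p (hiX (rad r u) m x) < low r u x (d s) q (hiX (rad r u) m x)) := by
        intro f g p q hf hg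
        rw [Test.Holds, ltT_holds, ltT_holds, lowE_eval B hf, lowE_eval B hg, lowE_eval B hf,
          lowE_eval B hg, loXE_eval E', hiXE_eval E']
      have dlo := fun {p} (hp : IsVertex r ↑(Q s) p) (hle : loX (rad r u) m x ≤ hiX (rad r u) m x) =>
        I.dom hm le_rfl hle (sgn (d s)) hp
      have dhi := fun {p} (hp : IsVertex r ↑(Q s) p) (hle : loX (rad r u) m x ≤ hiX (rad r u) m x) =>
        I.dom hm hle le_rfl (sgn (d s)) hp
      by_cases h1 : low r u x (d s) e.pt (loX (rad r u) m x) <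
            low r u x (d s) e.next (loX (rad r u) m x) ∧
          low r u x (d s) e.pt (hiX (rad r u) m x) < low r u x (d s) e.next (hiX (rad r u) m x)
      · rw [Program.act_cond_pos ((t1 (rep_pt hp) (rep_next hp)).2 h1)]
        refine h.moveR I hp fun g => (hg g).lt e he ha ?_
        have hle := (hz g).1.trans (hz g).2
        exact lo_lt_between (hz g).1 (hz g).2 (dlo vp hle) (dlo vn hle) (dhi vp hle) (dhi vn hle)
          h1.1 h1.2
      · rw [Program.act_cond_neg (mt (t1 (rep_pt hp) (rep_next hp)).1 h1)]
        by_cases h2 : low r u x (d s) e.next (loX (rad r u) m x) <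
              low r u x (d s) e.pt (loX (rad r u) m x) ∧
            low r u x (d s) e.next (hiX (rad r u) m x) < low r u x (d s) e.pt (hiX (rad r u) m x)
        · rw [Program.act_cond_pos ((t1 (rep_next hp) (rep_pt hp)).2 h2)]
          refine h.moveL I hp fun g => (hg g).gt e he ha ?_
          have hle := (hz g).1.trans (hz g).2
          exact lo_lt_between (hz g).1 (hz g).2 (dlo vn hle) (dlo vp hle) (dhi vn hle) (dhi vp hle)
            h2.1 h2.2
        · rw [Program.act_cond_neg (mt (t1 (rep_next hp) (rep_pt hp)).1 h2)]
          -- Neither order of the half circles holds strictly at both ends of the range, so they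
          -- cross inside it.
          refine hnode e l r' hp fun g => ?_
          have F : Frame u (sgn x) (sgn (d s)) := ⟨I.ne, sgn_mul_self x, sgn_mul_self (d s)⟩
          obtain ⟨h3, X, h4, h5, h6, h7⟩ := exists_cross ((hz g).1.trans (hz g).2)
            (fun X k1 k2 => I.dom hm k1 k2 _ vp) (fun X k1 k2 => I.dom hm k1 k2 _ vn)
            (F.inj.ne ((hg g).ne e he ha)) h1 h2
          exact ⟨X, ha, h3, ⟨h4, h5⟩, h6, h7⟩
    · rw [Program.act_cond_pos (by simp only [Test.Holds, hact]; exact ha)]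
      have hpas := fun g => (hg g).passive e he ha
      cases hd : d s with
      | true =>
        simp only [if_true]
        exact h.moveL I hp fun g => by rw [hpas g, hd]; simp
      | false =>
        simp only [Bool.false_eq_true, if_false]
        exact h.moveR I hp fun g => by rw [hpas g, hd]

theorem setup_act (B : Basic r t u T σ) (s x d : Bool) :
    ((setup s x d).act σ).ptr = σ.ptr ∧
    (∀ i, i ≠ absR s → i ≠ hatXR s → i ≠ hatYR s → ((setup s x d).act σ).re i = σ.re i) ∧
    (σ.ptr (cur s) = .nil →
      (((setup s x d).act σ).re (hatXR s), ((setup s x d).act σ).re (hatYR s)) =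
        hat u (sgn x) (sgn d) (cand s σ)) ∧
    (∀ e l r', σ.ptr (cur s) = .node e l r' →
      (((setup s x d).act σ).re (hatXR s), ((setup s x d).act σ).re (hatYR s)) =
        hat u (sgn x) (sgn d) e.pt ∧
      ((setup s x d).act σ).re (absR s) = crossX (rad r u) (hat u (sgn x) (sgn d) e.pt).1
        (hat u (sgn x) (sgn d) e.pt).2 (hat u (sgn x) (sgn d) e.next).1
        (hat u (sgn x) (sgn d) e.next).2) := by
  unfold setup
  cases hp : σ.ptr (cur s) with
  | nil =>
    rw [Program.act_cond_pos (by simpa [Test.Holds, PtrExpr.eval] using hp)]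
    refine ⟨rfl, fun i h1 h2 h3 => ?_, fun _ => ?_, fun e l r' h => by simp at h⟩
    · simp [Program.act, h2, h3]
    · have h1 := hatXE_eval B (rep_cand s) x (sgn d)
      have h2 := hatYE_eval B (rep_cand s) (sgn x) d
      have h3 : (hatYE d (candE s)).eval ((Program.setReal (hatXR s) (hatXE x (candE s))).act σ) =
          (hatYE d (candE s)).eval σ := by
        cases s <;> simp [Program.act, hatYE, candE, RealExpr.eval, candX, candY, hatXR]
      have h4 : hatXR s ≠ hatYR s := by cases s <;> simp [hatXR, hatYR]
      simp only [Program.act] at h3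
      rw [h1, h2] at h3
      simp only [Program.act, Function.update_self, Function.update_of_ne h4, h1, h3]
  | node e l r' =>
    rw [Program.act_cond_neg (by simp [Test.Holds, PtrExpr.eval, hp])]
    refine ⟨rfl, fun i h1 h2 h3 => by simp [Program.act, h1, h2, h3], fun h => by simp at h, ?_⟩
    rintro e l r' ⟨⟩
    have h1 := hatXE_eval B (rep_pt hp) x (sgn d)
    have h2 := hatYE_eval B (rep_pt hp) (sgn x) d
    have h3 := hatXE_eval B (rep_next hp) x (sgn d)
    have h4 := hatYE_eval B (rep_next hp) (sgn x) d
    have k : ∀ (i : ℕ) (y : ℝ), 5 ≤ i → ((hatXE x (fieldE .pt s)).eval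
        { σ with re := Function.update σ.re i y } = (hatXE x (fieldE .pt s)).eval σ) := by
      intro i y hi
      simp [hatXE, fieldE, RealExpr.eval, PtrExpr.eval, show (1 : ℕ) ≠ i by omega,
        show (2 : ℕ) ≠ i by omega]
    have k' : ∀ (i j : ℕ) (y y' : ℝ), 5 ≤ i → 5 ≤ j → ((hatYE d (fieldE .pt s)).eval
        { σ with re := Function.update (Function.update σ.re i y) j y' } =
          (hatYE d (fieldE .pt s)).eval σ) := by
      intro i j y y' hi hj
      simp [hatYE, fieldE, RealExpr.eval, PtrExpr.eval, show (1 : ℕ) ≠ i by omega,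
        show (2 : ℕ) ≠ i by omega, show (1 : ℕ) ≠ j by omega, show (2 : ℕ) ≠ j by omega]
    have n1 : 5 ≤ absR s := by cases s <;> simp [absR]
    have n2 : 5 ≤ hatXR s := by cases s <;> simp [hatXR]
    have n3 : hatXR s ≠ hatYR s := by cases s <;> simp [hatXR, hatYR]
    have n4 : absR s ≠ hatXR s := by cases s <;> simp [absR, hatXR]
    have n5 : absR s ≠ hatYR s := by cases s <;> simp [absR, hatYR]
    simp only [Program.act, Function.update_self, Function.update_of_ne n3, Function.update_of_ne n4,
      Function.update_of_ne n5, k _ _ n1, k' _ _ _ _ n1 n2, crossE_eval B, h1, h2, h3, h4]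
    constructor <;> trivial

/-- The crossings of the current edges are in their registers. -/
structure Ready (r : ℝ) (u : Plane) (v : Bool → ℕ → Plane) (m : Bool → ℝ) (x : Bool)
    (d : Bool → Bool) (G : Prop) (X : Bool → ℝ) (P : Bool → Plane) (σ : State) : Prop where
  abs : ∀ s, σ.re (absR s) = X s
  hat : ∀ s, (σ.re (hatXR s), σ.re (hatYR s)) = hat u (sgn x) (sgn (d s)) (P s)
  nil : ∀ s, σ.ptr (cur s) = .nil → P s = cand s σ ∧ X s = X !s
  node : ∀ s e l r', σ.ptr (cur s) = .node e l r' →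
    P s = e.pt ∧ (G → Crossing r u m s x (d s) (v s 0) e (X s))
  some : σ.ptr (cur true) = .nil → σ.ptr (cur false) ≠ .nil

theorem exists_ready (B : Basic r t u T σ) (x : Bool) (d : Bool → Bool)
    (hsome : σ.ptr (cur true) = .nil → σ.ptr (cur false) ≠ .nil)
    (hnode : ∀ s e l r', σ.ptr (cur s) = .node e l r' →
      (G → ∃ X, Crossing r u m s x (d s) (v s 0) e X)) {σ' : State}
    (hσ' : σ' = (Program.seq (setup true x (d true)) (.seq (setup false x (d false)) sync)).act σ) :
    σ'.ptr = σ.ptr ∧ (∀ i < 34, σ'.re i = σ.re i) ∧ ∃ X P, Ready r u v m x d G X P σ' := by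
  obtain ⟨a1, a2, a3, a4⟩ := setup_act B true x (d true)
  obtain ⟨σ₁, hσ₁⟩ : ∃ σ₁, σ₁ = (setup true x (d true)).act σ := ⟨_, rfl⟩
  rw [← hσ₁] at a1 a2 a3 a4
  have B₁ : Basic r t u T σ₁ := B.keep (k := 34) (by norm_num)
    ⟨fun i hi => a2 i (by simp [absR]; omega) (by simp [hatXR]; omega) (by simp [hatYR]; omega),
      fun s => by rw [a1]⟩
  obtain ⟨b1, b2, b3, b4⟩ := setup_act B₁ false x (d false)
  obtain ⟨σ₂, hσ₂⟩ : ∃ σ₂, σ₂ = (setup false x (d false)).act σ₁ := ⟨_, rfl⟩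
  rw [← hσ₂] at b1 b2 b3 b4
  have hc : cand false σ₁ = cand false σ := by
    simp only [cand]
    rw [a2 _ (by simp [candX, absR]) (by simp [candX, hatXR]) (by simp [candX, hatYR]),
      a2 _ (by simp [candY, absR]) (by simp [candY, hatXR]) (by simp [candY, hatYR])]
  rw [a1, hc] at b3
  rw [a1] at b1 b4
  have hσ'' : σ' = sync.act σ₂ := by rw [hσ', hσ₂, hσ₁]; rfl
  have e1 : σ₂.re (absR true) = σ₁.re (absR true) :=
    b2 _ (by simp [absR]) (by simp [absR, hatXR]) (by simp [absR, hatYR])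
  have e2 : σ₂.re (hatXR true) = σ₁.re (hatXR true) :=
    b2 _ (by simp [absR, hatXR]) (by simp [hatXR]) (by simp [hatXR, hatYR])
  have e3 : σ₂.re (hatYR true) = σ₁.re (hatYR true) :=
    b2 _ (by simp [absR, hatYR]) (by simp [hatYR, hatXR]) (by simp [hatYR])
  have elow : ∀ i < 34, σ₂.re i = σ.re i := fun i hi => by
    rw [b2 i (by simp [absR]; omega) (by simp [hatXR]; omega) (by simp [hatYR]; omega),
      a2 i (by simp [absR]; omega) (by simp [hatXR]; omega) (by simp [hatYR]; omega)]
  have hsync : σ'.ptr = σ₂.ptr ∧ (∀ i, i ≠ absR true → i ≠ absR false → σ'.re i = σ₂.re i) ∧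
      (σ₂.ptr (cur true) = .nil → σ'.re (absR true) = σ₂.re (absR false) ∧
        σ'.re (absR false) = σ₂.re (absR false)) ∧
      (σ₂.ptr (cur true) ≠ .nil → σ₂.ptr (cur false) = .nil →
        σ'.re (absR true) = σ₂.re (absR true) ∧ σ'.re (absR false) = σ₂.re (absR true)) ∧
      (σ₂.ptr (cur true) ≠ .nil → σ₂.ptr (cur false) ≠ .nil →
        σ'.re (absR true) = σ₂.re (absR true) ∧ σ'.re (absR false) = σ₂.re (absR false)) := by
    rw [hσ'', sync]
    by_cases h1 : σ₂.ptr (cur true) = .nil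
    · rw [Program.act_cond_pos (by simpa [Test.Holds, PtrExpr.eval] using h1)]
      refine ⟨rfl, fun i hi hi' => ?_, fun _ => ?_, fun h => absurd h1 h, fun h => absurd h1 h⟩
      · simp [Program.act, hi]
      · simp [Program.act, RealExpr.eval, absR]
    · rw [Program.act_cond_neg (by simpa [Test.Holds, PtrExpr.eval] using h1)]
      by_cases h2 : σ₂.ptr (cur false) = .nil
      · rw [Program.act_cond_pos (by simpa [Test.Holds, PtrExpr.eval] using h2)]
        refine ⟨rfl, fun i hi hi' => ?_, fun h => absurd h h1, fun _ _ => ?_, fun _ h => absurd h2 h⟩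
        · simp [Program.act, hi']
        · simp [Program.act, RealExpr.eval, absR]
      · rw [Program.act_cond_neg (by simpa [Test.Holds, PtrExpr.eval] using h2)]
        exact ⟨rfl, fun _ _ _ => rfl, fun h => absurd h h1, fun _ h => absurd h h2,
          fun _ _ => ⟨rfl, rfl⟩⟩
  obtain ⟨s1, s2, s3, s4, s5⟩ := hsync
  rw [b1] at s1 s3 s4 s5
  have glow : ∀ i < 34, σ'.re i = σ.re i := fun i hi => by
    rw [s2 i (by simp [absR]; omega) (by simp [absR]; omega), elow i hi]
  have hcand : ∀ s, cand s σ' = cand s σ := fun s => by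
    simp only [cand]
    rw [glow _ (by cases s <;> simp [candX]), glow _ (by cases s <;> simp [candY])]
  have hT : (σ'.re (hatXR true), σ'.re (hatYR true)) = (σ₁.re (hatXR true), σ₁.re (hatYR true)) := by
    rw [s2 _ (by simp [hatXR, absR]) (by simp [hatXR, absR]),
      s2 _ (by simp [hatYR, absR]) (by simp [hatYR, absR]), e2, e3]
  have hF : (σ'.re (hatXR false), σ'.re (hatYR false)) =
      (σ₂.re (hatXR false), σ₂.re (hatYR false)) := by
    rw [s2 _ (by simp [hatXR, absR]) (by simp [hatXR, absR]),
      s2 _ (by simp [hatYR, absR]) (by simp [hatYR, absR])]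
  refine ⟨s1, glow, ?_⟩
  have val : ∀ {s e X}, Crossing r u m s x (d s) (v s 0) e X → X = crossX (rad r u)
      (CircularHull.hat u (sgn x) (sgn (d s)) e.pt).1 (CircularHull.hat u (sgn x) (sgn (d s)) e.pt).2
      (CircularHull.hat u (sgn x) (sgn (d s)) e.next).1
      (CircularHull.hat u (sgn x) (sgn (d s)) e.next).2 := fun h => h.val
  cases hp : σ.ptr (cur true) with
  | nil =>
    obtain ⟨h1, h2⟩ := s3 hp
    cases hp' : σ.ptr (cur false) with
    | nil => exact absurd hp' (hsome hp)
    | node f l' r'' =>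
      obtain ⟨h3, h4⟩ := b4 f l' r'' hp'
      refine ⟨fun _ => σ₂.re (absR false), fun s => if s then cand true σ else f.pt, ?_, ?_, ?_, ?_, ?_⟩
      · intro s; cases s <;> assumption
      · intro s; cases s
        · rw [hF]; simpa using h3
        · rw [hT]; simpa using a3 hp
      · intro s hs
        cases s
        · rw [s1, hp'] at hs; simp at hs
        · simp [hcand]
      · intro s e l r' hs
        cases s
        · rw [s1, hp'] at hs
          cases hs
          refine ⟨by simp, fun g => ?_⟩
          obtain ⟨X, hX⟩ := hnode false f l' r'' hp' g
          rw [h4, ← val hX]; exact hX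
        · rw [s1, hp] at hs; simp at hs
      · rw [s1, hp']; simp
  | node e l r' =>
    obtain ⟨h3, h4⟩ := a4 e l r' hp
    cases hp' : σ.ptr (cur false) with
    | nil =>
      obtain ⟨h1, h2⟩ := s4 (by simp [hp]) hp'
      refine ⟨fun _ => σ₂.re (absR true), fun s => if s then e.pt else cand false σ, ?_, ?_, ?_, ?_, ?_⟩
      · intro s; cases s <;> assumption
      · intro s; cases s
        · rw [hF]; simpa using b3 hp'
        · rw [hT]; simpa using h3
      · intro s hs
        cases s
        · simp [hcand]
        · rw [s1, hp] at hs; simp at hs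
      · intro s e' l r' hs
        cases s
        · rw [s1, hp'] at hs; simp at hs
        · rw [s1, hp] at hs
          cases hs
          refine ⟨by simp, fun g => ?_⟩
          obtain ⟨X, hX⟩ := hnode true _ _ _ hp g
          rw [e1, h4, ← val hX]; exact hX
      · rw [s1, hp]; simp
    | node f l' r'' =>
      obtain ⟨h5, h6⟩ := b4 f l' r'' hp'
      obtain ⟨h1, h2⟩ := s5 (by simp [hp]) (by simp [hp'])
      refine ⟨fun s => σ₂.re (absR s), fun s => if s then e.pt else f.pt, ?_, ?_, ?_, ?_, ?_⟩
      · intro s; cases s <;> assumption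
      · intro s; cases s
        · rw [hF]; simpa using h5
        · rw [hT]; simpa using h3
      · intro s hs
        cases s
        · rw [s1, hp'] at hs; simp at hs
        · rw [s1, hp] at hs; simp at hs
      · intro s e' l r' hs
        cases s
        · rw [s1, hp'] at hs
          cases hs
          refine ⟨by simp, fun g => ?_⟩
          obtain ⟨X, hX⟩ := hnode false _ _ _ hp' g
          rw [h6, ← val hX]; exact hX
        · rw [s1, hp] at hs
          cases hs
          refine ⟨by simp, fun g => ?_⟩
          obtain ⟨X, hX⟩ := hnode true _ _ _ hp g
          rw [e1, h4, ← val hX]; exact hX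
      · rw [s1, hp]; simp

end

/-! ### Correctness of the simultaneous search -/

section

variable {r t : ℝ} {u : Plane} {Q : Bool → Finset Plane} {T : Bool → HullTree} {n : Bool → ℕ}
  {v : Bool → ℕ → Plane} {m : Bool → ℝ} {x : Bool} {d : Bool → Bool} {w : Bool → Plane} {z : ℝ}
  {G : Prop} {A : Bool → VertexRecord → Prop} {σ₀ σ : State} {s : Bool} {e : VertexRecord}
  {l r' : HullTree} {X : Bool → ℝ} {P : Bool → Plane}

theorem SearchInv.geMove (h : SearchInv r Q T G A w σ₀ σ) (I : Input r t u Q T n v)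
    (hm : Extreme r u Q m) (B : Basic r t u T σ)
    (hg : G → Target r t u Q m x d w z ∧ ∀ s, Guide r u s x (d s) (T s) (v s 0) (w s) z (A s))
    (hp : σ.ptr (cur s) = .node e l r') {X : ℝ}
    (hX : G → Crossing r u m s x (d s) (v s 0) e X ∧ X ≤ z) :
    SearchInv r Q T G A w σ₀ ((geMove s x).act σ) ∧ size ((CircularHull.geMove s x).act σ) < size σ := by
  have he := h.mem hp
  have key : G → (A s e ↔ (hat u (sgn x) (sgn (d s)) e.next).1 <
      (hat u (sgn x) (sgn (d s)) e.pt).1) := fun g => by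
    obtain ⟨hc, hXz⟩ := hX g
    exact (hg g).1.after_iff_of_le I hm ((hg g).2 s) hc.mem.1 hc.mem.2 he (I.isVertex_pt he)
      (I.isVertex_next he) hc.act hc.ne hc.eq hXz
  have ht : (ltT (hatXE x (fieldE .next s)) (hatXE x (fieldE .pt s))).Holds σ ↔
      (hat u (sgn x) (sgn (d s)) e.next).1 < (hat u (sgn x) (sgn (d s)) e.pt).1 := by
    rw [ltT_holds, hatXE_eval B (rep_next hp), hatXE_eval B (rep_pt hp)]
  unfold CircularHull.geMove
  by_cases hlt : (hat u (sgn x) (sgn (d s)) e.next).1 < (hat u (sgn x) (sgn (d s)) e.pt).1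
  · rw [Program.act_cond_pos (ht.2 hlt)]
    exact h.moveR I hp fun g => (key g).2 hlt
  · rw [Program.act_cond_neg (mt ht.1 hlt)]
    exact h.moveL I hp fun g => mt (key g).1 hlt

theorem SearchInv.ltMove (h : SearchInv r Q T G A w σ₀ σ) (I : Input r t u Q T n v)
    (hm : Extreme r u Q m) (B : Basic r t u T σ)
    (hg : G → Target r t u Q m x d w z ∧ ∀ s, Guide r u s x (d s) (T s) (v s 0) (w s) z (A s))
    (hp : σ.ptr (cur s) = .node e l r') {X : ℝ}
    (hX : G → Crossing r u m s x (d s) (v s 0) e X ∧ z < X) :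
    SearchInv r Q T G A w σ₀ ((ltMove s x).act σ) ∧ size ((CircularHull.ltMove s x).act σ) < size σ := by
  have he := h.mem hp
  have key : G → (A s e ↔ (hat u (sgn x) (sgn (d s)) e.pt).1 <
      (hat u (sgn x) (sgn (d s)) e.next).1) := fun g => by
    obtain ⟨hc, hXz⟩ := hX g
    exact (hg g).1.after_iff_of_lt I hm ((hg g).2 s) hc.mem.1 hc.mem.2 he (I.isVertex_pt he)
      (I.isVertex_next he) hc.act hc.ne hc.eq hXz
  have ht : (ltT (hatXE x (fieldE .pt s)) (hatXE x (fieldE .next s))).Holds σ ↔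
      (hat u (sgn x) (sgn (d s)) e.pt).1 < (hat u (sgn x) (sgn (d s)) e.next).1 := by
    rw [ltT_holds, hatXE_eval B (rep_next hp), hatXE_eval B (rep_pt hp)]
  unfold CircularHull.ltMove
  by_cases hlt : (hat u (sgn x) (sgn (d s)) e.pt).1 < (hat u (sgn x) (sgn (d s)) e.next).1
  · rw [Program.act_cond_pos (ht.2 hlt)]
    exact h.moveR I hp fun g => (key g).2 hlt
  · rw [Program.act_cond_neg (mt ht.1 hlt)]
    exact h.moveL I hp fun g => mt (key g).1 hlt

theorem Ready.not_nil (hR : Ready r u v m x d G X P σ) (h : σ.ptr (cur s) = .nil) :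
    ∃ e l r', σ.ptr (cur !s) = .node e l r' := by
  cases hp : σ.ptr (cur !s) with
  | nil =>
    have := hR.some
    cases s <;> simp_all
  | node e l r' => exact ⟨e, l, r', rfl⟩

theorem SearchInv.ge (h : SearchInv r Q T G A w σ₀ σ) (I : Input r t u Q T n v)
    (hm : Extreme r u Q m) (B : Basic r t u T σ)
    (hg : G → Target r t u Q m x d w z ∧ ∀ s, Guide r u s x (d s) (T s) (v s 0) (w s) z (A s))
    (hR : Ready r u v m x d G X P σ) (hX : G → X s ≤ z) :
    SearchInv r Q T G A w σ₀ ((ge s x).act σ) ∧ size ((CircularHull.ge s x).act σ) < size σ := by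
  unfold CircularHull.ge
  cases hp : σ.ptr (cur s) with
  | nil =>
    rw [Program.act_cond_pos (by simpa [Test.Holds, PtrExpr.eval] using hp)]
    obtain ⟨e, l, r', hp'⟩ := hR.not_nil hp
    exact h.geMove I hm B hg hp' fun g =>
      ⟨(hR.node _ e l r' hp').2 g, by rw [← (hR.nil s hp).2]; exact hX g⟩
  | node e l r' =>
    rw [Program.act_cond_neg (by simp [Test.Holds, PtrExpr.eval, hp])]
    exact h.geMove I hm B hg hp fun g => ⟨(hR.node _ e l r' hp).2 g, hX g⟩

theorem SearchInv.lt (h : SearchInv r Q T G A w σ₀ σ) (I : Input r t u Q T n v)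
    (hm : Extreme r u Q m) (B : Basic r t u T σ)
    (hg : G → Target r t u Q m x d w z ∧ ∀ s, Guide r u s x (d s) (T s) (v s 0) (w s) z (A s))
    (hR : Ready r u v m x d G X P σ) (hX : G → z < X s) :
    SearchInv r Q T G A w σ₀ ((lt s x).act σ) ∧ size ((CircularHull.lt s x).act σ) < size σ := by
  unfold CircularHull.lt
  cases hp : σ.ptr (cur s) with
  | nil =>
    rw [Program.act_cond_pos (by simpa [Test.Holds, PtrExpr.eval] using hp)]
    obtain ⟨e, l, r', hp'⟩ := hR.not_nil hp
    exact h.ltMove I hm B hg hp' fun g =>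
      ⟨(hR.node _ e l r' hp').2 g, by rw [← (hR.nil s hp).2]; exact hX g⟩
  | node e l r' =>
    rw [Program.act_cond_neg (by simp [Test.Holds, PtrExpr.eval, hp])]
    exact h.ltMove I hm B hg hp fun g => ⟨(hR.node _ e l r' hp).2 g, hX g⟩

theorem SearchInv.vertex_ready (h : SearchInv r Q T G A w σ₀ σ) (I : Input r t u Q T n v)
    (hR : Ready r u v m x d G X P σ) (s : Bool) : IsVertex r ↑(Q s) (P s) := by
  cases hp : σ.ptr (cur s) with
  | nil => rw [(hR.nil s hp).1]; exact h.vertex s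
  | node e l r' =>
    rw [(hR.node s e l r' hp).1]
    exact I.isVertex_pt (h.mem hp)

theorem Ready.mem (hR : Ready r u v m x d G X P σ) (g : G) (s : Bool) :
    loX (rad r u) m x ≤ X s ∧ X s ≤ hiX (rad r u) m x := by
  cases hp : σ.ptr (cur s) with
  | nil =>
    obtain ⟨e, l, r', hp'⟩ := hR.not_nil hp
    rw [(hR.nil s hp).2]
    exact ((hR.node _ e l r' hp').2 g).mem
  | node e l r' => exact ((hR.node s e l r' hp).2 g).mem

/-- If the search is unfinished, the crossing of an active edge is on the envelope, so `pt` is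
highest there. If it is finished, the candidate already is the target. -/
theorem SearchInv.low_le (h : SearchInv r Q T G A w σ₀ σ) (I : Input r t u Q T n v)
    (hm : Extreme r u Q m) (hg : Target r t u Q m x d w z)
    (hR : Ready r u v m x d G X P σ) (g : G) (s : Bool) :
    low r u x (d s) (w s) (X s) ≤ low r u x (d s) (P s) (X s) := by
  cases hp : σ.ptr (cur s) with
  | nil =>
    have := h.find g s
    rw [hp] at this
    rw [(hR.nil s hp).1, ← this]
    rfl
  | node e l r' =>
    rw [(hR.node s e l r' hp).1]
    have hc := (hR.node s e l r' hp).2 g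
    exact I.low_le_of_eq hm hc.mem.1 hc.mem.2 (h.mem hp) hc.act hc.eq (hg.vertex s)

theorem Ready.lo_eval (hR : Ready r u v m x d G X P σ) (B : Basic r t u T σ) (s s' : Bool) :
    (loE (.reg (absR s)) (.reg (hatXR s')) (.reg (hatYR s'))).eval σ = low r u x (d s') (P s') (X s) := by
  rw [loE_eval B]
  simp only [RealExpr.eval, hR.abs, hR.hat, low]

theorem SearchInv.decideMeet (h : SearchInv r Q T G A w σ₀ σ) (I : Input r t u Q T n v)
    (hm : Extreme r u Q m) (B : Basic r t u T σ)
    (hg : G → Target r t u Q m x d w z ∧ ∀ s, Guide r u s x (d s) (T s) (v s 0) (w s) z (A s))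
    (hR : Ready r u v m x d G X P σ) (hd : d true = d false) :
    SearchInv r Q T G A w σ₀ ((decideMeet x).act σ) ∧
      size ((CircularHull.decideMeet x).act σ) < size σ := by
  have rules := fun g => (hg g).1.meet_rules I hm hd (hR.mem g) (h.vertex_ready I hR)
    (h.low_le I hm (hg g).1 hR g) (H := fun s => (heightE s).eval σ) (fun s => by
      rw [← hR.lo_eval B s s]
      simp only [heightE, RealExpr.eval, psiE_eval B, hR.abs, B.line])
  have hle : leT.Holds σ ↔ X true ≤ X false := by simp only [leT, Test.Holds, RealExpr.eval, hR.abs]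
  unfold CircularHull.decideMeet
  by_cases h1 : X true ≤ X false
  · rw [Program.act_cond_pos (hle.2 h1)]
    by_cases h2 : (heightE true).eval σ ≤ (heightE false).eval σ
    · rw [Program.act_cond_pos (by exact h2)]
      exact h.ge I hm B hg hR fun g => (rules g).1 h1 h2
    · rw [Program.act_cond_neg (by exact h2)]
      exact h.lt I hm B hg hR fun g => (rules g).2.1 h1 h2
  · rw [Program.act_cond_neg (mt hle.1 h1)]
    by_cases h2 : (heightE false).eval σ ≤ (heightE true).eval σ
    · rw [Program.act_cond_pos (by exact h2)]
      exact h.lt I hm B hg hR fun g => (rules g).2.2.1 h1 h2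
    · rw [Program.act_cond_neg (by exact h2)]
      exact h.ge I hm B hg hR fun g => (rules g).2.2.2 h1 h2

theorem SearchInv.decideOpposite (h : SearchInv r Q T G A w σ₀ σ) (I : Input r t u Q T n v)
    (hm : Extreme r u Q m) (B : Basic r t u T σ)
    (hg : G → Target r t u Q m x d w z ∧ ∀ s, Guide r u s x (d s) (T s) (v s 0) (w s) z (A s))
    (hR : Ready r u v m x d G X P σ) (hd : d true ≠ d false) :
    SearchInv r Q T G A w σ₀ ((decideOpposite x).act σ) ∧
      size ((CircularHull.decideOpposite x).act σ) < size σ := by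
  have hx : ∀ s, σ.re (hatXR s) = (hat u (sgn x) (sgn (d s)) (P s)).1 := fun s =>
    congrArg Prod.fst (hR.hat s)
  have rules := fun g => (hg g).1.opposite_rules I hm hd (hR.mem g) (h.vertex_ready I hR)
    (h.low_le I hm (hg g).1 hR g) (F := fun s => (sumE s).eval σ)
    (M := σ.re (hatXR true) + σ.re (hatXR false)) (fun s => by
      rw [← hR.lo_eval B s true, ← hR.lo_eval B s false]; rfl) (by rw [hx, hx])
  have hle : leT.Holds σ ↔ X true ≤ X false := by simp only [leT, Test.Holds, RealExpr.eval, hR.abs]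
  have hpos : ∀ s, (ltT (.const 0) (sumE s)).Holds σ ↔ 0 < (sumE s).eval σ := fun s => by
    rw [ltT_holds]; simp [RealExpr.eval]
  have hmid : ∀ s, (midT s).Holds σ ↔ X s + X s < σ.re (hatXR true) + σ.re (hatXR false) := fun s => by
    rw [midT, ltT_holds]; simp only [RealExpr.eval, hR.abs]
  unfold CircularHull.decideOpposite
  by_cases h1 : 0 < (sumE false).eval σ
  · rw [Program.act_cond_pos ((hpos _).2 h1)]
    by_cases h2 : X false + X false < σ.re (hatXR true) + σ.re (hatXR false)
    · rw [Program.act_cond_pos ((hmid _).2 h2)]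
      exact h.ge I hm B hg hR fun g => (rules g).1 h1 h2
    · rw [Program.act_cond_neg (mt (hmid _).1 h2)]
      exact h.lt I hm B hg hR fun g => (rules g).2.1 h1 h2
  · rw [Program.act_cond_neg (mt (hpos _).1 h1)]
    by_cases h2 : 0 < (sumE true).eval σ
    · rw [Program.act_cond_pos ((hpos _).2 h2)]
      by_cases h3 : X true + X true < σ.re (hatXR true) + σ.re (hatXR false)
      · rw [Program.act_cond_pos ((hmid _).2 h3)]
        exact h.ge I hm B hg hR fun g => (rules g).2.2.1 h2 h3
      · rw [Program.act_cond_neg (mt (hmid _).1 h3)]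
        exact h.lt I hm B hg hR fun g => (rules g).2.2.2.1 h2 h3
    · rw [Program.act_cond_neg (mt (hpos _).1 h2)]
      by_cases h3 : X true ≤ X false
      · rw [Program.act_cond_pos (hle.2 h3)]
        exact h.ge I hm B hg hR fun g => (rules g).2.2.2.2.1 h1 h2 h3
      · rw [Program.act_cond_neg (mt hle.1 h3)]
        exact h.ge I hm B hg hR fun g => (rules g).2.2.2.2.2 h1 h2 h3

theorem SearchInv.crossStep (h : SearchInv r Q T G A w σ₀ σ) (I : Input r t u Q T n v)
    (hm : Extreme r u Q m) (E : Env r t u T v m σ₀)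
    (hg : G → Target r t u Q m x d w z ∧ ∀ s, Guide r u s x (d s) (T s) (v s 0) (w s) z (A s))
    (hsome : σ.ptr (cur true) = .nil → σ.ptr (cur false) ≠ .nil)
    (hnode : ∀ s e l r', σ.ptr (cur s) = .node e l r' →
      (G → ∃ X, Crossing r u m s x (d s) (v s 0) e X)) :
    SearchInv r Q T G A w σ₀ ((crossStep x d).act σ) ∧
      size ((CircularHull.crossStep x d).act σ) < size σ := by
  obtain ⟨σ', hσ'⟩ : ∃ σ', σ' = (Program.seq (setup true x (d true))
    (.seq (setup false x (d false)) sync)).act σ := ⟨_, rfl⟩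
  obtain ⟨h1, h2, X, P, hR⟩ := exists_ready (h.env E).toBasic x d hsome hnode hσ'
  have hcand : ∀ s, cand s σ' = cand s σ := fun s => by
    simp only [cand]
    rw [h2 _ (by cases s <;> simp [candX]), h2 _ (by cases s <;> simp [candY])]
  have h' : SearchInv r Q T G A w σ₀ σ' := by
    refine ⟨h.keep.trans ⟨fun i hi => h2 i (by omega), fun s => by rw [h1]⟩, ?_, ?_, ?_⟩
    · rw [h1]; exact h.sub
    · intro s; rw [hcand]; exact h.vertex s
    · intro g s; rw [hcand, h1]; exact h.find g s
  have hs : size σ' = size σ := by unfold size; rw [h1]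
  have B := (h'.env E).toBasic
  unfold CircularHull.crossStep
  rw [show ∀ P₁ P₂ : Program, (Program.seq P₁ P₂).act σ = P₂.act (P₁.act σ) from fun _ _ => rfl,
    ← hσ', ← hs]
  split_ifs with hd
  · exact h'.decideMeet I hm B hg hR hd
  · exact h'.decideOpposite I hm B hg hR hd

/-- Every branch moves one of the cursors to a child, so the sum of the two heights drops. The
crossing step is reached only if each unfinished tree has a crossing in the range. -/
theorem SearchInv.step (h : SearchInv r Q T G A w σ₀ σ) (I : Input r t u Q T n v)
    (hm : Extreme r u Q m) (E : Env r t u T v m σ₀)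
    (hg : G → Target r t u Q m x d w z ∧ ∀ s, Guide r u s x (d s) (T s) (v s 0) (w s) z (A s))
    (hsome : σ.ptr (cur true) = .nil → σ.ptr (cur false) ≠ .nil) :
    SearchInv r Q T G A w σ₀ ((CircularHull.freeStep true x (d true)
        (CircularHull.freeStep false x (d false) (CircularHull.crossStep x d))).act σ) ∧
      size ((CircularHull.freeStep true x (d true)
        (CircularHull.freeStep false x (d false) (CircularHull.crossStep x d))).act σ) < size σ := by
  have key : (∀ e l r', σ.ptr (cur true) = .node e l r' →
      (G → ∃ X, Crossing r u m true x (d true) (v true 0) e X)) →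
      SearchInv r Q T G A w σ₀ ((CircularHull.freeStep false x (d false)
        (CircularHull.crossStep x d)).act σ) ∧
      size ((CircularHull.freeStep false x (d false) (CircularHull.crossStep x d)).act σ) < size σ := by
    intro h1
    refine h.freeStep I hm E (fun g => (hg g).1.mem) (fun g => (hg g).2 false) (fun h2 => ?_)
      fun e l r' h2 h3 => ?_
    · refine h.crossStep I hm E hg hsome fun s e l r' h3 => ?_
      cases s
      · rw [h2] at h3; simp at h3
      · exact h1 e l r' h3
    · refine h.crossStep I hm E hg hsome fun s e' l r' h4 => ?_
      cases s
      · rw [h2] at h4; cases h4; exact h3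
      · exact h1 e' l r' h4
  refine h.freeStep I hm E (fun g => (hg g).1.mem) (fun g => (hg g).2 true) (fun h2 => ?_)
    fun e l r' h2 h3 => ?_
  · exact key fun e l r' h3 => by rw [h2] at h3; simp at h3
  · refine key fun e' l r' h4 => ?_
    rw [h2] at h4; cases h4; exact h3

theorem start_act (s : Bool) (σ : State) : Keep 30 σ ((start s).act σ) ∧
    ((start s).act σ).ptr (cur s) = σ.ptr (root s) ∧
    (∀ e l r', σ.ptr (root s) = .node e l r' → cand s ((start s).act σ) = e.pt) ∧
    ((start s).act σ).ptr (cur !s) = σ.ptr (cur !s) ∧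
    cand (!s) ((start s).act σ) = cand (!s) σ := by
  refine ⟨⟨fun i hi => ?_, fun s' => ?_⟩, ?_, ?_, ?_, ?_⟩
  · cases s <;> simp only [start, Program.act, candX, candY, if_true, Bool.false_eq_true, if_false] <;>
      rw [Function.update_of_ne (by omega), Function.update_of_ne (by omega)]
  · cases s <;> cases s' <;> simp [start, Program.act, cur, root]
  · simp [start, Program.act, PtrExpr.eval]
  · intro e l r' h
    rw [← plane_eta e.pt]
    cases s <;> simp [start, cand, Program.act, fieldE, RealExpr.eval, PtrExpr.eval, cur, root,
      readCoord, candX, candY] at h ⊢ <;> simp [h]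
  · cases s <;> simp [start, Program.act, cur]
  · cases s <;> simp [start, cand, Program.act, candX, candY]

theorem crossStep_loopFree (x : Bool) (d : Bool → Bool) : (crossStep x d).LoopFree := by
  unfold crossStep
  split_ifs <;> cases x <;> simp [setup, sync, decideMeet, decideOpposite, ge, lt, geMove, ltMove,
    moveR, moveL, moveTo, Program.LoopFree]

theorem freeStep_loopFree (s x d : Bool) {P : Program} (h : P.LoopFree) :
    (freeStep s x d P).LoopFree := by
  cases d <;> simp [freeStep, moveR, moveL, moveTo, Program.LoopFree, h]

/-- The simultaneous search finds the target, if there is one. -/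
theorem Ensures.double (I : Input r t u Q T n v) (hm : Extreme r u Q m) (E : Env r t u T v m σ)
    {h : ℕ} (hh : (T true).height + (T false).height ≤ h) (x : Bool) (d : Bool → Bool)
    (w : Bool → Plane) (z : ℝ) :
    Ensures h (double x d) σ fun σ' => Keep 30 σ σ' ∧ (∀ s, IsVertex r ↑(Q s) (cand s σ')) ∧
      (Target r t u Q m x d w z → ∀ s, cand s σ' = w s) := by
  classical
  -- Guides exist only for an actual target; otherwise any predicates do, since the invariant then
  -- says nothing about them.
  obtain ⟨A, hA⟩ : ∃ A : Bool → VertexRecord → Prop, Target r t u Q m x d w z →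
      ∀ s, Guide r u s x (d s) (T s) (v s 0) (w s) z (A s) := by
    by_cases hT : Target r t u Q m x d w z
    · choose A hA using hT.exists_guide I hm
      exact ⟨A, fun _ => hA⟩
    · exact ⟨fun _ _ => True, fun h => absurd h hT⟩
  obtain ⟨k1, p1, c1, -, -⟩ := start_act true σ
  obtain ⟨σ₁, hσ₁⟩ : ∃ σ₁, σ₁ = (start true).act σ := ⟨_, rfl⟩
  rw [← hσ₁] at k1 p1 c1
  obtain ⟨k2, p2, c2, p3, c3⟩ := start_act false σ₁
  obtain ⟨σ₂, hσ₂⟩ : ∃ σ₂, σ₂ = (start false).act σ₁ := ⟨_, rfl⟩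
  rw [← hσ₂] at k2 p2 c2 p3 c3
  have hT1 := (k1.2 false).trans (E.root false)
  have hnode : ∀ s, ∃ e l r', T s = .node e l r' := fun s => by
    cases hT : T s with
    | nil =>
      have h1 := (I.ring s).len
      have h2 := (I.ring s).pos
      rw [hT] at h1
      simp only [inorder, List.length_nil] at h1
      omega
    | node e l r' => exact ⟨e, l, r', rfl⟩
  have hp : ∀ s, σ₂.ptr (cur s) = T s := by
    intro s; cases s
    · rw [p2, hT1]
    · simp only [Bool.not_false] at p3
      rw [p3, p1, E.root]
  have hc : ∀ s, IsVertex r ↑(Q s) (cand s σ₂) := by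
    intro s
    obtain ⟨e, l, r', he⟩ := hnode s
    have : cand s σ₂ = e.pt := by
      cases s
      · exact c2 e l r' (by rw [hT1, he])
      · simp only [Bool.not_false] at c3
        rw [c3]; exact c1 e l r' (by rw [E.root, he])
    rw [this]
    exact I.isVertex_pt (by rw [he]; simp [inorder])
  have hinv : SearchInv r Q T (Target r t u Q m x d w z) A w σ σ₂ :=
    ⟨k1.trans k2, fun s => by rw [hp]; exact fun _ h => h, hc,
      fun g s => by rw [hp]; exact (hA g s).find_eq _⟩
  refine (Ensures.of_act (P := .seq (start true) (start false)) (Q := fun σ' => σ' = σ₂)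
    (by simp [start, Program.LoopFree]) (by rw [hσ₂, hσ₁]; rfl)).seq ?_
  rintro _ rfl
  refine (Ensures.loop (h := h) (freeStep_loopFree true x _ (freeStep_loopFree false x _
    (crossStep_loopFree x d))) (SearchInv r Q T (Target r t u Q m x d w z) A w σ) size ?_ hinv
    (by unfold size; rw [hp, hp]; exact hh)).mono ?_
  · intro σ' h1 h2
    refine h1.step I hm E (fun g => ⟨g, hA g⟩) fun h3 h4 => h2 ?_
    exact ⟨h3, h4⟩
  · rintro σ' ⟨h1, h2⟩
    simp only [Test.Holds, PtrExpr.eval, not_not] at h2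
    refine ⟨h1.keep, h1.vertex, fun g s => ?_⟩
    have h3 := h1.find g s
    have h4 : σ'.ptr (cur s) = .nil := by
      cases s
      · exact h2.2
      · exact h2.1
    rw [h4] at h3
    exact h3

end

/-! ### Tangents are targets -/

/-- The midpoint of `p` and `b` is not to the right of the center, so going counterclockwise from
`b` on the upper half over the left to `p` on the lower half takes at most a half turn. -/
theorem cross_nonneg_of_lower_upper {p₁ p₂ b₁ b₂ ρ : ℝ} (hp : p₁ ^ 2 + p₂ ^ 2 = ρ)
    (hb : b₁ ^ 2 + b₂ ^ 2 = ρ) (h1 : p₁ ≤ b₁) (h2 : p₁ + b₁ ≤ 0) (h3 : p₂ ≤ 0) (h4 : 0 ≤ b₂) :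
    0 ≤ b₁ * p₂ - b₂ * p₁ := by
  have h5 : -p₂ ≤ b₂ := by
    apply abs_le_of_sq_le_sq' _ h4 |>.2 |>.trans' (le_refl _)
    nlinarith
  rcases le_total 0 b₁ with h | h
  · nlinarith [mul_nonneg h (by linarith : 0 ≤ p₂ + b₂), mul_nonneg h4 (by linarith : 0 ≤ -(p₁ + b₁))]
  · nlinarith [mul_nonneg (neg_nonneg.2 h) (neg_nonneg.2 h3),
      mul_nonneg h4 (by linarith : 0 ≤ -p₁)]

/-- The orientation of an upper tangent with its left point on the lower half puts the midpoint to
the left of the center. This supplies the midpoint condition in `Target`. -/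
theorem add_nonpos_of_cross_nonpos {a₁ a₂ b₁ b₂ ρ : ℝ} (ha : a₁ ^ 2 + a₂ ^ 2 = ρ)
    (hb : b₁ ^ 2 + b₂ ^ 2 = ρ) (h1 : a₁ < b₁) (h2 : a₂ < 0) (h3 : 0 ≤ b₂)
    (h : a₁ * b₂ - a₂ * b₁ ≤ 0) : a₁ + b₁ ≤ 0 := by
  by_contra hcon
  push Not at hcon
  have h4 : b₂ < -a₂ := by
    apply lt_of_pow_lt_pow_left₀ 2 (by linarith)
    nlinarith [mul_pos hcon (sub_pos.2 h1)]
  have h5 : 0 < b₁ := by linarith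
  have h6 := mul_lt_mul_of_pos_right h4 h5
  rcases le_total 0 a₁ with h7 | h7
  · nlinarith [mul_nonneg h7 h3, mul_pos (neg_pos.2 h2) h5]
  · nlinarith [mul_nonneg h3 hcon.le]

/-- On the lower half, left to right is counterclockwise, so an upper tangent cannot have both
points there. -/
theorem cross_pos_of_lower {a₁ a₂ b₁ b₂ ρ : ℝ} (ha : a₁ ^ 2 + a₂ ^ 2 = ρ)
    (hb : b₁ ^ 2 + b₂ ^ 2 = ρ) (h1 : a₁ < b₁) (h2 : a₂ < 0) (h3 : b₂ < 0) :
    0 < a₁ * b₂ - a₂ * b₁ := by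
  rcases le_total 0 a₁ with h | h
  · have : -b₂ < -a₂ := by
      apply lt_of_pow_lt_pow_left₀ 2 (by linarith)
      nlinarith
    nlinarith [mul_pos (neg_pos.2 h3) (sub_pos.2 h1), mul_pos (sub_pos.2 this) (h.trans_lt h1)]
  · rcases le_total 0 b₁ with h' | h'
    · rcases eq_or_lt_of_le h' with h'' | h''
      · nlinarith [mul_pos (neg_pos.2 h3) (by linarith : 0 < -a₁)]
      · nlinarith [mul_nonneg (neg_pos.2 h3).le (neg_nonneg.2 h), mul_pos (neg_pos.2 h2) h'']
    · have : -a₂ ≤ -b₂ := by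
        apply le_of_lt
        apply lt_of_pow_lt_pow_left₀ 2 (by linarith)
        nlinarith
      nlinarith [mul_pos (neg_pos.2 h2) (sub_pos.2 h1), mul_nonneg (sub_nonneg.2 this) (neg_nonneg.2 h)]

/-- Three points of a circle in general position are not on its upper half. -/
theorem GenPos.not_upper {ρ : ℝ} (hρ : 0 < ρ) {S : Set (ℝ × ℝ)} (h : GenPos ρ S)
    {p q s c : ℝ × ℝ} (hp : p ∈ S) (hq : q ∈ S) (hs : s ∈ S) (hpq : p ≠ q) (hqs : q ≠ s)
    (hps : p ≠ s) (hpc : sq p c = ρ ^ 2) (hqc : sq q c = ρ ^ 2) (hsc : sq s c = ρ ^ 2)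
    (hp2 : c.2 ≤ p.2) (hq2 : c.2 ≤ q.2) (hs2 : c.2 ≤ s.2) : False := by
  have o : ∀ a b : ℝ × ℝ, sq a c = ρ ^ 2 → sq b c = ρ ^ 2 → c.2 ≤ a.2 → c.2 ≤ b.2 → b.1 ≤ a.1 →
      0 ≤ orient c a b := fun a b ha hb ha2 hb2 hab =>
    orient_nonneg_of_lo_eq (X := c.1) (Y := c.2) (abs_sub_le_of_sq_le hρ.le ha.le)
      (abs_sub_le_of_sq_le hρ.le hb.le) (lo_eq_of_sq_eq ha ha2) (lo_eq_of_sq_eq hb hb2) hab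
  have sorted : ∀ a b e : ℝ × ℝ, a ∈ S → b ∈ S → e ∈ S → a ≠ b → b ≠ e → a ≠ e → sq a c = ρ ^ 2 →
      sq b c = ρ ^ 2 → sq e c = ρ ^ 2 → c.2 ≤ a.2 → c.2 ≤ b.2 → c.2 ≤ e.2 → b.1 ≤ a.1 →
      e.1 ≤ b.1 → False := fun a b e ha hb he hab hbe hae hac hbc hec ha2 hb2 he2 h1 h2 =>
    h.not_half hρ ha hb he hab hbe hae hac hbc hec
      ⟨o a b hac hbc ha2 hb2 h1, o b e hbc hec hb2 he2 h2, o a e hac hec ha2 he2 (h2.trans h1)⟩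
  rcases le_total p.1 q.1 with h1 | h1 <;> rcases le_total q.1 s.1 with h2 | h2 <;>
    rcases le_total p.1 s.1 with h3 | h3
  · exact sorted s q p hs hq hp hqs.symm hpq.symm hps.symm hsc hqc hpc hs2 hq2 hp2 h2 h1
  · exact sorted s q p hs hq hp hqs.symm hpq.symm hps.symm hsc hqc hpc hs2 hq2 hp2 h2 h1
  · exact sorted q s p hq hs hp hqs hps.symm hpq.symm hqc hsc hpc hq2 hs2 hp2 h2 h3
  · exact sorted q p s hq hp hs hpq.symm hps hqs hqc hpc hsc hq2 hp2 hs2 h1 h3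
  · exact sorted s p q hs hp hq hps.symm hpq hqs.symm hsc hpc hqc hs2 hp2 hq2 h3 h1
  · exact sorted p s q hp hs hq hps hqs.symm hpq hpc hsc hqc hp2 hs2 hq2 h3 h2
  · exact sorted p q s hp hq hs hpq hqs hps hpc hqc hsc hp2 hq2 hs2 h1 h2
  · exact sorted p q s hp hq hs hpq hqs hps hpc hqc hsc hp2 hq2 hs2 h1 h2

/-- If the tangent points are on different halves of the circle, then any other point on it is to
the right of the tangent point on the same half. -/
theorem GenPos.lt_of_lower {ρ : ℝ} (hρ : 0 < ρ) {S : Set (ℝ × ℝ)} (h : GenPos ρ S)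
    {a b p c : ℝ × ℝ} (ha : a ∈ S) (hb : b ∈ S) (hp : p ∈ S) (hab : a ≠ b) (hpa : p ≠ a)
    (hpb : p ≠ b) (hac : sq a c = ρ ^ 2) (hbc : sq b c = ρ ^ 2) (hpc : sq p c = ρ ^ 2)
    (hba : 0 ≤ orient c b a) (hmid : a.1 + b.1 ≤ 2 * c.1) (hlt : a.1 < b.1) (ha2 : a.2 ≤ c.2)
    (hb2 : c.2 ≤ b.2) (hp2 : p.2 ≤ c.2) : a.1 < p.1 := by
  by_contra hcon
  push Not at hcon
  -- Otherwise `b`, `p`, `a` would follow each other counterclockwise on a half circle.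
  refine h.not_half hρ hb hp ha hpb.symm hpa hab.symm hbc hpc hac ⟨?_, ?_, hba⟩
  · exact cross_nonneg_of_lower_upper hpc hbc (by linarith) (by linarith) (by linarith) (by linarith)
  · have hac' : sq (a.1, -a.2) (c.1, -c.2) = ρ ^ 2 := by rw [← hac]; simp only [sq]; ring
    have hpc' : sq (p.1, -p.2) (c.1, -c.2) = ρ ^ 2 := by rw [← hpc]; simp only [sq]; ring
    have := orient_nonneg_of_lo_eq (X := c.1) (Y := -c.2)
      (abs_sub_le_of_sq_le (c := (c.1, -c.2)) hρ.le hac'.le)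
      (abs_sub_le_of_sq_le (c := (c.1, -c.2)) hρ.le hpc'.le) (lo_eq_of_sq_eq hac' (by simpa using ha2))
      (lo_eq_of_sq_eq hpc' (by simpa using hp2)) hcon
    simp only [orient] at this ⊢
    linarith

theorem GenPos.lt_of_upper {ρ : ℝ} (hρ : 0 < ρ) {S : Set (ℝ × ℝ)} (h : GenPos ρ S)
    {a b p c : ℝ × ℝ} (ha : a ∈ S) (hb : b ∈ S) (hp : p ∈ S) (hab : a ≠ b) (hpa : p ≠ a)
    (hpb : p ≠ b) (hac : sq a c = ρ ^ 2) (hbc : sq b c = ρ ^ 2) (hpc : sq p c = ρ ^ 2)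
    (hba : 0 ≤ orient c b a) (hmid : a.1 + b.1 ≤ 2 * c.1) (hlt : a.1 < p.1) (ha2 : a.2 ≤ c.2)
    (hb2 : c.2 ≤ b.2) (hp2 : c.2 ≤ p.2) : b.1 < p.1 := by
  by_contra hcon
  push Not at hcon
  refine h.not_half hρ hb hp ha hpb.symm hpa hab.symm hbc hpc hac ⟨?_, ?_, hba⟩
  · exact orient_nonneg_of_lo_eq (X := c.1) (Y := c.2) (abs_sub_le_of_sq_le hρ.le hbc.le)
      (abs_sub_le_of_sq_le hρ.le hpc.le) (lo_eq_of_sq_eq hbc hb2) (lo_eq_of_sq_eq hpc hp2) hcon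
  · exact cross_nonneg_of_lower_upper hac hpc (by linarith) (by linarith) (by linarith) (by linarith)

/-- The tangent points. -/
def both (a b : Plane) (s : Bool) : Plane := if s then a else b

/-- The envelopes used if the tangent points are on different halves of the circle. -/
def oppD (x τ : Bool) (s : Bool) : Bool := if s = x then !τ else τ

section

variable {r t : ℝ} {u : Plane} {Q : Bool → Finset Plane} {T : Bool → HullTree} {n : Bool → ℕ}
  {v : Bool → ℕ → Plane} {m : Bool → ℝ} {x : Bool} {d : Bool → Bool} {w : Bool → Plane} {c : Plane}

theorem Input.genPos (I : Input r t u Q T n v) (x d : Bool) :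
    GenPos (rad r u) (hat u (sgn x) (sgn d) '' (↑(Q true) ∪ ↑(Q false))) :=
  Frame.genPos ⟨I.ne, sgn_mul_self x, sgn_mul_self d⟩ I.pos I.sep.gp

theorem Input.mem_union {Q : Bool → Finset Plane} {s : Bool} {p : Plane} (hp : p ∈ Q s) :
    p ∈ ((↑(Q true) ∪ ↑(Q false) : Set Plane)) := by
  cases s
  · exact Or.inr hp
  · exact Or.inl hp

/-- In the frame chosen for a set its tangent point is on the upper half, by `hup`, so its half
circle passes through the center. Covering says that no other half circle passes above the center.
-/
theorem target_of_tangent (I : Input r t u Q T n v) (hm : Extreme r u Q m)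
    (hc : ∀ s, Covers r c ↑(Q s)) (hw : ∀ s, w s ∈ Q s) (hwc : ∀ s, dist (w s) c = r)
    (hup : ∀ s, (hat u (sgn x) (sgn (d s)) c).2 ≤ (hat u (sgn x) (sgn (d s)) (w s)).2)
    (htie : ∀ s, ∀ p ∈ Q s, p ≠ w s → dist p c = r →
      (hat u (sgn x) (sgn (d s)) c).2 ≤ (hat u (sgn x) (sgn (d s)) p).2 →
      (hat u (sgn x) (sgn (d s)) (w s)).1 < (hat u (sgn x) (sgn (d s)) p).1)
    (hmeet : d true = d false → x = true)
    (hopp : d true ≠ d false → (hat u (sgn x) 1 (w true)).1 + (hat u (sgn x) 1 (w false)).1 ≤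
      2 * (hat u (sgn x) 1 c).1) :
    Target r t u Q m x d w (hat u (sgn x) 1 c).1 := by
  have F : ∀ s, Frame u (sgn x) (sgn (d s)) := fun s => ⟨I.ne, sgn_mul_self x, sgn_mul_self (d s)⟩
  have hρ := I.rad_pos.le
  have eq : ∀ s, low r u x (d s) (w s) (hat u (sgn x) 1 c).1 = (hat u (sgn x) (sgn (d s)) c).2 :=
    fun s => lo_eq_of_sq_eq (((F s).sq_eq_iff I.pos _ c).2 (hwc s)) (hup s)
  have abs : ∀ s, ∀ p ∈ Q s, |(hat u (sgn x) 1 c).1 - (hat u (sgn x) 1 p).1| ≤ rad r u :=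
    fun s p hp => by
      have h := abs_sub_le_of_sq_le hρ (((F s).sq_le_iff I.pos p c).2 (hc s hp))
      exact h
  refine ⟨fun s => ⟨hw s, c, hc s, hwc s⟩, ?_, ?_, ?_, ?_, ?_⟩
  · obtain ⟨p, hp, hp', -⟩ := hm true
    obtain ⟨q, hq, hq', -⟩ := hm false
    have h1 := abs_le.1 (abs true p hp.1)
    have h2 := abs_le.1 (abs false q hq.1)
    simp only [hat, ← hp', ← hq'] at h1 h2 ⊢
    cases x <;> simp only [loX, hiX, sgn_true, sgn_false, Bool.false_eq_true, if_true, if_false]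
      at h1 h2 ⊢ <;> constructor <;> linarith [h1.1, h1.2, h2.1, h2.2]
  · intro s p hp
    rw [eq]
    exact lo_le_of_sq_le (((F s).sq_le_iff I.pos p c).2 (hc s hp.1))
  · intro s p hp hne h
    rw [eq] at h
    refine htie s p hp.1 hne ?_ ?_
    · rw [← (F s).sq_eq_iff I.pos]
      have := sq_lo (abs s p hp.1) (v := hat u (sgn x) (sgn (d s)) p)
      rwa [show lo (rad r u) (hat u (sgn x) (sgn (d s)) p) (hat u (sgn x) 1 c).1 = _ from h] at this
    · rw [← h]; exact le_of_eq_lo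
  · intro hd
    rw [eq, eq, hd]
    exact ⟨hmeet hd, rfl⟩
  · intro hd
    refine ⟨?_, hopp hd⟩
    rw [eq, eq]
    simp only [hat]
    cases h1 : d true <;> cases h2 : d false <;> simp_all

theorem Tangent.exists_target (I : Input r t u Q T n v) (hm : Extreme r u Q m) {τ : Bool}
    {a b : Plane} (h : Tangent (sgn τ) r (Q true) (Q false) a b) :
    ∃ z, Target r t u Q m true (fun _ => τ) (both a b) z ∨
      Target r t u Q m true (oppD true τ) (both a b) z ∨
      Target r t u Q m false (oppD false τ) (both a b) z := by
  obtain ⟨c, h1, h2, h3, h4, h5, h6, h7⟩ := h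
  have hN := norm_pos_of_ne I.ne
  have hρ := I.rad_pos
  have hc : ∀ s, Covers r c ↑(Q s) := by intro s; cases s <;> assumption
  have hw : ∀ s, both a b s ∈ Q s := by intro s; cases s <;> assumption
  have hwc : ∀ s, dist (both a b s) c = r := by intro s; cases s <;> assumption
  have F : ∀ x : Bool, Frame u (sgn x) (sgn τ) := fun x => ⟨I.ne, sgn_mul_self x, sgn_mul_self τ⟩
  have mem : ∀ (x : Bool) {s p}, p ∈ Q s → hat u (sgn x) (sgn τ) p ∈
      hat u (sgn x) (sgn τ) '' (↑(Q true) ∪ ↑(Q false)) := fun x s p hp =>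
    ⟨p, Input.mem_union hp, rfl⟩
  have on : ∀ (x : Bool) {p}, dist p c = r →
      sq (hat u (sgn x) (sgn τ) p) (hat u (sgn x) (sgn τ) c) = rad r u ^ 2 := fun x p hp =>
    ((F x).sq_eq_iff I.pos p c).2 hp
  have hab : ∀ x, both a b x ≠ both a b !x := by
    intro x
    cases x
    · exact (I.sep.mem_ne h3 h4).symm
    · exact I.sep.mem_ne h3 h4
  have horient : ∀ x, 0 ≤ orient (hat u (sgn x) (sgn τ) c) (hat u (sgn x) (sgn τ) (both a b !x))
      (hat u (sgn x) (sgn τ) (both a b x)) := by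
    intro x
    rw [Frame.orient_hat]
    have : 0 ≤ (u 0 * u 0 + u 1 * u 1) * -(sgn τ * cross (a - c) (b - c)) :=
      mul_nonneg hN.le (by linarith)
    cases x <;> simp only [both, cross, sgn_true, sgn_false, Bool.not_true, Bool.not_false,
      Bool.false_eq_true, if_true, if_false] at this ⊢ <;> linarith
  have hlt : ∀ (x : Bool) {p q : Plane}, p ∈ Q x → q ∈ Q (!x) →
      (hat u (sgn x) (sgn τ) p).1 < (hat u (sgn x) (sgn τ) q).1 := by
    intro x p q hp hq
    have k1 := I.side hp
    have k2 := I.side hq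
    simp only [hat]
    cases x <;> simp only [sgn_true, sgn_false, Bool.not_true, Bool.not_false] at * <;> linarith
  -- The frame `sgn x` puts the set `x` on the left. So the two mixed cases, with the tangent point
  -- of `L` or that of `R` on the lower half, are one case.
  have opp : ∀ x : Bool, (hat u (sgn x) (sgn τ) (both a b x)).2 < (hat u (sgn x) (sgn τ) c).2 →
      (hat u (sgn x) (sgn τ) c).2 ≤ (hat u (sgn x) (sgn τ) (both a b !x)).2 →
      Target r t u Q m x (oppD x τ) (both a b) (hat u (sgn x) 1 c).1 := by
    intro x k1 k2
    have hmid := add_nonpos_of_cross_nonpos (on x (hwc x)) (on x (hwc !x))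
      (sub_lt_sub_right (hlt x (hw x) (hw !x)) _) (by linarith) (by linarith) (by
        have := horient x
        simp only [orient] at this
        linarith)
    have hmid' : (hat u (sgn x) (sgn τ) (both a b x)).1 + (hat u (sgn x) (sgn τ) (both a b !x)).1 ≤
      2 * (hat u (sgn x) (sgn τ) c).1 := by linarith
    have gp := I.genPos x τ
    have sx : sgn (oppD x τ x) = - sgn τ := by cases τ <;> simp [oppD]
    have sx' : sgn (oppD x τ !x) = sgn τ := by simp [oppD]
    have y : ∀ p, (hat u (sgn x) (sgn (oppD x τ x)) p).2 = - (hat u (sgn x) (sgn τ) p).2 := by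
      intro p; rw [sx]; simp only [hat]; ring
    have y' : ∀ p, (hat u (sgn x) (sgn (oppD x τ !x)) p).2 = (hat u (sgn x) (sgn τ) p).2 := by
      intro p; rw [sx']
    refine target_of_tangent I hm hc hw hwc ?_ ?_ ?_ ?_
    · refine forall_side (p := fun s => (hat u (sgn x) (sgn (oppD x τ s)) c).2 ≤
        (hat u (sgn x) (sgn (oppD x τ s)) (both a b s)).2) x ?_ ?_
      · simp only [y]; linarith
      · simp only [y']; exact k2
    · refine forall_side (p := fun s => ∀ p ∈ Q s, p ≠ both a b s → dist p c = r →
        (hat u (sgn x) (sgn (oppD x τ s)) c).2 ≤ (hat u (sgn x) (sgn (oppD x τ s)) p).2 →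
        (hat u (sgn x) (sgn (oppD x τ s)) (both a b s)).1 <
          (hat u (sgn x) (sgn (oppD x τ s)) p).1) x ?_ ?_
      · intro p hp hne hpc hy
        simp only [y] at hy
        show (hat u (sgn x) (sgn τ) (both a b x)).1 < (hat u (sgn x) (sgn τ) p).1
        exact gp.lt_of_lower hρ (mem x (hw x)) (mem x (hw !x)) (mem x hp) ((F x).inj.ne (hab x))
          ((F x).inj.ne hne) (fun e => by
            have := hlt x hp (hw !x)
            rw [e] at this; exact lt_irrefl _ this) (on x (hwc x)) (on x (hwc !x)) (on x hpc)
          (horient x) hmid' (hlt x (hw x) (hw !x)) k1.le k2 (by linarith)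
      · intro p hp hne hpc hy
        simp only [y'] at hy
        show (hat u (sgn x) (sgn τ) (both a b !x)).1 < (hat u (sgn x) (sgn τ) p).1
        exact gp.lt_of_upper hρ (mem x (hw x)) (mem x (hw !x)) (mem x hp) ((F x).inj.ne (hab x))
          (fun e => by
            have := hlt x (hw x) hp
            rw [e] at this; exact lt_irrefl _ this) ((F x).inj.ne hne) (on x (hwc x))
          (on x (hwc !x)) (on x hpc) (horient x) hmid' (hlt x (hw x) hp) k1.le k2 hy
    · intro hd
      cases x <;> cases τ <;> simp [oppD] at hd
    · intro _
      simp only [hat] at hmid' ⊢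
      cases x <;> simp only [Bool.not_true, Bool.not_false] at hmid' <;> linarith
  have yx : ∀ p, (hat u (sgn false) (sgn τ) p).2 = (hat u (sgn true) (sgn τ) p).2 := fun p => rfl
  by_cases k1 : (hat u (sgn true) (sgn τ) c).2 ≤ (hat u (sgn true) (sgn τ) a).2
  · by_cases k2 : (hat u (sgn true) (sgn τ) c).2 ≤ (hat u (sgn true) (sgn τ) b).2
    · refine ⟨_, Or.inl (target_of_tangent I hm hc hw hwc ?_ ?_ (fun _ => rfl) fun h => absurd rfl h)⟩
      · intro s; cases s <;> assumption
      · intro s p hp hne hpc hy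
        exfalso
        have gp := I.genPos true τ
        have F' := F true
        cases s
        · exact gp.not_upper hρ (mem true h3) (mem true h4) (mem true hp)
            (F'.inj.ne (I.sep.mem_ne h3 h4)) (F'.inj.ne (Ne.symm hne))
            (F'.inj.ne (I.sep.mem_ne h3 hp)) (on true h5) (on true h6) (on true hpc) k1 k2 hy
        · exact gp.not_upper hρ (mem true h3) (mem true h4) (mem true hp)
            (F'.inj.ne (I.sep.mem_ne h3 h4)) (F'.inj.ne (I.sep.mem_ne hp h4).symm)
            (F'.inj.ne (Ne.symm hne)) (on true h5) (on true h6) (on true hpc) k1 k2 hy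
    · exact ⟨_, Or.inr (Or.inr (opp false (not_le.1 k2) k1))⟩
  · by_cases k2 : (hat u (sgn true) (sgn τ) c).2 ≤ (hat u (sgn true) (sgn τ) b).2
    · exact ⟨_, Or.inr (Or.inl (opp true (not_le.1 k1) k2))⟩
    · exfalso
      have k3 := cross_pos_of_lower (on true h5) (on true h6)
        (sub_lt_sub_right (hlt true h3 h4) _) (by linarith) (by linarith)
      have k4 := horient true
      simp only [orient, both, Bool.not_true, Bool.false_eq_true, if_true, if_false] at k4
      linarith

end

/-! ### Testing whether a disk covers one of the sets -/

section

variable {r t : ℝ} {u : Plane} {Q : Bool → Finset Plane} {T : Bool → HullTree} {n : Bool → ℕ}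
  {v : Bool → ℕ → Plane} {m : Bool → ℝ} {c : Plane} {s d : Bool} {σ σ' : State} {h : ℕ}

theorem Input.covers_of_vertices (I : Input r t u Q T n v)
    (hc : ∀ p, IsVertex r ↑(Q s) p → dist p c ≤ r) : Covers r c ↑(Q s) := by
  have F : Frame u 1 1 := I.sep.frame (by norm_num)
  obtain ⟨-, o, ho, -⟩ := (I.ring s).isVertex (Nat.zero_le _)
  rw [← F.cov_iff I.pos]
  refine cov_of_cov_vertices ((F.cov_iff I.pos o _).2 ho) ?_
  rintro _ hp ⟨c', h1, h2⟩
  obtain ⟨p, hq, rfl⟩ := Finset.mem_image.1 hp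
  obtain ⟨c', rfl⟩ := F.surj c'
  rw [F.sq_le_iff I.pos]
  exact hc p ⟨by simpa using hq, c', (F.cov_iff I.pos c' _).1 h1, (F.sq_eq_iff I.pos p c').1 h2⟩

/-- The abscissa of `c` is within reach of all vertices. -/
def Near (r : ℝ) (u : Plane) (m : Bool → ℝ) (s : Bool) (o c : Plane) : Prop :=
  sgn s * (u 0 * c 0 + u 1 * c 1) ≤ sgn s * m s + rad r u ∧
    sgn s * (u 0 * o 0 + u 1 * o 1) ≤ sgn s * (u 0 * c 0 + u 1 * c 1) + rad r u

/-- The first vertex and the one giving `m s` have the extreme abscissae of the set, so two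
comparisons control all its vertices. -/
theorem Input.near_iff (I : Input r t u Q T n v) (hm : Extreme r u Q m) :
    Near r u m s (v s 0) c ↔
      ∀ p, IsVertex r ↑(Q s) p → |(hat u 1 1 c).1 - (hat u 1 1 p).1| ≤ rad r u := by
  have flip : ∀ p, |(hat u 1 1 c).1 - (hat u 1 1 p).1| =
      |sgn s * (u 0 * c 0 + u 1 * c 1) - sgn s * (u 0 * p 0 + u 1 * p 1)| := by
    intro p
    simp only [hat]
    cases s
    · rw [← abs_neg]; simp only [sgn_false]; ring_nf
    · simp
  constructor
  · rintro ⟨h1, h2⟩ p hp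
    obtain ⟨q, hq, -, hmin⟩ := hm s
    obtain ⟨i, hi, rfl⟩ := ((I.ring s).vertex p).2 hp
    have := hmin _ hp
    have := (I.ring s).max i hi
    rw [flip, abs_le]
    constructor <;> linarith
  · intro hp
    obtain ⟨q, hq, hmq, -⟩ := hm s
    have h1 := hp q hq
    have h2 := hp _ ((I.ring s).isVertex (Nat.zero_le _))
    rw [flip, abs_le] at h1 h2
    unfold Near
    rw [hmq]
    constructor <;> linarith [h1.1, h1.2, h2.1, h2.2]

theorem Near.of_covers (I : Input r t u Q T n v) (hm : Extreme r u Q m) (hc : Covers r c ↑(Q s)) :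
    Near r u m s (v s 0) c := by
  have F : Frame u 1 1 := I.sep.frame (by norm_num)
  rw [I.near_iff hm]
  exact fun p hp => abs_sub_le_of_sq_le I.rad_pos.le ((F.sq_le_iff I.pos p c).2 (hc hp.1))

def highT (s d : Bool) : Test :=
  if d then .and (activeT s d) (.not (.le (lowE true d (fieldE .next s) (.reg 25))
    (lowE true d (fieldE .pt s) (.reg 25))))
  else .not (.and (activeT s d) (.le (lowE true d (fieldE .next s) (.reg 25))
    (lowE true d (fieldE .pt s) (.reg 25))))

def failIf (b : Test) : Program := .cond b (.setReal 27 (.const 0)) .skip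

def farT (s : Bool) : Test :=
  ltT (.mul (.reg 4) (.reg 4))
    (sqE (hatXE true (candE s)) (hatYE true (candE s)) (.reg 25) (.reg 26))

/-- Test whether a vertex on one side of the disk around the registers 25, 26 is outside. -/
def testHalf (s d : Bool) : Program := .seq (search s (highT s d)) (failIf (farT s))

def nearT (s : Bool) : Test :=
  .and (.le (.mul (sgnE s) (.reg 25)) (.add (.mul (sgnE s) (.reg (extR s))) (.reg 4)))
    (.le (hatXE s (firstE s)) (.add (.mul (sgnE s) (.reg 25)) (.reg 4)))

/-- Clear register 27 unless the disk around the registers 25, 26 covers the set `s`. -/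
def testCover (s : Bool) : Program :=
  .seq (failIf (.not (nearT s))) (.seq (testHalf s true) (testHalf s false))

/-- The effect of a test: register 27 is cleared unless the test is passed. -/
structure Tested (A : Prop) (σ σ' : State) : Prop where
  keep : Keep 27 σ σ'
  pass : A → σ'.re 27 = σ.re 27
  fail : ¬ A → σ'.re 27 = 0

theorem Tested.trans {A B : Prop} {σ'' : State} (h : Tested A σ σ') (h' : Tested B σ' σ'') :
    Tested (A ∧ B) σ σ'' := by
  refine ⟨h.keep.trans h'.keep, fun ⟨a, b⟩ => (h'.pass b).trans (h.pass a), fun hab => ?_⟩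
  by_cases b : B
  · rw [h'.pass b]; exact h.fail fun a => hab ⟨a, b⟩
  · exact h'.fail b

theorem tested_failIf (b : Test) : Tested (¬ b.Holds σ) σ ((failIf b).act σ) := by
  by_cases hb : b.Holds σ
  · rw [failIf, Program.act_cond_pos hb]
    refine ⟨⟨fun i hi => ?_, fun _ => rfl⟩, fun h => absurd hb h, fun _ => ?_⟩
    · simp [Program.act, Function.update_of_ne (show i ≠ 27 by omega)]
    · simp [Program.act, RealExpr.eval]
  · rw [failIf, Program.act_cond_neg hb]
    exact ⟨Keep.refl _ _, fun _ => rfl, fun h => absurd hb h⟩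

/-- The half circle of `e.next` is higher than that of `e.pt` at `z`. -/
def High (r : ℝ) (u : Plane) (s d : Bool) (o : Plane) (z : ℝ) (e : VertexRecord) : Prop :=
  if d then Active u (sgn s) d o e.pt e.next ∧
    ¬ lo (rad r u) (hat u 1 (sgn d) e.next) z ≤ lo (rad r u) (hat u 1 (sgn d) e.pt) z
  else ¬ (Active u (sgn s) d o e.pt e.next ∧
    lo (rad r u) (hat u 1 (sgn d) e.next) z ≤ lo (rad r u) (hat u 1 (sgn d) e.pt) z)

theorem highT_holds (E : Env r t u T v m σ) {e : VertexRecord} {l r' : HullTree}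
    (hp : σ.ptr (cur s) = .node e l r') :
    (highT s d).Holds σ ↔ High r u s d (v s 0) (σ.re 25) e := by
  have h1 := activeT_holds E.toBasic (d := d) (E.rep_first s) hp
  have h2 := lowE_eval E.toBasic (rep_pt hp) true d (.reg 25)
  have h3 := lowE_eval E.toBasic (rep_next hp) true d (.reg 25)
  cases d <;>
    simp only [highT, Test.Holds, h1, h2, h3, High, low, RealExpr.eval, sgn_true, if_true, if_false,
      Bool.false_eq_true]

theorem farT_holds (B : Basic r t u T σ) : (farT s).Holds σ ↔
    ¬ sq (hat u 1 1 (cand s σ)) (σ.re 25, σ.re 26) ≤ rad r u ^ 2 := by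
  have h1 := hatXE_eval B (rep_cand s) true 1
  have h2 := hatYE_eval B (rep_cand s) 1 true
  rw [farT, ltT_holds, not_le]
  simp only [sqE, RealExpr.eval, h1, h2, B.scaled, sgn_true, sq]
  constructor <;> intro h <;> nlinarith

theorem nearT_holds (E : Env r t u T v m σ) (hc : (hat u 1 1 c).1 = σ.re 25) :
    (nearT s).Holds σ ↔ Near r u m s (v s 0) c := by
  have h1 := hatXE_eval E.toBasic (E.rep_first s) s 0
  simp only [nearT, Test.Holds, RealExpr.eval, h1, E.ext, E.scaled, sgnE_eval, ← hc, Near, hat,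
    one_mul]

/-- The verdict `A` is whether the vertex found is covered. If the abscissa of the center is out of
reach of some vertex, half circles have no meaning there and the vertex found is arbitrary; hence
`A` is related to covering only under the condition of nearness. -/
theorem Ensures.testHalf (I : Input r t u Q T n v) (E : Env r t u T v m σ)
    (hh : (T s).height ≤ h) (hc : hat u 1 1 c = (σ.re 25, σ.re 26)) (d : Bool) :
    Ensures h (testHalf s d) σ fun σ' => ∃ A, Tested A σ σ' ∧ ((∀ p, IsVertex r ↑(Q s) p →
      |(hat u 1 1 c).1 - (hat u 1 1 p).1| ≤ rad r u) → (Covers r c ↑(Q s) → A) ∧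
      (A → ∀ p, IsVertex r ↑(Q s) p → lo (rad r u) (hat u 1 (sgn d) p) (hat u 1 (sgn d) c).1 ≤
        (hat u 1 (sgn d) c).2)) := by
  have F : Frame u 1 1 := I.sep.frame (by norm_num)
  have Fd : Frame u 1 (sgn d) := I.sep.frame (sgn_mul_self d)
  have hX : (hat u 1 (sgn d) c).1 = σ.re 25 := congrArg Prod.fst hc
  refine (Ensures.search (A := High r u s d (v s 0) (σ.re 25)) (E.root s) hh
    fun σ₁ k e _ l r' hp => by
      rw [highT_holds (E.keep (by norm_num) k) hp, k.1 25 (by norm_num)]).seq ?_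
  rintro σ₁ ⟨k, hf⟩
  have B := (E.keep (by norm_num) k).toBasic
  refine Ensures.of_act (by simp [failIf, Program.LoopFree]) ?_
  have ht := tested_failIf (σ := σ₁) (farT s)
  refine ⟨_, ⟨(k.mono (by norm_num)).trans ht.keep, fun a => (ht.pass a).trans (k.1 27 (by norm_num)),
    ht.fail⟩, fun hz => ?_⟩
  obtain ⟨j, hj, hmax, hfind⟩ := (I.ring s).find_max I.pos I.ne (I.gp s) (d := d) (z := σ.re 25)
    (fun p hp => by rw [← hX]; exact hz p hp) (cand s σ)
  have hj' : cand s σ₁ = v s j := hf.trans hfind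
  have hA : ¬ (farT s).Holds σ₁ ↔ dist (v s j) c ≤ r := by
    rw [farT_holds B, not_not, k.1 25 (by norm_num), k.1 26 (by norm_num), ← hc, F.sq_le_iff I.pos, hj']
  rw [hA]
  refine ⟨fun hcov => hcov ((I.ring s).mem hj), fun hd p hp => ?_⟩
  obtain ⟨i, hi, rfl⟩ := ((I.ring s).vertex p).2 hp
  rw [hX]
  refine (hmax i hi.le).trans ?_
  rw [← hX]
  exact lo_le_of_sq_le ((Fd.sq_le_iff I.pos _ c).2 hd)

theorem Ensures.testCover (I : Input r t u Q T n v) (hm : Extreme r u Q m) (E : Env r t u T v m σ)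
    (hh : (T s).height ≤ h) (hc : hat u 1 1 c = (σ.re 25, σ.re 26)) :
    Ensures h (testCover s) σ fun σ' => Tested (Covers r c ↑(Q s)) σ σ' := by
  have F : ∀ d, Frame u 1 (sgn d) := fun d => I.sep.frame (sgn_mul_self d)
  refine (Ensures.of_act (Q := fun σ' => σ' = (failIf (.not (nearT s))).act σ)
    (by simp [failIf, Program.LoopFree]) rfl).seq ?_
  rintro σ₁ hσ₁
  have t1 := tested_failIf (σ := σ) (.not (nearT s))
  rw [← hσ₁] at t1
  have k1 := t1.keep
  refine (Ensures.testHalf I (E.keep (by norm_num) k1) hh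
    (by rw [hc, k1.1 25 (by norm_num), k1.1 26 (by norm_num)]) true).seq ?_
  rintro σ₂ ⟨A, t2, hA⟩
  have k2 := k1.trans t2.keep
  refine (Ensures.testHalf I (E.keep (by norm_num) k2) hh
    (by rw [hc, k2.1 25 (by norm_num), k2.1 26 (by norm_num)]) false).mono ?_
  rintro σ₃ ⟨B, t3, hB⟩
  have ht := (t1.trans t2).trans t3
  have hn : ¬ (Test.not (nearT s)).Holds σ ↔ Near r u m s (v s 0) c := by
    rw [← nearT_holds E (congrArg Prod.fst hc)]
    exact not_not
  rw [hn] at ht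
  convert ht
  constructor
  · intro hcov
    have hz := Near.of_covers I hm hcov
    rw [I.near_iff hm] at hz
    exact ⟨⟨Near.of_covers I hm hcov, (hA hz).1 hcov⟩, (hB hz).1 hcov⟩
  · rintro ⟨⟨hz, a⟩, b⟩
    rw [I.near_iff hm] at hz
    -- The two envelopes bound the second coordinate of `p` relative to the center from above and
    -- from below by the height of the half circle, which is the distance condition.
    refine I.covers_of_vertices fun p hp => ?_
    have h1 := (hA hz).2 a p hp
    have h2 := (hB hz).2 b p hp
    have h3 := hz p hp
    rw [← (F true).sq_le_iff I.pos]
    have h4 := psi_sq h3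
    have h5 := psi_nonneg (rad r u) ((hat u 1 1 c).1 - (hat u 1 1 p).1)
    simp only [lo, hat, sgn_true, sgn_false, one_mul] at h1 h2 h3 h4 h5
    simp only [sq, hat, sgn_true, one_mul]
    generalize psi _ _ = y at *
    nlinarith

end

/-! ### Searching for a tangent -/

def savedX (s : Bool) : ℕ := if s then 21 else 23
def savedY (s : Bool) : ℕ := if s then 22 else 24
def outX (τ s : Bool) : ℕ := if τ then if s then 11 else 13 else if s then 15 else 17
def outY (τ s : Bool) : ℕ := if τ then if s then 12 else 14 else if s then 16 else 18
def flagR (τ : Bool) : ℕ := if τ then 19 else 20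

def saved (s : Bool) (σ : State) : Plane := !₂[σ.re (savedX s), σ.re (savedY s)]

/-- The tangent points found so far. -/
def out (τ s : Bool) (σ : State) : Plane := !₂[σ.re (outX τ s), σ.re (outY τ s)]

def savedE (s : Bool) : RealExpr × RealExpr := (.reg (savedX s), .reg (savedY s))

def apothemE (x₁ y₁ x₂ y₂ : RealExpr) : RealExpr :=
  .sqrt (.sub (.mul (.reg 4) (.reg 4)) (.div (sqE x₁ y₁ x₂ y₂) (.const 4)))

def ctrXE (x₁ y₁ x₂ y₂ : RealExpr) : RealExpr :=
  .sub (.div (.add x₁ x₂) (.const 2))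
    (.div (.mul (apothemE x₁ y₁ x₂ y₂) (.sub y₂ y₁)) (.sqrt (sqE x₁ y₁ x₂ y₂)))

def ctrYE (x₁ y₁ x₂ y₂ : RealExpr) : RealExpr :=
  .add (.div (.add y₁ y₂) (.const 2))
    (.div (.mul (apothemE x₁ y₁ x₂ y₂) (.sub x₂ x₁)) (.sqrt (sqE x₁ y₁ x₂ y₂)))

/-- Compute in the registers 25, 26 the center of the disk that has `e` and `f` in
counterclockwise order on its boundary. -/
def center (e f : RealExpr × RealExpr) : Program :=
  .seq (.setReal 25 (ctrXE (hatXE true e) (hatYE true e) (hatXE true f) (hatYE true f)))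
    (.seq (.setReal 26 (ctrYE (hatXE true e) (hatYE true e) (hatXE true f) (hatYE true f)))
      (.setReal 27 (.const 1)))

def save : Program :=
  .seq (.seq (.setReal 21 (.reg 30)) (.setReal 22 (.reg 31)))
    (.seq (.setReal 23 (.reg 32)) (.setReal 24 (.reg 33)))

def store (τ : Bool) : Program :=
  .cond (ltT (.const 0) (.reg 27))
    (.seq (.seq (.seq (.setReal (outX τ true) (.reg 21)) (.setReal (outY τ true) (.reg 22)))
      (.seq (.setReal (outX τ false) (.reg 23)) (.setReal (outY τ false) (.reg 24))))
      (.setReal (flagR τ) (.const 1))) .skip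

/-- Search with the parameters `x` and `d` for the tangent given by `τ`, and verify the result. -/
def attempt (τ x : Bool) (d : Bool → Bool) : Program :=
  .seq (.seq (double x d) (.seq save (center (savedE !τ) (savedE τ))))
    (.seq (.seq (testCover true) (testCover false)) (store τ))

section

variable {r t : ℝ} {u : Plane} {Q : Bool → Finset Plane} {T : Bool → HullTree} {n : Bool → ℕ}
  {v : Bool → ℕ → Plane} {m : Bool → ℝ} {c p q : Plane} {s d τ x : Bool} {σ σ' : State} {h : ℕ}

theorem center_act (B : Basic r t u T σ) {e f : RealExpr × RealExpr}
    (he : ∀ a, Rep { σ with re := Function.update σ.re 25 a } e p)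
    (hf : ∀ a, Rep { σ with re := Function.update σ.re 25 a } f q) :
    Keep 25 σ ((center e f).act σ) ∧ ((center e f).act σ).re 27 = 1 ∧
      (((center e f).act σ).re 25, ((center e f).act σ).re 26) =
        ctr (rad r u) (hat u 1 1 p) (hat u 1 1 q) := by
  have key : ∀ a, Basic r t u T { σ with re := Function.update σ.re 25 a } := fun a =>
    Basic.keep (σ := σ) (k := 25) (by norm_num) ⟨fun i hi => by
      simp [Function.update_of_ne (show i ≠ 25 by omega)], fun _ => rfl⟩ B
  have hX : (ctrXE (hatXE true e) (hatYE true e) (hatXE true f) (hatYE true f)).eval σ =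
      (ctr (rad r u) (hat u 1 1 p) (hat u 1 1 q)).1 := by
    have e0 : { σ with re := Function.update σ.re 25 (σ.re 25) } = σ := by simp
    have he' := he (σ.re 25)
    have hf' := hf (σ.re 25)
    rw [e0] at he' hf'
    simp only [ctrXE, apothemE, sqE, RealExpr.eval, hatXE_eval B he' true 1, hatXE_eval B hf' true 1,
      hatYE_eval B he' 1 true, hatYE_eval B hf' 1 true, sgn_true, ctr, B.scaled]
    norm_num
  have hY : ∀ a, (ctrYE (hatXE true e) (hatYE true e) (hatXE true f) (hatYE true f)).eval
      { σ with re := Function.update σ.re 25 a } = (ctr (rad r u) (hat u 1 1 p) (hat u 1 1 q)).2 := by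
    intro a
    have B' := key a
    simp only [ctrYE, apothemE, sqE, RealExpr.eval, hatXE_eval B' (he a) true 1,
      hatXE_eval B' (hf a) true 1, hatYE_eval B' (he a) 1 true, hatYE_eval B' (hf a) 1 true, sgn_true,
      ctr]
    norm_num [B.scaled]
  refine ⟨⟨fun i hi => ?_, fun _ => rfl⟩, ?_, Prod.ext ?_ ?_⟩
  · simp [center, Program.act, Function.update_of_ne (show i ≠ 25 by omega),
      Function.update_of_ne (show i ≠ 26 by omega), Function.update_of_ne (show i ≠ 27 by omega)]
  · simp [center, Program.act, RealExpr.eval]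
  · simp [center, Program.act, hX]
  · simp [center, Program.act, hY]

theorem save_act : Keep 21 σ (save.act σ) ∧ ∀ s, saved s (save.act σ) = cand s σ := by
  refine ⟨⟨fun i hi => ?_, fun _ => rfl⟩, fun s => ?_⟩
  · simp [save, Program.act, Function.update_of_ne (show i ≠ 21 by omega),
      Function.update_of_ne (show i ≠ 22 by omega), Function.update_of_ne (show i ≠ 23 by omega),
      Function.update_of_ne (show i ≠ 24 by omega)]
  · cases s <;> simp [save, saved, cand, Program.act, RealExpr.eval, savedX, savedY, candX, candY]

theorem rep_saved (hs : saved s σ = p) (a : ℝ) :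
    Rep { σ with re := Function.update σ.re 25 a } (savedE s) p := by
  rw [← hs]
  cases s <;> simp [Rep, savedE, RealExpr.eval, saved, savedX, savedY]

theorem store_act_pos (h0 : 0 < σ.re 27) : Keep 11 σ ((store τ).act σ) ∧
    (∀ s, out τ s ((store τ).act σ) = saved s σ) ∧ ((store τ).act σ).re (flagR τ) = 1 ∧
    (∀ s, out (!τ) s ((store τ).act σ) = out (!τ) s σ) ∧
    ((store τ).act σ).re (flagR !τ) = σ.re (flagR !τ) := by
  rw [store, Program.act_cond_pos (by simpa [ltT_holds, RealExpr.eval] using h0)]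
  refine ⟨⟨fun i hi => ?_, fun _ => rfl⟩, fun s => ?_, ?_, fun s => ?_, ?_⟩
  · have : ∀ j, 11 ≤ j → i ≠ j := fun j hj => by omega
    cases τ <;> simp [Program.act, outX, outY, flagR, Function.update_of_ne, this]
  · cases τ <;> cases s <;> simp [Program.act, outX, outY, flagR, out, saved, savedX, savedY,
      RealExpr.eval]
  · cases τ <;> simp [Program.act, flagR, RealExpr.eval]
  · cases τ <;> cases s <;> simp [Program.act, outX, outY, flagR, out, RealExpr.eval]
  · cases τ <;> simp [Program.act, outX, outY, flagR, RealExpr.eval]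

theorem store_act_neg (h0 : ¬ 0 < σ.re 27) : (store τ).act σ = σ := by
  rw [store, Program.act_cond_neg (by simpa [ltT_holds, RealExpr.eval] using h0)]
  rfl

end

/-- The tangents found so far are tangents. -/
def Sound (r : ℝ) (Q : Bool → Finset Plane) (σ : State) : Prop :=
  ∀ τ, 0 < σ.re (flagR τ) → Tangent (sgn τ) r (Q true) (Q false) (out τ true σ) (out τ false σ)

structure Advance (r : ℝ) (Q : Bool → Finset Plane) (σ σ' : State) : Prop where
  keep : Keep 11 σ σ'
  sound : Sound r Q σ → Sound r Q σ'
  mono : ∀ τ, 0 < σ.re (flagR τ) → 0 < σ'.re (flagR τ)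

/-! ### Verified attempts to find a tangent -/

section

variable {r t : ℝ} {u : Plane} {Q : Bool → Finset Plane} {T : Bool → HullTree} {n : Bool → ℕ}
  {v : Bool → ℕ → Plane} {m : Bool → ℝ} {a b c p q : Plane} {s τ x : Bool} {d : Bool → Bool}
  {σ σ' σ'' : State} {h : ℕ} {z : ℝ}

theorem Advance.trans (h : Advance r Q σ σ') (h' : Advance r Q σ' σ'') : Advance r Q σ σ'' :=
  ⟨h.keep.trans h'.keep, fun k => h'.sound (h.sound k), fun τ k => h'.mono τ (h.mono τ k)⟩

theorem Keep.out (k : Keep 21 σ σ') (τ s : Bool) : out τ s σ' = out τ s σ := by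
  unfold CircularHull.out
  rw [k.1 _ (by cases τ <;> cases s <;> simp [outX]), k.1 _ (by cases τ <;> cases s <;> simp [outY])]

theorem Keep.flag (k : Keep 21 σ σ') (τ : Bool) : σ'.re (flagR τ) = σ.re (flagR τ) :=
  k.1 _ (by cases τ <;> simp [flagR])

theorem Keep.advance (k : Keep 21 σ σ') : Advance r Q σ σ' :=
  ⟨k.mono (by norm_num), fun h τ h0 => by rw [k.out, k.out]; exact h τ (by rwa [← k.flag τ]),
    fun τ h0 => by rwa [k.flag]⟩

theorem advance_store (h : 0 < σ.re 27 →
    Tangent (sgn τ) r (Q true) (Q false) (saved true σ) (saved false σ)) :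
    Advance r Q σ ((store τ).act σ) := by
  by_cases h0 : 0 < σ.re 27
  · obtain ⟨k1, k2, k3, k4, k5⟩ := store_act_pos (τ := τ) h0
    refine ⟨k1, fun hs => forall_side τ ?_ ?_, forall_side τ ?_ ?_⟩
    · rw [k2, k2]; exact fun _ => h h0
    · rw [k4, k4, k5]; exact hs _
    · rw [k3]; exact fun _ => zero_lt_one
    · rw [k5]; exact id
  · rw [store_act_neg h0]
    exact ⟨Keep.refl _ _, id, fun _ => id⟩

/-- Soundness of the verification: whatever the search has returned, if the disk with the computed
center covers both sets, then both vertices are on its boundary with the right orientation, by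
`ctr_spec`. -/
theorem tangent_of_ctr (I : Input r t u Q T n v) {w : Bool → Plane}
    (hw : ∀ s, IsVertex r ↑(Q s) (w s)) (hc : ∀ s, Covers r c ↑(Q s))
    (h : hat u 1 1 c = ctr (rad r u) (hat u 1 1 (w !τ)) (hat u 1 1 (w τ))) :
    Tangent (sgn τ) r (Q true) (Q false) (w true) (w false) := by
  have F : Frame u 1 1 := I.sep.frame (by norm_num)
  have hne : w (!τ) ≠ w τ := by
    have := I.sep.mem_ne (hw true).1 (hw false).1
    cases τ
    · exact this
    · exact this.symm
  obtain ⟨h1, h2, h3⟩ := ctr_spec (r := rad r u) (F.inj.ne hne)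
    (by rw [← h, F.sq_le_iff I.pos]; exact hc _ (hw _).1)
  rw [← h, F.sq_eq_iff I.pos] at h1 h2
  rw [← h, Frame.orient_hat, one_mul, one_mul] at h3
  have h4 := nonneg_of_mul_nonneg_right h3 (norm_pos_of_ne I.ne)
  cases τ
  · exact ⟨c, hc _, hc _, (hw _).1, (hw _).1, h1, h2, by simpa using h4⟩
  · refine ⟨c, hc _, hc _, (hw _).1, (hw _).1, h2, h1, ?_⟩
    simp only [cross, sgn_true, Bool.not_true] at h4 ⊢
    linarith

/-- Completeness of the verification: the computed center is that of the tangent disk. The order of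
the points depends on `τ` because `ctr` wants them counterclockwise. -/
theorem Tangent.exists_ctr (I : Input r t u Q T n v)
    (h : Tangent (sgn τ) r (Q true) (Q false) a b) : ∃ c, (∀ s, Covers r c ↑(Q s)) ∧
    hat u 1 1 c = ctr (rad r u) (hat u 1 1 (both a b !τ)) (hat u 1 1 (both a b τ)) := by
  have F : Frame u 1 1 := I.sep.frame (by norm_num)
  obtain ⟨c, h1, h2, h3, h4, h5, h6, h7⟩ := h
  have hN := norm_pos_of_ne I.ne
  have hne := I.sep.mem_ne h3 h4
  refine ⟨c, fun s => by cases s <;> assumption, ?_⟩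
  rw [← F.sq_eq_iff I.pos] at h5 h6
  have h8 : 0 ≤ (u 0 * u 0 + u 1 * u 1) * -(sgn τ * cross (a - c) (b - c)) :=
    mul_nonneg hN.le (by linarith)
  cases τ
  · refine eq_ctr (F.inj.ne hne) h5 h6 ?_
    rw [Frame.orient_hat]
    simp only [both, cross, sgn_false, Bool.not_false, if_true, if_false, Bool.false_eq_true] at h8 ⊢
    linarith
  · refine eq_ctr (F.inj.ne hne.symm) h6 h5 ?_
    rw [Frame.orient_hat]
    simp only [both, cross, sgn_true, Bool.not_true, if_true, if_false, Bool.false_eq_true] at h8 ⊢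
    linarith

theorem Ensures.attempt (I : Input r t u Q T n v) (hm : Extreme r u Q m) (E : Env r t u T v m σ)
    (hh : (T true).height + (T false).height ≤ h) (τ x : Bool) (d : Bool → Bool) (a b : Plane) (z : ℝ) :
    Ensures h (attempt τ x d) σ fun σ' => Advance r Q σ σ' ∧
      (Tangent (sgn τ) r (Q true) (Q false) a b → Target r t u Q m x d (both a b) z →
        0 < σ'.re (flagR τ)) := by
  have F : Frame u 1 1 := I.sep.frame (by norm_num)
  refine (Ensures.seq (Q' := fun σ' => Keep 21 σ σ' ∧ (∀ s, IsVertex r ↑(Q s) (saved s σ')) ∧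
    (Target r t u Q m x d (both a b) z → ∀ s, saved s σ' = both a b s) ∧
    (σ'.re 25, σ'.re 26) = ctr (rad r u) (hat u 1 1 (saved (!τ) σ')) (hat u 1 1 (saved τ σ')) ∧
    σ'.re 27 = 1) (Ensures.double I hm E hh x d (both a b) z) ?_).seq ?_
  · rintro σ₁ ⟨k1, h1, h2⟩
    refine Ensures.of_act (by simp [save, center, Program.LoopFree]) ?_
    obtain ⟨k2, h3⟩ := save_act (σ := σ₁)
    have B := (((E.keep (by norm_num) k1).keep (by norm_num) k2)).toBasic
    obtain ⟨k3, h4, h5⟩ := center_act B (rep_saved (s := !τ) rfl) (rep_saved (s := τ) rfl)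
    have h6 : ∀ s, saved s ((center (savedE !τ) (savedE τ)).act (save.act σ₁)) =
        saved s (save.act σ₁) := by
      intro s
      unfold saved
      rw [k3.1 _ (by cases s <;> simp [savedX]), k3.1 _ (by cases s <;> simp [savedY])]
    refine ⟨((k1.mono (by norm_num)).trans k2).trans (k3.mono (by norm_num)), ?_, ?_, ?_, h4⟩
    · intro s
      show IsVertex r _ (saved s ((center (savedE !τ) (savedE τ)).act (save.act σ₁)))
      rw [h6, h3]; exact h1 s
    · intro g s
      show saved s ((center (savedE !τ) (savedE τ)).act (save.act σ₁)) = _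
      rw [h6, h3]; exact h2 g s
    · show (((center (savedE !τ) (savedE τ)).act (save.act σ₁)).re 25,
        ((center (savedE !τ) (savedE τ)).act (save.act σ₁)).re 26) = ctr _ (hat u 1 1 (saved (!τ)
          ((center (savedE !τ) (savedE τ)).act (save.act σ₁)))) (hat u 1 1 (saved τ
          ((center (savedE !τ) (savedE τ)).act (save.act σ₁))))
      rw [h6, h6]; exact h5
  · rintro σ₁ ⟨k1, h1, h2, h3, h4⟩
    have E1 := E.keep (by norm_num) k1
    obtain ⟨c, hc⟩ := F.surj (σ₁.re 25, σ₁.re 26)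
    refine (((Ensures.testCover I hm E1 (by omega) hc).seq fun σ₂ t2 => (Ensures.testCover I hm
      (E1.keep (by norm_num) t2.keep) (by omega) (by rw [hc, t2.keep.1 25 (by norm_num),
        t2.keep.1 26 (by norm_num)])).mono fun σ₃ t3 => t2.trans t3)).seq ?_
    intro σ₂ t2
    refine Ensures.of_act (by simp [store, Program.LoopFree]) ?_
    have h5 : ∀ s, saved s σ₂ = saved s σ₁ := by
      intro s
      unfold saved
      rw [t2.keep.1 _ (by cases s <;> simp [savedX]), t2.keep.1 _ (by cases s <;> simp [savedY])]
    refine ⟨(k1.trans (t2.keep.mono (by norm_num))).advance.trans (advance_store fun h0 => ?_),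
      fun g1 g2 => ?_⟩
    · have h6 : Covers r c ↑(Q true) ∧ Covers r c ↑(Q false) := by
        by_contra hcon
        rw [t2.fail hcon] at h0
        exact lt_irrefl _ h0
      rw [h5, h5]
      exact tangent_of_ctr I (w := fun s => saved s σ₁) h1
        (fun s => by cases s; exacts [h6.2, h6.1]) (hc.trans h3)
    · obtain ⟨c', h6, h7⟩ := g1.exists_ctr I
      have h8 : c = c' := F.inj (by rw [hc, h3, h7, h2 g2, h2 g2])
      have h9 := t2.pass ⟨h8 ▸ h6 true, h8 ▸ h6 false⟩
      rw [h4] at h9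
      obtain ⟨-, -, h10, -⟩ := store_act_pos (τ := τ) (σ := σ₂) (by rw [h9]; exact zero_lt_one)
      rw [h10]
      exact zero_lt_one

/-- Search for both tangents, in all possible positions. -/
def attempts (τ : Bool) : Program :=
  .seq (attempt τ true fun _ => τ)
    (.seq (attempt τ true (oppD true τ)) (attempt τ false (oppD false τ)))

theorem Ensures.attempts (I : Input r t u Q T n v) (hm : Extreme r u Q m) (E : Env r t u T v m σ)
    (hh : (T true).height + (T false).height ≤ h) (τ : Bool) :
    Ensures h (attempts τ) σ fun σ' => Advance r Q σ σ' ∧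
      ((∃ a b, Tangent (sgn τ) r (Q true) (Q false) a b) → 0 < σ'.re (flagR τ)) := by
  -- One tangent and its `z` are fixed for all three attempts, although only one of them need have a
  -- target; if there is no tangent, the values are dummies.
  obtain ⟨a, b, z, g⟩ : ∃ a b z, (∃ a b, Tangent (sgn τ) r (Q true) (Q false) a b) →
      Tangent (sgn τ) r (Q true) (Q false) a b ∧
      (Target r t u Q m true (fun _ => τ) (both a b) z ∨
      Target r t u Q m true (oppD true τ) (both a b) z ∨
      Target r t u Q m false (oppD false τ) (both a b) z) := by
    by_cases h : ∃ a b, Tangent (sgn τ) r (Q true) (Q false) a b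
    · obtain ⟨a, b, h⟩ := h
      obtain ⟨z, hz⟩ := h.exists_target I hm
      exact ⟨a, b, z, fun _ => ⟨h, hz⟩⟩
    · exact ⟨0, 0, 0, fun h' => absurd h' h⟩
  refine (Ensures.attempt I hm E hh _ _ _ a b z).seq fun σ₁ ⟨k1, h1⟩ => ?_
  have E1 := E.keep le_rfl k1.keep
  refine (Ensures.attempt I hm E1 hh _ _ _ a b z).seq fun σ₂ ⟨k2, h2⟩ => ?_
  refine (Ensures.attempt I hm (E1.keep le_rfl k2.keep) hh _ _ _ a b z).mono fun σ₃ ⟨k3, h3⟩ => ?_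
  refine ⟨(k1.trans k2).trans k3, fun g' => ?_⟩
  obtain ⟨g1, g2 | g2 | g2⟩ := g g'
  · exact k3.mono _ (k2.mono _ (h1 g1 g2))
  · exact k3.mono _ (h2 g1 g2)
  · exact h3 g1 g2

end

/-! ### The edges of a hull -/

section

variable {r t : ℝ} {u : Plane} {Q : Finset Plane} {T : HullTree} {n : ℕ} {v : ℕ → Plane} {s : Bool}

/-- The list gives orientations only for increasing indices. Rotating the triple covers vertices
before the edge and the edge that closes the cycle. -/
theorem HullCycle.cross_pos {σ : ℝ} (R : HullCycle r Q u σ T n v) {i k : ℕ} (hi : i < n) (hk : k < n)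
    (h1 : v k ≠ v i) (h2 : v k ≠ v (i + 1)) : 0 < σ * cross (v (i + 1) - v i) (v k - v i) := by
  have rot : ∀ a b c : Plane, cross (b - a) (c - a) = cross (c - b) (a - b) := by
    intro a b c
    simp only [cross, PiLp.sub_apply]; ring
  have k1 : k ≠ i := fun h => h1 (by rw [h])
  have k2 : k ≠ i + 1 := fun h => h2 (by rw [h])
  rcases Nat.lt_or_ge (i + 1) n with h | h
  · rcases Nat.lt_or_ge k i with h' | h'
    · rw [← rot]; exact R.ccw k i (i + 1) h' (by omega) h
    · exact R.ccw i (i + 1) k (by omega) (by omega) hk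
  · obtain rfl : n = i + 1 := by omega
    rw [R.wrap] at h2 ⊢
    have k3 : k ≠ 0 := fun h => h2 (by rw [h])
    rw [rot]
    exact R.ccw 0 k i (by omega) (by omega) hi

/-- If all other vertices are to the left of the line from `p` to `q`, then this is an edge. -/
theorem exists_cover_of_left (hr : 0 < r) (hgp : GeneralPosition r ↑Q) {p q : Plane}
    (hp : IsVertex r ↑Q p) (hq : IsVertex r ↑Q q) (hpq : p ≠ q)
    (h : ∀ w, IsVertex r ↑Q w → w ≠ p → w ≠ q → 0 < cross (q - p) (w - p)) :
    ∃ c, Covers r c ↑Q ∧ dist p c = r ∧ dist q c = r ∧ 0 ≤ cross (p - c) (q - c) := by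
  obtain ⟨hpQ, c₀, h1, h2⟩ := hp
  obtain ⟨w, hw, hwp, c, h3, h4, h5, h6⟩ := exists_edge hr hgp hpQ h1 h2 ⟨q, hq.1, hpq.symm⟩
  -- The edge leaving `p` ends at some vertex `w`. If it were not `q`, then `q` would lie in the cap
  -- cut off by that edge, as `w` is to the left of the line from `p` to `q`.
  suffices w = q by subst this; exact ⟨c, h3, h4, h5, h6⟩
  by_contra hwq
  obtain ⟨hqQ, c', h7, h8⟩ := hq
  have h9 := h w ⟨hw, c, h3, h5⟩ hwp hwq
  have hu : (q - p : Plane) ≠ 0 := sub_ne_zero.2 hpq.symm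
  have F : Frame (q - p) 1 1 := ⟨hu, by norm_num, by norm_num⟩
  have hN := norm_pos_of_ne hu
  have key := (F.genPos hr hgp).eq_of_orient_nonneg (a := hat (q - p) 1 1 w) (b := hat (q - p) 1 1 p)
    (s := hat (q - p) 1 1 q) (c := hat (q - p) 1 1 c) (c' := hat (q - p) 1 1 c') ⟨w, hw, rfl⟩
    ⟨p, hpQ, rfl⟩ ⟨q, hqQ, rfl⟩ (F.inj.ne hwp) ((F.sq_eq_iff hr _ _).2 h5)
    ((F.sq_eq_iff hr _ _).2 h4) ?_ ((F.sq_le_iff hr _ _).2 (h3 hqQ)) ((F.sq_le_iff hr _ _).2 (h7 hw))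
    ((F.sq_le_iff hr _ _).2 (h7 hpQ)) ((F.sq_eq_iff hr _ _).2 h8) ?_
  · rcases key with k | k
    · exact hwq (F.inj k).symm
    · exact hpq (F.inj k).symm
  · rw [Frame.orient_hat]
    have := mul_nonneg hN.le h6
    simp only [cross] at this ⊢
    linarith
  · rw [Frame.orient_hat]
    have := mul_pos hN h9
    simp only [cross, PiLp.sub_apply] at this ⊢
    linarith

theorem HullCycle.exists_cover (R : HullCycle r Q u (sgn s) T n v) (hr : 0 < r)
    (hgp : GeneralPosition r ↑Q)
    {i : ℕ} (hi : i < n) (hne : v i ≠ v (i + 1)) : ∃ c, Covers r c ↑Q ∧ dist (v i) c = r ∧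
    dist (v (i + 1)) c = r ∧ 0 ≤ sgn s * cross (v i - c) (v (i + 1) - c) := by
  have h : ∀ w, IsVertex r ↑Q w → w ≠ v i → w ≠ v (i + 1) →
      0 < sgn s * cross (v (i + 1) - v i) (w - v i) := by
    intro w hw h1 h2
    obtain ⟨k, hk, rfl⟩ := (R.vertex w).2 hw
    exact R.cross_pos hi hk h1 h2
  cases s
  · obtain ⟨c, h1, h2, h3, h4⟩ := exists_cover_of_left hr hgp (R.isVertex hi) (R.isVertex hi.le)
      hne.symm fun w hw h1 h2 => by
        have := h w hw h2 h1
        simp only [cross, PiLp.sub_apply, sgn_false] at this ⊢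
        linarith
    refine ⟨c, h1, h3, h2, ?_⟩
    simp only [cross, sgn_false] at h4 ⊢
    linarith
  · obtain ⟨c, h1, h2, h3, h4⟩ := exists_cover_of_left hr hgp (R.isVertex hi.le) (R.isVertex hi)
      hne fun w hw h1 h2 => by simpa using h w hw h1 h2
    exact ⟨c, h1, h2, h3, by simpa using h4⟩

/-- The only vertex is the only point. -/
theorem HullCycle.covers_of_eq {σ : ℝ} (R : HullCycle r Q u σ T n v) (hr : 0 < r)
    (hgp : GeneralPosition r ↑Q) {i : ℕ} (hi : i < n) (h : v i = v (i + 1)) {c : Plane}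
    (hc : dist (v i) c = r) : Covers r c ↑Q := by
  have hn : n = 1 := by
    rcases Nat.lt_or_ge (i + 1) n with h' | h'
    · have := R.inj i hi _ h' h
      omega
    · obtain rfl : n = i + 1 := by omega
      rw [R.wrap] at h
      have := R.inj i hi 0 R.pos h
      omega
  subst hn
  obtain rfl : i = 0 := by omega
  intro q hq
  by_cases hq' : q = v 0
  · rw [hq']; exact hc.le
  · obtain ⟨h0, c₀, h1, h2⟩ := R.isVertex (Nat.zero_le 1)
    obtain ⟨w, hw, hw0, c', h3, -, h4, -⟩ := exists_edge hr hgp h0 h1 h2 ⟨q, hq, hq'⟩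
    obtain ⟨k, hk, rfl⟩ := (R.vertex w).2 ⟨hw, c', h3, h4⟩
    obtain rfl : k = 0 := by omega
    exact absurd rfl hw0

end

/-! ### The algorithm -/

/-- Compute in the registers 25, 26 the center of a disk that covers the set `s`, with a vertex on
its boundary. -/
def edgeCenter (s : Bool) : Program :=
  .seq (.setPtr (cur s) (.reg (root s)))
    (.cond (eqT (fieldE .pt s) (fieldE .next s))
      (.seq (.setReal 25 (.add (hatXE true (fieldE .pt s)) (.reg 4)))
        (.seq (.setReal 26 (hatYE true (fieldE .pt s))) (.setReal 27 (.const 1))))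
      (if s then center (fieldE .pt s) (fieldE .next s)
        else center (fieldE .next s) (fieldE .pt s)))

/-- The test `0 < 0` never holds, so the first search always goes left and ends at the first vertex.
The second follows the active edges to the opposite extreme. -/
def scan (s : Bool) : Program :=
  .seq (.seq (search s (ltT (.const 0) (.const 0)))
      (.seq (.setReal (firstX s) (candE s).1) (.setReal (firstY s) (candE s).2)))
    (.seq (search s (activeT s true)) (.setReal (extR s) (hatXE true (candE s))))

def prepare : Program :=
  .seq (.setReal 4 (.mul (.reg 0) (.sqrt (.add (.mul (.reg 1) (.reg 1)) (.mul (.reg 2) (.reg 2))))))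
    (.seq (scan true) (scan false))

def reportTangents : Program :=
  .seq (.seq (.seq (.setReal 1 (.reg 11)) (.setReal 2 (.reg 12)))
      (.seq (.setReal 3 (.reg 13)) (.setReal 4 (.reg 14))))
    (.seq (.seq (.seq (.setReal 5 (.reg 15)) (.setReal 6 (.reg 16)))
      (.seq (.setReal 7 (.reg 17)) (.setReal 8 (.reg 18)))) (.setReal 0 (.const 3)))

/-- Decide which set dominates, if there are no common tangents. -/
def dominance : Program :=
  .seq (.seq (edgeCenter true) (testCover false))
    (.cond (ltT (.const 0) (.reg 27)) (.setReal 0 (.const 1))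
      (.seq (.seq (edgeCenter false) (testCover true))
        (.cond (ltT (.const 0) (.reg 27)) (.setReal 0 (.const 2)) (.setReal 0 (.const 0)))))

def tangentProgram : Program :=
  .seq prepare (.seq (.seq (attempts true) (attempts false))
    (.cond (.and (ltT (.const 0) (.reg 19)) (ltT (.const 0) (.reg 20))) reportTangents dominance))

section

variable {r t : ℝ} {u : Plane} {Q : Bool → Finset Plane} {T : Bool → HullTree} {n : Bool → ℕ}
  {v : Bool → ℕ → Plane} {m : Bool → ℝ} {s : Bool} {σ σ' : State} {h : ℕ}

theorem Input.exists_node (I : Input r t u Q T n v) (s : Bool) : ∃ e l r', T s = .node e l r' := by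
  cases hT : T s with
  | nil =>
    have h1 := (I.ring s).len
    have h2 := (I.ring s).pos
    rw [hT] at h1
    simp only [inorder, List.length_nil] at h1
    omega
  | node e l r' => exact ⟨e, l, r', rfl⟩

theorem edgeCenter_act (I : Input r t u Q T n v) (B : Basic r t u T σ) (s : Bool) :
    Keep 25 σ ((edgeCenter s).act σ) ∧ ((edgeCenter s).act σ).re 27 = 1 ∧
      ∃ c, hat u 1 1 c = (((edgeCenter s).act σ).re 25, ((edgeCenter s).act σ).re 26) ∧
        Covers r c ↑(Q s) ∧ ∃ p ∈ Q s, dist p c = r := by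
  have F : Frame u 1 1 := I.sep.frame (by norm_num)
  have R := I.ring s
  obtain ⟨e, l, r', hT⟩ := I.exists_node s
  obtain ⟨i, hi, hpt, hnext⟩ := R.exists_index (x := e) (by rw [hT]; simp [inorder])
  obtain ⟨σ₁, hσ₁⟩ : ∃ σ₁, σ₁ = (Program.setPtr (cur s) (.reg (root s))).act σ := ⟨_, rfl⟩
  have k1 : Keep 25 σ σ₁ := by
    rw [hσ₁]
    exact ⟨fun i _ => rfl, fun s' => by cases s <;> cases s' <;> simp [Program.act, cur, root]⟩
  have B1 := B.keep (by norm_num) k1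
  have hp : ∀ a, ({ σ₁ with re := Function.update σ₁.re 25 a } : State).ptr (cur s) = .node e l r' := by
    intro a; rw [hσ₁]; simp [Program.act, PtrExpr.eval, B.root, hT]
  have hp0 : σ₁.ptr (cur s) = .node e l r' := hp 0
  have heq := eqT_holds (rep_pt hp0) (rep_next hp0)
  obtain ⟨P, hP⟩ : ∃ P, P = Program.cond (eqT (fieldE .pt s) (fieldE .next s))
      (.seq (.setReal 25 (.add (hatXE true (fieldE .pt s)) (.reg 4)))
        (.seq (.setReal 26 (hatYE true (fieldE .pt s))) (.setReal 27 (.const 1))))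
      (if s then center (fieldE .pt s) (fieldE .next s)
        else center (fieldE .next s) (fieldE .pt s)) := ⟨_, rfl⟩
  have hact : (edgeCenter s).act σ = P.act σ₁ := by rw [hP, hσ₁]; rfl
  rw [hact, hP]
  by_cases hb : (eqT (fieldE .pt s) (fieldE .next s)).Holds σ₁
  · rw [Program.act_cond_pos hb]
    have hv : v s i = v s (i + 1) := by rw [← hpt, ← hnext]; exact heq.1 hb
    have B2 : ∀ a, Basic r t u T { σ₁ with re := Function.update σ₁.re 25 a } := fun a =>
      Basic.keep (σ := σ₁) (k := 25) (by norm_num) ⟨fun j hj => by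
        simp [Function.update_of_ne (show j ≠ 25 by omega)], fun _ => rfl⟩ B1
    have hX := hatXE_eval B1 (rep_pt hp0) true 1
    have hY := fun a => hatYE_eval (B2 a) (rep_pt (hp a)) 1 true
    -- With a single vertex there is no edge. The set is then a single point, and any center at
    -- distance `r` from it will do.
    obtain ⟨c, hc⟩ := F.surj ((hat u 1 1 e.pt).1 + rad r u, (hat u 1 1 e.pt).2)
    have hd : dist e.pt c = r := by
      rw [← F.sq_eq_iff I.pos, hc]; simp only [sq]; ring
    rw [hpt] at hd
    refine ⟨k1.trans ⟨fun j hj => ?_, fun _ => rfl⟩, ?_, c, ?_, R.covers_of_eq I.pos (I.gp s) hi hv hd,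
      _, R.mem hi.le, hd⟩
    · simp [Program.act, Function.update_of_ne (show j ≠ 25 by omega),
        Function.update_of_ne (show j ≠ 26 by omega), Function.update_of_ne (show j ≠ 27 by omega)]
    · simp [Program.act, RealExpr.eval]
    · rw [hc]
      refine Prod.ext ?_ ?_
      · simp [Program.act, RealExpr.eval, hX, B1.scaled]
      · simp [Program.act, hY]
  · rw [Program.act_cond_neg hb]
    have hv : v s i ≠ v s (i + 1) := by rw [← hpt, ← hnext]; exact mt heq.2 hb
    obtain ⟨c, h1, h2, h3, h4⟩ := R.exists_cover I.pos (I.gp s) hi hv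
    have hN := norm_pos_of_ne I.ne
    have h2' := (F.sq_eq_iff I.pos _ c).2 h2
    have h3' := (F.sq_eq_iff I.pos _ c).2 h3
    have hrp := fun a => rep_pt (hp a)
    have hrn := fun a => rep_next (hp a)
    have h5 := mul_nonneg hN.le h4
    cases s
    · obtain ⟨k2, h6, h7⟩ := center_act B1 hrn hrp
      refine ⟨k1.trans k2, h6, c, ?_, h1, _, R.mem hi.le, h2⟩
      rw [if_neg (by simp), h7, hpt, hnext]
      refine eq_ctr (F.inj.ne hv.symm) h3' h2' ?_
      rw [Frame.orient_hat]
      simp only [cross, sgn_false] at h5 ⊢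
      linarith
    · obtain ⟨k2, h6, h7⟩ := center_act B1 hrp hrn
      refine ⟨k1.trans k2, h6, c, ?_, h1, _, R.mem hi.le, h2⟩
      rw [if_pos rfl, h7, hpt, hnext]
      refine eq_ctr (F.inj.ne hv) h2' h3' ?_
      rw [Frame.orient_hat]
      simp only [cross, sgn_true] at h5 ⊢
      linarith

theorem Ensures.scan (I : Input r t u Q T n v) (B : Basic r t u T σ) (hh : (T s).height ≤ h) :
    Ensures h (CircularHull.scan s) σ fun σ' =>
      (∀ i < 30, i ≠ firstX s → i ≠ firstY s → i ≠ extR s → σ'.re i = σ.re i) ∧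
      (∀ s, σ'.ptr (root s) = σ.ptr (root s)) ∧
      σ'.re (firstX s) = v s 0 0 ∧ σ'.re (firstY s) = v s 0 1 ∧
      ∃ p, IsVertex r ↑(Q s) p ∧ σ'.re (extR s) = u 0 * p 0 + u 1 * p 1 ∧
        ∀ q, IsVertex r ↑(Q s) q → sgn s * σ'.re (extR s) ≤ sgn s * (u 0 * q 0 + u 1 * q 1) := by
  have R := I.ring s
  refine (Ensures.seq (Q' := fun σ' => (∀ i < 30, i ≠ firstX s → i ≠ firstY s → σ'.re i = σ.re i) ∧
    (∀ s, σ'.ptr (root s) = σ.ptr (root s)) ∧ Rep σ' (firstE s) (v s 0)) (Ensures.search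
      (A := fun _ => False) (B.root s) hh fun σ₁ _ e _ l r' _ => by simp [ltT_holds, RealExpr.eval])
      ?_).seq ?_
  · rintro σ₁ ⟨k, hf⟩
    rw [R.find_first] at hf
    refine Ensures.of_act (by simp [Program.LoopFree]) ⟨fun i hi h1 h2 => ?_, k.2, ?_⟩
    · simp [Program.act, Function.update_of_ne h1, Function.update_of_ne h2, k.1 i hi]
    · rw [← hf]
      cases s <;> simp [Program.act, Rep, firstE, firstX, firstY, RealExpr.eval, candE, cand, candX,
        candY]
  · rintro σ₁ ⟨k, kp, hf⟩
    have hk : ∀ i < 5, σ₁.re i = σ.re i := fun i hi =>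
      k i (by omega) (by cases s <;> simp [firstX] <;> omega) (by cases s <;> simp [firstY] <;> omega)
    have B1 : Basic r t u T σ₁ := B.keep le_rfl ⟨hk, kp⟩
    have hfirst : ∀ σ', Keep 30 σ₁ σ' → Rep σ' (firstE s) (v s 0) := fun σ' k' =>
      ⟨(k'.1 (firstX s) (by cases s <;> simp [firstX])).trans hf.1,
        (k'.1 (firstY s) (by cases s <;> simp [firstY])).trans hf.2⟩
    refine (Ensures.search (A := fun e => Active u (sgn s) true (v s 0) e.pt e.next) (B1.root s) hh
      fun σ₂ k2 e _ l r' hp => activeT_holds (B1.keep (by norm_num) k2) (hfirst σ₂ k2) hp).seq ?_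
    rintro σ₂ ⟨k2, hf2⟩
    obtain ⟨j, hj, hmin, hfind⟩ := R.find_min I.pos I.ne (I.gp s) (cand s σ₁)
    have hX := hatXE_eval (B1.keep (by norm_num) k2) (rep_cand (σ := σ₂) s) true 1
    rw [hf2, hfind] at hX
    have hfirst2 := hfirst σ₂ k2
    refine Ensures.of_act (P := .setReal _ _) trivial ⟨fun i hi h1 h2 h3 => ?_, fun s' => (k2.2 s').trans (kp s'), ?_, ?_,
      v s j, R.isVertex hj, ?_, ?_⟩
    · simp [Program.act, Function.update_of_ne h3, k2.1 i hi, k i hi h1 h2]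
    · rw [← hfirst2.1]; cases s <;> simp [Program.act, firstE, firstX, extR, RealExpr.eval]
    · rw [← hfirst2.2]; cases s <;> simp [Program.act, firstE, firstY, extR, RealExpr.eval]
    · simp [Program.act, hX, hat]
    · intro q hq
      obtain ⟨i, hi, rfl⟩ := (R.vertex q).2 hq
      simpa [Program.act, hX, hat] using hmin i hi.le

theorem Ensures.prepare (I : Input r t u Q T n v) (hh : (T true).height + (T false).height ≤ h) :
    Ensures h prepare (inputState r u t (T true) (T false)) fun σ => ∃ m, Extreme r u Q m ∧
      Env r t u T v m σ ∧ ∀ τ, σ.re (flagR τ) = 0 := by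
  obtain ⟨σ₀, hσ₀⟩ : ∃ σ₀, σ₀ = inputState r u t (T true) (T false) := ⟨_, rfl⟩
  rw [← hσ₀]
  refine (Ensures.of_act (P := .setReal 4 _) (Q := fun σ' => Basic r t u T σ' ∧
    ∀ τ, σ'.re (flagR τ) = 0) trivial ⟨⟨?_, ?_, ?_, ?_, ?_, fun s => ?_⟩, fun τ => ?_⟩).seq ?_
  · simp [Program.act, hσ₀, inputState]
  · simp [Program.act, hσ₀, inputState]
  · simp [Program.act, hσ₀, inputState]
  · simp [Program.act, hσ₀, inputState]
  · simp [Program.act, hσ₀, inputState, RealExpr.eval, rad]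
  · cases s <;> simp [Program.act, hσ₀, inputState, root]
  · cases τ <;> simp [Program.act, hσ₀, inputState, flagR]
  · rintro σ₁ ⟨B1, f1⟩
    refine (Ensures.scan (s := true) I B1 (by omega)).seq fun σ₂ ⟨k2, p2, x2, y2, p, hp, e2, m2⟩ => ?_
    have B2 : Basic r t u T σ₂ := B1.keep le_rfl ⟨fun i hi => k2 i (by omega) (by simp [firstX]; omega)
      (by simp [firstY]; omega) (by simp [extR]; omega), p2⟩
    refine (Ensures.scan (s := false) I B2 (by omega)).mono
      fun σ₃ ⟨k3, p3, x3, y3, q, hq, e3, m3⟩ => ?_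
    have B3 : Basic r t u T σ₃ := B2.keep le_rfl ⟨fun i hi => k3 i (by omega) (by simp [firstX]; omega)
      (by simp [firstY]; omega) (by simp [extR]; omega), p3⟩
    have x4 := k3 (firstX true) (by simp [firstX]) (by simp [firstX]) (by simp [firstX, firstY])
      (by simp [firstX, extR])
    have y4 := k3 (firstY true) (by simp [firstY]) (by simp [firstX, firstY]) (by simp [firstY])
      (by simp [firstY, extR])
    have e4 := k3 (extR true) (by simp [extR]) (by simp [firstX, extR]) (by simp [extR, firstY])
      (by simp [extR])
    refine ⟨fun s => σ₃.re (extR s), forall_side true ⟨p, hp, e4.trans e2,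
      fun q hq => by simpa only [e4] using m2 q hq⟩
      ⟨q, hq, e3, m3⟩, ⟨B3, forall_side true ⟨x4.trans x2, y4.trans y2⟩ ⟨x3, y3⟩, fun _ => rfl⟩,
      fun τ => ?_⟩
    rw [k3, k2, f1] <;> cases τ <;> simp [flagR, firstX, firstY, extR]

/-- Without an equidistant center one disk decides for each set: it covers the set and touches it.
If it covers the other set too, the touched set dominates; if it does not, the touched set does not
dominate. If neither set dominates, no disk covers both. -/
theorem Ensures.dominance (I : Input r t u Q T n v) (hm : Extreme r u Q m) (E : Env r t u T v m σ)
    (hh : (T true).height + (T false).height ≤ h)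
    (hE : ¬ Equi r u (Q true) (Q false) I.sep.neL I.sep.neR) :
    Ensures h dominance σ fun σ' => ∃ o, Reports σ' o ∧ Correct r ↑(Q true) ↑(Q false) o := by
  have step : ∀ (s : Bool) (σ : State), Env r t u T v m σ →
      Ensures h (.seq (edgeCenter s) (CircularHull.testCover !s)) σ fun σ' => Env r t u T v m σ' ∧
        ∃ c p, Covers r c ↑(Q s) ∧ p ∈ Q s ∧ dist p c = r ∧ (0 < σ'.re 27 ↔ Covers r c ↑(Q !s)) := by
    intro s σ E
    obtain ⟨k, h1, c, hc, h2, p, hp, h3⟩ := edgeCenter_act I E.toBasic s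
    refine (Ensures.of_act (Q := fun σ' => σ' = (edgeCenter s).act σ)
      (by cases s <;> simp [edgeCenter, center, Program.LoopFree]) rfl).seq ?_
    rintro _ rfl
    refine (Ensures.testCover (s := !s) I hm (E.keep (by norm_num) k)
      (by cases s <;> simp only [Bool.not_true, Bool.not_false] <;> omega) hc).mono fun σ' ht =>
      ⟨(E.keep (by norm_num) k).keep (by norm_num) ht.keep, c, p, h2, hp, h3, fun h4 => ?_, fun h4 => ?_⟩
    · by_contra hcon
      rw [ht.fail hcon] at h4
      exact lt_irrefl _ h4
    · rw [ht.pass h4, h1]; exact zero_lt_one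
  have hflag : ∀ σ : State, (ltT (.const 0) (.reg 27)).Holds σ ↔ 0 < σ.re 27 := fun σ => by
    simp [ltT_holds, RealExpr.eval]
  have union : ∀ c, Covers r c ↑(Q true) → Covers r c ↑(Q false) →
      HullExists r (↑(Q true) ∪ ↑(Q false)) := fun c h1 h2 => ⟨c, Set.union_subset h1 h2⟩
  refine (step true σ E).seq ?_
  rintro σ₁ ⟨E1, c, p, h1, hp, h2, h3⟩
  refine Ensures.cond (fun hb => ?_) fun hb => ?_
  · rw [hflag, h3] at hb
    exact Ensures.of_act (P := .setReal _ _) trivial ⟨.leftDominates, by simp [Reports, Program.act, RealExpr.eval],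
      union c h1 hb, I.sep.dominates_left hE h1 hb hp h2⟩
  · rw [hflag, h3] at hb
    refine (step false σ₁ E1).seq ?_
    rintro σ₂ ⟨-, c', p', h1', hp', h2', h3'⟩
    refine Ensures.cond (fun hb' => ?_) fun hb' => ?_
    · rw [hflag, h3'] at hb'
      exact Ensures.of_act (P := .setReal _ _) trivial ⟨.rightDominates, by simp [Reports, Program.act, RealExpr.eval],
        union c' hb' h1', I.sep.dominates_right hE hb' h1' hp' h2'⟩
    · rw [hflag, h3'] at hb'
      refine Ensures.of_act (P := .setReal _ _) trivial ⟨.noHull, by simp [Reports, Program.act, RealExpr.eval], ?_⟩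
      rintro ⟨o, ho⟩
      rcases I.sep.dominates hE (Set.subset_union_left.trans ho) (Set.subset_union_right.trans ho)
        with k | k
      · exact hb (k c h1)
      · exact hb' (k c' h1')

theorem reportTangents_act (hs : Sound r Q σ) (h : ∀ τ, 0 < σ.re (flagR τ)) (I : Input r t u Q T n v) :
    ∃ o, Reports (reportTangents.act σ) o ∧ Correct r ↑(Q true) ↑(Q false) o := by
  have h1 := hs true (h true)
  have h2 := hs false (h false)
  obtain ⟨c, k1, k2, -⟩ := id h1
  refine ⟨.tangents (out true true σ) (out true false σ) (out false true σ) (out false false σ), ?_,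
    ⟨c, Set.union_subset k1 k2⟩, (I.sep.not_dominated h1).1, (I.sep.not_dominated h1).2,
    fun a b => ?_, fun a b => ?_⟩
  · simp [Reports, reportTangents, Program.act, RealExpr.eval, out, outX, outY]
  · rw [isUpperTangent_iff]
    exact ⟨fun g => I.sep.tangent_unique (by norm_num) g h1, fun ⟨ha, hb⟩ => by rw [ha, hb]; exact h1⟩
  · rw [isLowerTangent_iff]
    exact ⟨fun g => I.sep.tangent_unique (by norm_num) g h2, fun ⟨ha, hb⟩ => by rw [ha, hb]; exact h2⟩

theorem Ensures.tangentProgram (I : Input r t u Q T n v) (hh : (T true).height + (T false).height ≤ h) :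
    Ensures h tangentProgram (inputState r u t (T true) (T false)) fun σ' =>
      ∃ o, Reports σ' o ∧ Correct r ↑(Q true) ↑(Q false) o := by
  refine (Ensures.prepare I hh).seq fun σ₁ ⟨m, hm, E, h0⟩ => ?_
  refine ((Ensures.attempts I hm E hh true).seq fun σ₂ ⟨k2, h2⟩ => (Ensures.attempts I hm
    (E.keep le_rfl k2.keep) hh false).mono fun σ₃ ⟨k3, h3⟩ =>
      (⟨k2.trans k3, forall_side true (fun g => k3.mono _ (h2 g)) h3⟩ : Advance r Q σ₁ σ₃ ∧
        ∀ τ, (∃ a b, Tangent (sgn τ) r (Q true) (Q false) a b) → 0 < σ₃.re (flagR τ))).seq ?_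
  rintro σ₂ ⟨k, hk⟩
  have hs : Sound r Q σ₂ := k.sound fun τ hτ => absurd hτ (by rw [h0]; exact lt_irrefl _)
  have hflags : (Test.and (ltT (.const 0) (.reg 19)) (ltT (.const 0) (.reg 20))).Holds σ₂ ↔
      ∀ τ, 0 < σ₂.re (flagR τ) := by
    simp only [Test.Holds, ltT_holds, RealExpr.eval, Rat.cast_zero]
    exact ⟨fun ⟨a, b⟩ => forall_side true a b, fun h => ⟨h true, h false⟩⟩
  refine Ensures.cond (fun hb => ?_) fun hb => ?_
  · exact Ensures.of_act (by simp [reportTangents, Program.LoopFree])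
      (reportTangents_act hs (hflags.1 hb) I)
  -- An equidistant center would give tangents of both kinds, and the attempts would have raised
  -- both flags.
  · refine Ensures.dominance I hm (E.keep le_rfl k.keep) hh fun hE => hb (hflags.2 fun τ => hk τ ?_)
    exact I.sep.exists_tangent hE (sgn_mul_self τ)

end

/-! ### Tree sizes and the final bound -/

theorem length_inorder : ∀ T : HullTree, (inorder T).length = T.numNodes
  | .nil => rfl
  | .node x l r => by
    simp only [inorder, List.length_append, List.length_cons, BinaryTree.numNodes, length_inorder l,
      length_inorder r]
    omega

theorem HullCycle.numNodes_le {r : ℝ} {Q : Finset Plane} {u : Plane} {σ : ℝ} {T : HullTree} {n : ℕ}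
    {v : ℕ → Plane} (R : HullCycle r Q u σ T n v) : T.numNodes ≤ Q.card := by
  rw [← length_inorder, R.len, ← Finset.card_range n]
  exact Finset.card_le_card_of_injOn v (fun i hi => R.mem (Finset.mem_range.1 hi).le)
    fun i hi j hj h => R.inj i (Finset.mem_range.1 hi) j (Finset.mem_range.1 hj) h

theorem StoresHullCcw.stored {r : ℝ} {Q : Set Plane} {u : Plane} {T : HullTree}
    (h : StoresHullCcw r Q u T) : Stored r Q u (sgn true) T := by
  simpa [Stored, StoresHullCcw] using h

theorem StoresHullCw.stored {r : ℝ} {Q : Set Plane} {u : Plane} {T : HullTree}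
    (h : StoresHullCw r Q (-u) T) : Stored r Q u (sgn false) T := by
  simpa [Stored, StoresHullCw] using h

/-- The absolute value makes the factor nonnegative, so the bound is monotone in `N` even though `β`
is an arbitrary real. -/
theorem Balanced.height_le {β : ℝ} {T : HullTree} (h : Balanced β T) {N : ℝ}
    (hN : (T.numNodes : ℝ) + 1 ≤ N) : (T.height : ℝ) ≤ |β| * Real.logb 2 N := by
  have h0 : (0 : ℝ) ≤ T.numNodes := Nat.cast_nonneg _
  have h1 : Real.logb 2 (T.numNodes + 1) ≤ Real.logb 2 N :=
    Real.logb_le_logb_of_le one_lt_two (by linarith) hN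
  have h2 : 0 ≤ Real.logb 2 ((T.numNodes : ℝ) + 1) := Real.logb_nonneg one_lt_two (by linarith)
  exact h.trans (mul_le_mul (le_abs_self β) h1 h2 (abs_nonneg β))

end CircularHull

theorem mainTheorem6 :
    ∃ P : CircularHull.Program, ∀ β : ℝ, ∃ C : ℝ,
      ∀ (r : ℝ) (L R : Finset CircularHull.Plane) (u : CircularHull.Plane) (t : ℝ)
        (T₁ T₂ : CircularHull.HullTree),
        0 < r → L.Nonempty → R.Nonempty →
        (∀ p ∈ L, inner ℝ u p < t) → (∀ q ∈ R, t < inner ℝ u q) →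
        CircularHull.GeneralPosition r (↑L ∪ ↑R) →
        CircularHull.HullExists r ↑L → CircularHull.HullExists r ↑R →
        CircularHull.Balanced β T₁ → CircularHull.Balanced β T₂ →
        CircularHull.StoresHullCcw r ↑L u T₁ → CircularHull.StoresHullCw r ↑R (-u) T₂ →
        ∃ (n : ℕ) (s : CircularHull.State) (o : CircularHull.Outcome),
          CircularHull.Runs P (CircularHull.inputState r u t T₁ T₂) n s ∧
          (n : ℝ) ≤ C * Real.log ((L.card : ℝ) + (R.card : ℝ)) ∧
          CircularHull.Reports s o ∧ CircularHull.Correct r ↑L ↑R o := by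
  -- The program is chosen before `β`. The cost is its weight times the sum of the two heights plus
  -- one: `2 * |β|` accounts for the heights, `1` for the additional unit, and the division by
  -- `Real.log 2` for the change of base.
  refine ⟨CircularHull.tangentProgram, fun β =>
    ⟨CircularHull.tangentProgram.weight * (2 * |β| + 1) / Real.log 2, ?_⟩⟩
  intro r L R u t T₁ T₂ hr hL hR hl hr' hgp hexL hexR hb₁ hb₂ hs₁ hs₂
  obtain ⟨n₁, v₁, R₁⟩ := hs₁.stored.ring hr hL hexL
  obtain ⟨n₂, v₂, R₂⟩ := hs₂.stored.ring hr hR hexR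
  have I : CircularHull.Input r t u (fun s => if s then L else R) (fun s => if s then T₁ else T₂)
      (fun s => if s then n₁ else n₂) (fun s => if s then v₁ else v₂) :=
    ⟨⟨hr, fun p hp => CircularHull.inner_eq u p ▸ hl p hp,
      fun q hq => CircularHull.inner_eq u q ▸ hr' q hq, hgp, hL, hR⟩,
      CircularHull.forall_side true R₁ R₂⟩
  obtain ⟨k, s, hrun, hk, o, ho, hc⟩ := CircularHull.Ensures.tangentProgram I le_rfl
  refine ⟨k, s, o, hrun, ?_, ho, hc⟩
  have c₁ : (1 : ℝ) ≤ L.card := by exact_mod_cast hL.card_pos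
  have c₂ : (1 : ℝ) ≤ R.card := by exact_mod_cast hR.card_pos
  have m₁ : (T₁.numNodes : ℝ) ≤ L.card := by exact_mod_cast R₁.numNodes_le
  have m₂ : (T₂.numNodes : ℝ) ≤ R.card := by exact_mod_cast R₂.numNodes_le
  -- The number of nodes plus one is within `N`, because the other set has at least one point. For
  -- the same reason `N` is at least two and its binary logarithm at least one.
  have h₁ := hb₁.height_le (N := L.card + R.card) (by linarith)
  have h₂ := hb₂.height_le (N := L.card + R.card) (by linarith)
  have hlog : 1 ≤ Real.logb 2 ((L.card : ℝ) + R.card) := by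
    rw [Real.le_logb_iff_rpow_le one_lt_two (by linarith), Real.rpow_one]
    linarith
  have hk' : (k : ℝ) ≤ CircularHull.tangentProgram.weight * (T₁.height + T₂.height + 1) := by
    exact_mod_cast hk
  refine hk'.trans ?_
  rw [mul_div_assoc, mul_assoc, div_mul_eq_mul_div, mul_div_assoc]
  refine mul_le_mul_of_nonneg_left ?_ (Nat.cast_nonneg _)
  change _ ≤ _ * Real.logb 2 _
  linarith
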